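/- Let $M$ be a smooth manifold (finite-dimensional, Hausdorff, second countable) and let $\Theta$ be a smooth bivector field on $M$, that is, a skew-symmetric $(2,0)$ tensor field, of constant rank. View $\Theta$ as a bundle morphism $T^*M\to TM$, $\xi\mapsto\Theta(\xi,\cdot)$, and let $\mathrm{Im}\,\Theta\subseteq TM$ be its image, a smooth distribution. At each point $x$, with $W=\mathrm{Im}\,\Theta_x$, the restriction of $\Theta_x$ to $W$ is the nondegenerate $(2,0)$ tensor $\Theta_W$ in $W$ given by $\Theta_W(\eta,\eta')=\Theta_x(\xi,\xi')$, where $\xi,\xi'\in T_x^*M$ are any extensions of $\eta,\eta'\in W^*$; its inverse is the skew-symmetric bilinear form $\zeta_x$ on $W$ corresponding to the inverse of the isomorphism $W^*\to W$, $\eta\mapsto\Theta_W(\eta,\cdot)$. Call $\Theta$ locally constant if around each point of $M$ there are local coordinates in which the components of $\Theta$ are constant, and integrable if $\nabla\Theta=0$ for some smooth torsion-free connection $\nabla$ on $M$. Call a distribution integrable if each point of $M$ lies in an integral manifold of it; its leaves are its maximal connected integral manifolds. Then the following three conditions are equivalent: (a) $\Theta$ is locally constant; (b) $\Theta$ is integrable;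 (c) the distribution $\mathrm{Im}\,\Theta$ is integrable and the $2$-form that $\zeta$ defines on each leaf of $\mathrm{Im}\,\Theta$ is closed. -/

import Mathlib

open Set Bundle NormedSpace
open scoped Manifold ContDiff

noncomputable section

namespace BivectorFields

section LinearAlgebra

variable {V : Type*} [AddCommGroup V] [Module ℝ V] [TopologicalSpace V] [IsTopologicalAddGroup V]
  [ContinuousSMul ℝ V] [T2Space V] [FiniteDimensional ℝ V]

/-- A (2,0) tensor in a finite-dimensional real vector space `V`, viewed as the linear map
`V* → V` sending `ξ` to the vector `Θ(ξ, ·) ∈ V** = V`; thus `Θ(ξ, η) = η (Θ ξ)`. This predicate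
says that the tensor is skew-symmetric, i.e. a bivector. -/
def IsSkew (Θ : (V →L[ℝ] ℝ) →L[ℝ] V) : Prop :=
  ∀ ξ η : V →L[ℝ] ℝ, η (Θ ξ) = -ξ (Θ η)

/-- The image `Im Θ ⊆ V` of a (2,0) tensor. -/
def im (Θ : (V →L[ℝ] ℝ) →L[ℝ] V) : Submodule ℝ V :=
  LinearMap.range (Θ : (V →L[ℝ] ℝ) →ₗ[ℝ] V)

/-- A linear projection of `V` onto a subspace `W`. -/
def proj (W : Submodule ℝ V) : V →L[ℝ] W :=
  LinearMap.toContinuousLinearMap (W.projectionOnto _ W.exists_isCompl.choose_spec)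

theorem proj_apply (W : Submodule ℝ V) (w : W) : proj W (w : V) = w :=
  Submodule.projectionOnto_apply_left W.exists_isCompl.choose_spec w

/-- The restriction of a (2,0) tensor `Θ` to `W = Im Θ`: the (2,0) tensor in `W`, viewed as a map
`W* → W`, which sends `η` to `Θ ξ`, where `ξ = η ∘ proj W` is an extension of `η` to `V`. See
`restrict_eq` and `restrict_form` for independence of the extension. -/
def restrict (Θ : (V →L[ℝ] ℝ) →L[ℝ] V) : (im Θ →L[ℝ] ℝ) →ₗ[ℝ] im Θ where
  toFun η := ⟨Θ (η ∘L proj (im Θ)), LinearMap.mem_range_self (Θ : (V →L[ℝ] ℝ) →ₗ[ℝ] V) _⟩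
  map_add' η η' := by
    apply Subtype.ext
    simp [ContinuousLinearMap.add_comp]
  map_smul' c η := by
    apply Subtype.ext
    simp [ContinuousLinearMap.smul_comp]

theorem map_eq_of_eqOn {Θ : (V →L[ℝ] ℝ) →L[ℝ] V} (hΘ : IsSkew Θ) {ξ ξ' : V →L[ℝ] ℝ}
    (h : ∀ w ∈ im Θ, ξ w = ξ' w) : Θ ξ = Θ ξ' := by
  rw [← sub_eq_zero, ← map_sub]
  by_contra hne
  have hdual : ∀ η : V →L[ℝ] ℝ, η (Θ (ξ - ξ')) = 0 := by
    intro η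
    rw [hΘ]
    have := h (Θ η) (LinearMap.mem_range_self (Θ : (V →L[ℝ] ℝ) →ₗ[ℝ] V) η)
    simp [this]
  exact hne ((Module.forall_dual_apply_eq_zero_iff ℝ _).1
    fun φ => hdual (LinearMap.toContinuousLinearMap φ))

theorem restrict_eq {Θ : (V →L[ℝ] ℝ) →L[ℝ] V} (hΘ : IsSkew Θ) (η : im Θ →L[ℝ] ℝ)
    (ξ : V →L[ℝ] ℝ) (hξ : ∀ w : im Θ, ξ w = η w) : (restrict Θ η : V) = Θ ξ := by
  refine map_eq_of_eqOn hΘ fun w hw => ?_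
  have := hξ ⟨w, hw⟩
  simp only at this
  rw [this, ContinuousLinearMap.comp_apply, proj_apply (im Θ) ⟨w, hw⟩]

/-- `Θ_W(η, η') = Θ(ξ, ξ')` for any extensions `ξ, ξ'` of `η, η'` to `V`. -/
theorem restrict_form {Θ : (V →L[ℝ] ℝ) →L[ℝ] V} (hΘ : IsSkew Θ) (η η' : im Θ →L[ℝ] ℝ)
    (ξ ξ' : V →L[ℝ] ℝ) (hξ : ∀ w : im Θ, ξ w = η w) (hξ' : ∀ w : im Θ, ξ' w = η' w) :
    η' (restrict Θ η) = ξ' (Θ ξ) := by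
  rw [← hξ', restrict_eq hΘ η ξ hξ]

/-- The restriction of a bivector to its image is nondegenerate. -/
theorem restrict_bijective {Θ : (V →L[ℝ] ℝ) →L[ℝ] V} (hΘ : IsSkew Θ) :
    Function.Bijective (restrict Θ) := by
  have hs : Function.Surjective (restrict Θ) := by
    rintro ⟨w, ξ, rfl⟩
    refine ⟨ξ ∘L (im Θ).subtypeL, Subtype.ext ?_⟩
    exact restrict_eq hΘ _ ξ fun w => rfl
  refine ⟨?_, hs⟩
  rw [injective_iff_map_eq_zero]
  intro η hη
  ext w
  obtain ⟨η', rfl⟩ := hs w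
  have h := hΘ (η ∘L proj (im Θ)) (η' ∘L proj (im Θ))
  have h1 : (restrict Θ η : V) = 0 := by rw [hη]; rfl
  have h2 : proj (im Θ) (restrict Θ η' : V) = restrict Θ η' := proj_apply _ _
  change (η' ∘L proj (im Θ)) (restrict Θ η : V) = -(η (proj (im Θ) (restrict Θ η' : V))) at h
  rw [h1, h2, map_zero] at h
  simpa using h.symm

/-- The inverse of the restriction of a bivector `Θ` to `W = Im Θ`: the bilinear form `ζ` on `W`
with `ζ(w, w') = η w'`, where `η ∈ W*` is the unique functional that the restriction of `Θ`
sends to `w`. -/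
def inverseForm (Θ : (V →L[ℝ] ℝ) →L[ℝ] V) (hΘ : IsSkew Θ) (w w' : im Θ) : ℝ :=
  (LinearEquiv.ofBijective (restrict Θ) (restrict_bijective hΘ)).symm w w'

theorem inverseForm_apply {Θ : (V →L[ℝ] ℝ) →L[ℝ] V} (hΘ : IsSkew Θ) (ξ : V →L[ℝ] ℝ)
    (w w' : im Θ) (hw : Θ ξ = w) : inverseForm Θ hΘ w w' = ξ w' := by
  have h : restrict Θ (ξ ∘L (im Θ).subtypeL) = w :=
    Subtype.ext ((restrict_eq hΘ _ ξ fun w => rfl).trans hw)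
  have : (LinearEquiv.ofBijective (restrict Θ) (restrict_bijective hΘ)).symm w
      = ξ ∘L (im Θ).subtypeL := by
    rw [LinearEquiv.symm_apply_eq]
    exact h.symm
  rw [inverseForm, this]
  rfl

theorem inverseForm_self {Θ : (V →L[ℝ] ℝ) →L[ℝ] V} (hΘ : IsSkew Θ) (w : im Θ) :
    inverseForm Θ hΘ w w = 0 := by
  obtain ⟨w, ξ, rfl⟩ := w
  rw [inverseForm_apply hΘ ξ _ _ rfl]
  have := hΘ ξ ξ
  change ξ (Θ ξ) = 0
  linarith

/-- For a linear map `A : F → V` with values in `W = Im Θ`, the linear map `F → F*` sending `u` to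
`ζ(A u, A ·)`, with `ζ` the inverse of the restriction of `Θ` to `W`. -/
def pullbackMap {F : Type*} [NormedAddCommGroup F] [NormedSpace ℝ F]
    (Θ : (V →L[ℝ] ℝ) →L[ℝ] V) (hΘ : IsSkew Θ) (A : F →L[ℝ] V) (hA : ∀ u, A u ∈ im Θ) :
    F →ₗ[ℝ] F →L[ℝ] ℝ where
  toFun u := (LinearEquiv.ofBijective (restrict Θ) (restrict_bijective hΘ)).symm ⟨A u, hA u⟩ ∘L
    A.codRestrict (im Θ) hA
  map_add' u v := by
    have : (⟨A (u + v), hA (u + v)⟩ : im Θ) = ⟨A u, hA u⟩ + ⟨A v, hA v⟩ :=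
      Subtype.ext (map_add A u v)
    rw [this, map_add, ContinuousLinearMap.add_comp]
  map_smul' c u := by
    have : (⟨A (c • u), hA (c • u)⟩ : im Θ) = c • ⟨A u, hA u⟩ :=
      Subtype.ext (map_smul A c u)
    rw [this, map_smul, ContinuousLinearMap.smul_comp, RingHom.id_apply]

/-- The pullback `(u, v) ↦ ζ(A u, A v)` of the inverse `ζ` of the restriction of `Θ` to `W = Im Θ`
under a linear map `A : F → V` with values in `W`, as an alternating 2-form on `F`. -/
def pullbackInverse {F : Type*} [NormedAddCommGroup F] [NormedSpace ℝ F] [FiniteDimensional ℝ F]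
    (Θ : (V →L[ℝ] ℝ) →L[ℝ] V) (hΘ : IsSkew Θ) (A : F →L[ℝ] V) (hA : ∀ u, A u ∈ im Θ) :
    F [⋀^Fin 2]→L[ℝ] ℝ where
  toFun u := inverseForm Θ hΘ ⟨A (u 0), hA (u 0)⟩ ⟨A (u 1), hA (u 1)⟩
  map_update_add' {_} u i x y := by
    change pullbackMap Θ hΘ A hA _ _ = pullbackMap Θ hΘ A hA _ _ + pullbackMap Θ hΘ A hA _ _
    fin_cases i <;> simp
  map_update_smul' {_} u i c x := by
    change pullbackMap Θ hΘ A hA _ _ = c • pullbackMap Θ hΘ A hA _ _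
    fin_cases i <;> simp
  cont := by
    change Continuous fun u : Fin 2 → F =>
      LinearMap.toContinuousLinearMap (pullbackMap Θ hΘ A hA) (u 0) (u 1)
    fun_prop
  map_eq_zero_of_eq' u i j h hij := by
    have h01 : u 0 = u 1 := by fin_cases i <;> fin_cases j <;> simp_all
    simp only [h01]
    exact inverseForm_self hΘ _

end LinearAlgebra

section Manifold

variable {E : Type*} [NormedAddCommGroup E] [NormedSpace ℝ E]
  {M : Type*} [TopologicalSpace M] [ChartedSpace E M]

instance (x : M) : T2Space (TangentSpace 𝓘(ℝ, E) x) := inferInstanceAs (T2Space E)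

instance [FiniteDimensional ℝ E] (x : M) : FiniteDimensional ℝ (TangentSpace 𝓘(ℝ, E) x) :=
  inferInstanceAs (FiniteDimensional ℝ E)

/-- A parametrized connected integral manifold of a distribution `D`: an injective smooth immersion
`f` into `M` of a nonempty connected open set `U ⊆ ℝᵏ`, whose tangent space at each point is the
fibre of `D`. -/
structure IsIntegralPatch (D : ∀ x : M, Submodule ℝ (TangentSpace 𝓘(ℝ, E) x)) {k : ℕ}
    (U : Set (EuclideanSpace ℝ (Fin k))) (f : EuclideanSpace ℝ (Fin k) → M) : Prop where
  isOpen : IsOpen U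
  isConnected : IsConnected U
  injOn : InjOn f U
  smooth : ContMDiffOn 𝓘(ℝ, EuclideanSpace ℝ (Fin k)) 𝓘(ℝ, E) ∞ f U
  immersion : ∀ p ∈ U,
    Function.Injective (mfderiv 𝓘(ℝ, EuclideanSpace ℝ (Fin k)) 𝓘(ℝ, E) f p)
  tangent : ∀ p ∈ U, ∀ v : TangentSpace 𝓘(ℝ, E) (f p),
    v ∈ D (f p) ↔ ∃ u, mfderiv 𝓘(ℝ, EuclideanSpace ℝ (Fin k)) 𝓘(ℝ, E) f p u = v

/-- A distribution is integrable if every point of `M` lies in an integral manifold. -/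
def IsIntegrableDistribution (D : ∀ x : M, Submodule ℝ (TangentSpace 𝓘(ℝ, E) x)) : Prop :=
  ∀ x : M, ∃ (k : ℕ) (U : Set (EuclideanSpace ℝ (Fin k))) (f : EuclideanSpace ℝ (Fin k) → M),
    IsIntegralPatch D U f ∧ x ∈ f '' U

/-- Two points lie in a common parametrized connected integral manifold of `D`. -/
def InCommonPatch (D : ∀ x : M, Submodule ℝ (TangentSpace 𝓘(ℝ, E) x)) (x y : M) : Prop :=
  ∃ (k : ℕ) (U : Set (EuclideanSpace ℝ (Fin k))) (f : EuclideanSpace ℝ (Fin k) → M),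
    IsIntegralPatch D U f ∧ x ∈ f '' U ∧ y ∈ f '' U

/-- The leaf through `x` of an integrable distribution `D`, that is, the maximal connected integral
manifold containing `x`: the set of all points which can be joined to `x` by a finite chain of
connected integral manifolds. Its manifold structure is the one for which the parametrized integral
manifolds contained in it are inverses of local coordinate systems. -/
def leaf (D : ∀ x : M, Submodule ℝ (TangentSpace 𝓘(ℝ, E) x)) (x : M) : Set M :=
  {y | Relation.ReflTransGen (InCommonPatch D) x y}

/-- A family of cotangent vectors is a smooth 1-form. -/
def IsSmoothOneForm [IsManifold 𝓘(ℝ, E) ∞ M]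
    (ξ : ∀ x : M, TangentSpace 𝓘(ℝ, E) x →L[ℝ] ℝ) : Prop :=
  ContMDiff 𝓘(ℝ, E) (𝓘(ℝ, E).prod 𝓘(ℝ, E →L[ℝ] ℝ)) ∞
    fun x => TotalSpace.mk' (E →L[ℝ] ℝ) (E := fun x : M => TangentSpace 𝓘(ℝ, E) x →L[ℝ] ℝ) x (ξ x)

theorem tensorialAt_dualDeriv [IsManifold 𝓘(ℝ, E) ∞ M]
    (cov : CovariantDerivative 𝓘(ℝ, E) E (TangentSpace 𝓘(ℝ, E) : M → Type _))
    {ξ : ∀ x : M, TangentSpace 𝓘(ℝ, E) x →L[ℝ] ℝ} (hξ : IsSmoothOneForm ξ) (x : M)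
    (v : TangentSpace 𝓘(ℝ, E) x) :
    TensorialAt 𝓘(ℝ, E) E (fun Y : ∀ x : M, TangentSpace 𝓘(ℝ, E) x =>
      mvfderiv 𝓘(ℝ, E) (fun y => ξ y (Y y)) x v - ξ x (cov Y x v)) x := by
  have key : ∀ Y : ∀ x : M, TangentSpace 𝓘(ℝ, E) x,
      MDifferentiableAt 𝓘(ℝ, E) 𝓘(ℝ, E).tangent (fun x => TotalSpace.mk' E x (Y x)) x →
      MDifferentiableAt 𝓘(ℝ, E) 𝓘(ℝ, ℝ) (fun y => ξ y (Y y)) x := by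
    intro Y hY
    have h := MDifferentiableAt.clm_bundle_apply (F₁ := E) (F₂ := ℝ)
      (E₁ := (TangentSpace 𝓘(ℝ, E) : M → Type _)) (E₂ := Bundle.Trivial M ℝ) (b := id)
      (ϕ := ξ) (v := Y) ((hξ x).mdifferentiableAt (by simp)) hY
    exact ((mdifferentiableAt_totalSpace _ _).1 h).2
  constructor
  · intro g Y hg hY
    have h1 := mvfderiv_fun_mul hg (key Y hY)
    have h2 := cov.isCovariantDerivativeOnUniv.leibniz hY hg
    simp only [Pi.smul_apply', map_smul, smul_eq_mul, h1, h2]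
    simp
    ring
  · intro Y Y' hY hY'
    have h1 := mvfderiv_fun_add (key Y hY) (key Y' hY')
    have h2 := cov.isCovariantDerivativeOnUniv.add hY hY'
    simp only [Pi.add_apply, map_add, h1, h2]
    simp
    ring

/-- The covariant derivative `∇_v ξ` of a smooth 1-form, in the connection on `T*M` induced by a
connection on `TM`: `(∇_v ξ) Y = d_v (ξ Y) - ξ (∇_v Y)`. -/
def dualDeriv [FiniteDimensional ℝ E] [IsManifold 𝓘(ℝ, E) ∞ M]
    (cov : CovariantDerivative 𝓘(ℝ, E) E (TangentSpace 𝓘(ℝ, E) : M → Type _))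
    (ξ : ∀ x : M, TangentSpace 𝓘(ℝ, E) x →L[ℝ] ℝ) (hξ : IsSmoothOneForm ξ) (x : M)
    (v : TangentSpace 𝓘(ℝ, E) x) : TangentSpace 𝓘(ℝ, E) x →L[ℝ] ℝ :=
  TensorialAt.mkHom _ x (tensorialAt_dualDeriv cov hξ x v)

variable (E M) in
/-- A (smooth) bivector field on `M`: a smooth skew-symmetric (2,0) tensor field, treated as a
vector-bundle morphism `T*M → TM`. -/
structure Bivector [IsManifold 𝓘(ℝ, E) ∞ M] where
  toFun : ∀ x : M, (TangentSpace 𝓘(ℝ, E) x →L[ℝ] ℝ) →L[ℝ] TangentSpace 𝓘(ℝ, E) x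
  smooth : ContMDiff 𝓘(ℝ, E) (𝓘(ℝ, E).prod 𝓘(ℝ, (E →L[ℝ] ℝ) →L[ℝ] E)) ∞
    fun x => TotalSpace.mk' ((E →L[ℝ] ℝ) →L[ℝ] E)
      (E := fun x : M => (TangentSpace 𝓘(ℝ, E) x →L[ℝ] ℝ) →L[ℝ] TangentSpace 𝓘(ℝ, E) x)
      x (toFun x)
  skew : ∀ x, IsSkew (toFun x)

namespace Bivector

variable [FiniteDimensional ℝ E] [IsManifold 𝓘(ℝ, E) ∞ M]

/-- The distribution `Im Θ`. -/
def image (Θ : Bivector E M) (x : M) : Submodule ℝ (TangentSpace 𝓘(ℝ, E) x) := im (Θ.toFun x)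

/-- `Θ` has constant rank. -/
def HasConstantRank (Θ : Bivector E M) : Prop :=
  ∃ r : ℕ, ∀ x, Module.finrank ℝ (Θ.image x) = r

/-- `Θ` is locally constant: around each point there are local coordinates in which the components
`Θ(dx^i, dx^j)` are constant. -/
def IsLocallyConstant (Θ : Bivector E M) : Prop :=
  ∀ x : M, ∃ φ ∈ IsManifold.maximalAtlas 𝓘(ℝ, E) ∞ M, x ∈ φ.source ∧
    ∃ B : (E →L[ℝ] ℝ) → (E →L[ℝ] ℝ) → ℝ, ∀ y ∈ φ.source, ∀ α β : E →L[ℝ] ℝ,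
      (β ∘L mvfderiv 𝓘(ℝ, E) φ y) (Θ.toFun y (α ∘L mvfderiv 𝓘(ℝ, E) φ y)) = B α β

/-- `Θ` is parallel, `∇Θ = 0`, that is, `∇_v (Θ ξ) = Θ (∇_v ξ)` for all 1-forms `ξ` and tangent
vectors `v`. -/
def IsParallel (Θ : Bivector E M)
    (cov : CovariantDerivative 𝓘(ℝ, E) E (TangentSpace 𝓘(ℝ, E) : M → Type _)) : Prop :=
  ∀ (ξ : ∀ x : M, TangentSpace 𝓘(ℝ, E) x →L[ℝ] ℝ) (hξ : IsSmoothOneForm ξ) (x : M)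
    (v : TangentSpace 𝓘(ℝ, E) x),
    cov (fun y => Θ.toFun y (ξ y)) x v = Θ.toFun x (dualDeriv cov ξ hξ x v)

/-- `Θ` is integrable: some smooth torsion-free connection on `M` makes it parallel. -/
def IsIntegrable (Θ : Bivector E M) : Prop :=
  ∃ cov : CovariantDerivative 𝓘(ℝ, E) E (TangentSpace 𝓘(ℝ, E) : M → Type _),
    cov.ContMDiffCovariantDerivative ∞ ∧ cov.torsion = 0 ∧ Θ.IsParallel cov

open scoped Classical in
/-- The pullback to `U`, under a parametrized integral manifold `f : U → M` of `Im Θ`, of the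
inverse of the restriction of `Θ` to `Im Θ` (set equal to `0` outside the open set `U`). This is the
restriction of that inverse to the integral manifold, in the local coordinates given by `f`. -/
def inverseOnPatch (Θ : Bivector E M) {k : ℕ} {U : Set (EuclideanSpace ℝ (Fin k))}
    {f : EuclideanSpace ℝ (Fin k) → M} (hf : IsIntegralPatch Θ.image U f)
    (p : EuclideanSpace ℝ (Fin k)) : EuclideanSpace ℝ (Fin k) [⋀^Fin 2]→L[ℝ] ℝ :=
  if hp : p ∈ U then
    pullbackInverse (Θ.toFun (f p)) (Θ.skew (f p))
      (mfderiv 𝓘(ℝ, EuclideanSpace ℝ (Fin k)) 𝓘(ℝ, E) f p ∘L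
        ((fromTangentSpace (𝕜 := ℝ) p).symm :
          EuclideanSpace ℝ (Fin k) →L[ℝ] TangentSpace 𝓘(ℝ, EuclideanSpace ℝ (Fin k)) p))
      (fun _ => (hf.tangent p hp _).2 ⟨_, rfl⟩)
  else 0

/-- The inverse of the restriction of `Θ` to `Im Θ` is closed along a leaf `L` of `Im Θ`: in the
local coordinates of `L`, this 2-form on `L` has zero exterior derivative. -/
def InverseClosedAlong (Θ : Bivector E M) (L : Set M) : Prop :=
  ∀ (k : ℕ) (U : Set (EuclideanSpace ℝ (Fin k))) (f : EuclideanSpace ℝ (Fin k) → M)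
    (hf : IsIntegralPatch Θ.image U f), f '' U ⊆ L →
    ∀ p ∈ U, extDeriv (Θ.inverseOnPatch hf) p = 0

end Bivector

end Manifold

end BivectorFields

end

/-!
All three conditions are equivalent to the Jacobi identity, in every chart, for the bracket
`{f, g} = Θ(df, dg)`.

If `∇Θ = 0` for a torsion-free `∇`, the derivatives of the components of `Θ` are expressed through
the Christoffel symbols, which cancel from the cyclic sum by symmetry. If `Im Θ` is integrable,
every Hamiltonian field is tangent to the leaves, where `ζ` is inverse to `Θ`, and differentiating
this inverse turns `dζ` into the cyclic sum of the Jacobi identity.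

Conversely, let the Jacobi identity hold and let `Θ` have constant rank `r`. Functions with constant
mutual brackets have commuting Hamiltonian fields. As long as there are fewer than `r` of them, with
linearly independent fields, a linear function of coordinates straightening these fields is a
further such function. Given `r` of them, take these functions as the first coordinates, and as the
others functions killed by their Hamiltonian fields, that is, Casimir functions: in these
coordinates `Θ` is constant.

In coordinates where `Θ` is constant the leaves are affine slices, on which `ζ` is constant, and the
flat connection of the coordinates preserves `Θ`. The torsion-free connections preserving `Θ` form
an affine space, so a partition of unity glues these flat connections.
-/


noncomputable section

namespace BivectorFields

open Filter Topology

section InverseFunction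

variable {E F : Type*} [NormedAddCommGroup E] [NormedSpace ℝ E]
  [NormedAddCommGroup F] [NormedSpace ℝ F]

/-- A smooth diffeomorphism between open subsets of two normed spaces. -/
structure IsSmoothDiffeo (e : OpenPartialHomeomorph E F) : Prop where
  contDiffOn : ContDiffOn ℝ ∞ e e.source
  contDiffOn_symm : ContDiffOn ℝ ∞ e.symm e.target

namespace IsSmoothDiffeo

variable {e : OpenPartialHomeomorph E F} {x : E}

theorem symm (he : IsSmoothDiffeo e) : IsSmoothDiffeo e.symm :=
  ⟨he.contDiffOn_symm, he.contDiffOn⟩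

theorem contDiffAt (he : IsSmoothDiffeo e) (hx : x ∈ e.source) : ContDiffAt ℝ ∞ e x :=
  he.contDiffOn.contDiffAt (e.open_source.mem_nhds hx)

theorem hasFDerivAt (he : IsSmoothDiffeo e) (hx : x ∈ e.source) :
    HasFDerivAt e (fderiv ℝ e x) x :=
  ((he.contDiffAt hx).differentiableAt (by simp)).hasFDerivAt

theorem fderiv_symm_comp_fderiv (he : IsSmoothDiffeo e) (hx : x ∈ e.source) :
    fderiv ℝ e.symm (e x) ∘L fderiv ℝ e x = ContinuousLinearMap.id ℝ E := by
  have hcomp : HasFDerivAt (e.symm ∘ e) (fderiv ℝ e.symm (e x) ∘L fderiv ℝ e x) x :=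
    (he.symm.hasFDerivAt (e.map_source hx)).comp x (he.hasFDerivAt hx)
  exact hcomp.unique ((hasFDerivAt_id x).congr_of_eventuallyEq (e.eventually_left_inverse hx))

theorem isInvertible_fderiv (he : IsSmoothDiffeo e) (hx : x ∈ e.source) :
    (fderiv ℝ e x).IsInvertible := by
  refine .of_inverse (g := fderiv ℝ e.symm (e x)) ?_ (he.fderiv_symm_comp_fderiv hx)
  simpa only [e.left_inv hx, e.symm_symm] using he.symm.fderiv_symm_comp_fderiv (e.map_source hx)

end IsSmoothDiffeo

theorem eventually_isInvertible [CompleteSpace E] {A : E →L[ℝ] F} (hA : A.IsInvertible) :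
    ∀ᶠ B in 𝓝 A, B.IsInvertible := by
  obtain ⟨g, rfl⟩ := hA
  exact g.nhds

theorem exists_isSmoothDiffeo [CompleteSpace E] {f : E → F} {f' : E ≃L[ℝ] F} {a : E} {s : Set E}
    (hf : ∀ᶠ x in 𝓝 a, ContDiffAt ℝ ∞ f x) (hf' : HasFDerivAt f (f' : E →L[ℝ] F) a)
    (hs : s ∈ 𝓝 a) :
    ∃ e : OpenPartialHomeomorph E F, IsSmoothDiffeo e ∧ a ∈ e.source ∧ e.source ⊆ s ∧ ⇑e = f := by
  have hinv : ∀ᶠ x in 𝓝 a, (fderiv ℝ f x).IsInvertible := by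
    have hcont : ContinuousAt (fderiv ℝ f) a :=
      (hf.self_of_nhds.fderiv_right (m := 0) (by simp)).continuousAt
    exact hcont.eventually (eventually_isInvertible ⟨f', hf'.fderiv.symm⟩)
  obtain ⟨u, hu, huo, hau⟩ := eventually_nhds_iff.1 ((hf.and hinv).and hs)
  let e := (hf.self_of_nhds.toOpenPartialHomeomorph f hf' (by simp)).restrOpen u huo
  refine ⟨e, ⟨fun x hx => (hu x hx.2).1.1.contDiffWithinAt, fun y hy => ?_⟩,
    ⟨hf.self_of_nhds.mem_toOpenPartialHomeomorph_source hf' (by simp), hau⟩,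
    fun x hx => (hu x hx.2).2, rfl⟩
  obtain ⟨hc, g, hg⟩ := (hu _ (e.map_target hy).2).1
  exact (e.contDiffAt_symm hy (hg ▸ (hc.differentiableAt (by simp)).hasFDerivAt)
    hc).contDiffWithinAt

end InverseFunction

section ImplicitFunction

variable {E₁ E₂ F : Type*} [NormedAddCommGroup E₁] [NormedSpace ℝ E₁] [CompleteSpace E₁]
  [NormedAddCommGroup E₂] [NormedSpace ℝ E₂] [CompleteSpace E₂]
  [NormedAddCommGroup F] [NormedSpace ℝ F] [CompleteSpace F]

/- At each nearby zero, local uniqueness identifies the implicit function with the one based at that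
zero; this is needed because `ContDiffAt ℝ ∞` at a point is not an open condition. -/
theorem eventually_contDiffAt_implicitFunction {f : E₁ × E₂ → F} {u : E₁ × E₂} {n : WithTop ℕ∞}
    (hf : ∀ᶠ w in 𝓝 u, ContDiffAt ℝ n f w) (hn : n ≠ 0)
    (hu : (fderiv ℝ f u ∘L .inr ℝ E₁ E₂).IsInvertible) :
    ∀ᶠ x in 𝓝 u.1, ContDiffAt ℝ n (hf.self_of_nhds.implicitFunction hn hu) x := by
  set ψ := hf.self_of_nhds.implicitFunction hn hu with hψ
  have hn1 : 1 ≤ n := ENat.one_le_iff_ne_zero_withTop.2 hn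
  have hψu : ContDiffAt ℝ n ψ u.1 := hf.self_of_nhds.contDiffAt_implicitFunction hn hu
  have hgraph : Tendsto (fun x => (x, ψ x)) (𝓝 u.1) (𝓝 u) := by
    have : ContinuousAt (fun x => (x, ψ x)) u.1 := continuousAt_id.prodMk hψu.continuousAt
    rwa [ContinuousAt, hψ, hf.self_of_nhds.implicitFunction_apply_self hn hu] at this
  have hinv : ∀ᶠ w in 𝓝 u, (fderiv ℝ f w ∘L .inr ℝ E₁ E₂).IsInvertible := by
    have hcont : ContinuousAt (fun w => fderiv ℝ f w ∘L ContinuousLinearMap.inr ℝ E₁ E₂) u :=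
      (hf.self_of_nhds.fderiv_right (m := 0) (by simpa using hn1)).continuousAt.clm_comp
        continuousAt_const
    exact hcont.eventually (eventually_isInvertible hu)
  have hψc : ∀ᶠ x in 𝓝 u.1, ContinuousAt ψ x :=
    ((hψu.of_le hn1).eventually (by simp)).mono fun x hx => hx.continuousAt
  filter_upwards [hgraph.eventually (hf.and hinv), hψc,
    (hf.self_of_nhds.eventually_apply_implicitFunction hn hu).eventually_nhds]
    with x ⟨hfx, hinvx⟩ hcx hzero
  refine (hfx.contDiffAt_implicitFunction hn hinvx).congr_of_eventuallyEq ?_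
  filter_upwards [hzero, (continuousAt_id.prodMk hcx).eventually
    (hfx.eventually_apply_eq_iff_implicitFunction hn hinvx)] with y hy hiff
  exact (hiff.1 (hy.trans hzero.self_of_nhds.symm)).symm

end ImplicitFunction

section Superposition

variable {K : Type*} [TopologicalSpace K] [CompactSpace K]
  {E F : Type*} [NormedAddCommGroup E] [NormedSpace ℝ E]
  [NormedAddCommGroup F] [NormedSpace ℝ F]

/- Shortcut instances: the generic search for these structures times out. -/
instance : SeminormedAddCommGroup C(K, E →L[ℝ] F) := ContinuousMap.instSeminormedAddCommGroup

instance : NormedAddCommGroup C(K, E →L[ℝ] F) := ContinuousMap.instNormedAddCommGroup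

instance : SeminormedAddCommGroup (C(K, E) →L[ℝ] C(K, F)) :=
  ContinuousLinearMap.toSeminormedAddCommGroup

variable (K E F) in
/-- Pointwise application of a continuous family of continuous linear maps; it expresses the
derivative of a superposition operator `γ ↦ X ∘ γ`. -/
def pointwiseApply : C(K, E →L[ℝ] F) →L[ℝ] C(K, E) →L[ℝ] C(K, F) :=
  LinearMap.mkContinuous₂ (LinearMap.mk₂ ℝ
    (fun (A : C(K, E →L[ℝ] F)) (h : C(K, E)) => (⟨fun t => A t (h t), by fun_prop⟩ : C(K, F)))
    (fun _ _ _ => by ext; simp) (fun _ _ _ => by ext; simp)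
    (fun _ _ _ => by ext; simp) (fun _ _ _ => by ext; simp)) 1 fun A h => by
      rw [ContinuousMap.norm_le _ (by positivity), one_mul]
      exact fun t => (A t).le_of_opNorm_le_of_le (A.norm_coe_le_norm t) (h.norm_coe_le_norm t)

@[simp] theorem pointwiseApply_apply (A : C(K, E →L[ℝ] F)) (h : C(K, E)) (t : K) :
    pointwiseApply K E F A h t = A t (h t) := rfl

theorem hasFDerivAt_continuousMap_comp {X : C(E, F)} {X' : C(E, E →L[ℝ] F)}
    (hX : ∀ x, HasFDerivAt X (X' x) x) (γ : C(K, E)) :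
    HasFDerivAt (fun γ : C(K, E) => X.comp γ) (pointwiseApply K E F (X'.comp γ)) γ := by
  rw [hasFDerivAt_iff_isLittleO_nhds_zero, Asymptotics.isLittleO_iff]
  intro ε hε
  obtain ⟨δ, hδ, hX'⟩ := Metric.mem_uniformity_dist.1 <|
    (isCompact_range γ.continuous).uniformContinuousAt_of_continuousAt X'
      (fun _ _ => X'.continuous.continuousAt) (Metric.dist_mem_uniformity hε)
  filter_upwards [Metric.ball_mem_nhds (0 : C(K, E)) hδ] with h hh
  rw [ContinuousMap.norm_le _ (by positivity)]
  intro t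
  have hht : ‖h t‖ < δ := (h.norm_coe_le_norm t).trans_lt (by simpa using hh)
  have hbound : ∀ x ∈ Metric.ball (γ t) δ, ‖X' x - X' (γ t)‖ ≤ ε := fun x hx => by
    rw [← dist_eq_norm, dist_comm]
    exact (hX' (dist_comm x (γ t) ▸ hx) (mem_range_self t)).le
  calc ‖(X.comp (γ + h) - X.comp γ - pointwiseApply K E F (X'.comp γ) h) t‖
      = ‖X (γ t + h t) - X (γ t) - X' (γ t) (γ t + h t - γ t)‖ := by simp
    _ ≤ ε * ‖γ t + h t - γ t‖ :=
        (convex_ball (γ t) δ).norm_image_sub_le_of_norm_hasFDerivWithin_le'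
          (fun x _ => (hX x).hasFDerivWithinAt) hbound (Metric.mem_ball_self hδ)
          (by simpa using hht)
    _ ≤ ε * ‖h‖ := by
        rw [add_sub_cancel_left]
        gcongr
        exact h.norm_coe_le_norm t

universe u in
theorem contDiff_nat_continuousMap_comp {E : Type u} [NormedAddCommGroup E] [NormedSpace ℝ E]
    (n : ℕ) {F : Type u} [NormedAddCommGroup F] [NormedSpace ℝ F] (X : C(E, F))
    (hX : ContDiff ℝ n X) : ContDiff ℝ n fun γ : C(K, E) => X.comp γ := by
  induction n generalizing F with
  | zero => exact contDiff_zero.2 (ContinuousMap.continuous_postcomp X)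
  | succ n ih =>
    have hX' : ContDiff ℝ n (fderiv ℝ X) := hX.fderiv_right (by simp)
    let X' : C(E, E →L[ℝ] F) := ⟨fderiv ℝ X, hX'.continuous⟩
    have hd : ∀ γ : C(K, E), HasFDerivAt (fun γ : C(K, E) => X.comp γ)
        (pointwiseApply K E F (X'.comp γ)) γ :=
      hasFDerivAt_continuousMap_comp fun x => (hX.differentiable (by simp) x).hasFDerivAt
    rw [Nat.cast_add, Nat.cast_one, contDiff_succ_iff_fderiv]
    refine ⟨fun γ => (hd γ).differentiableAt, fun h => absurd h (by simp), ?_⟩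
    rw [funext fun γ => (hd γ).fderiv]
    exact (pointwiseApply K E F).contDiff.comp (ih X' hX')

universe u in
theorem contDiff_continuousMap_comp {E F : Type u} [NormedAddCommGroup E] [NormedSpace ℝ E]
    [NormedAddCommGroup F] [NormedSpace ℝ F] {X : C(E, F)} (hX : ContDiff ℝ ∞ X) :
    ContDiff ℝ ∞ fun γ : C(K, E) => X.comp γ :=
  contDiff_infty.2 fun n => contDiff_nat_continuousMap_comp n X (contDiff_infty.1 hX n)

end Superposition

section Primitive

variable {E : Type*} [NormedAddCommGroup E] [NormedSpace ℝ E]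

variable (E) in
/-- The Volterra operator, sending a curve `γ` to its primitive vanishing at `0`. -/
def primitive : C(unitInterval, E) →L[ℝ] C(unitInterval, E) :=
  LinearMap.mkContinuous
    { toFun := fun γ => ⟨fun τ => ∫ σ in (0 : ℝ)..τ, IccExtend zero_le_one γ σ,
        (intervalIntegral.continuous_primitive
          (fun _ _ => γ.continuous.Icc_extend'.intervalIntegrable _ _) 0).comp
          continuous_subtype_val⟩
      map_add' := fun γ γ' => by
        ext τ
        exact intervalIntegral.integral_add
          (γ.continuous.Icc_extend'.intervalIntegrable _ _)
          (γ'.continuous.Icc_extend'.intervalIntegrable _ _)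
      map_smul' := fun c γ => by
        ext τ
        exact intervalIntegral.integral_smul _ _ }
    1 fun γ => by
      rw [one_mul, ContinuousMap.norm_le _ (norm_nonneg _)]
      intro τ
      refine (intervalIntegral.norm_integral_le_of_norm_le_const (C := ‖γ‖)
        fun σ _ => γ.norm_coe_le_norm _).trans ?_
      rw [sub_zero, abs_of_nonneg τ.2.1]
      exact mul_le_of_le_one_right (norm_nonneg _) τ.2.2

theorem primitive_apply (γ : C(unitInterval, E)) (τ : unitInterval) :
    primitive E γ τ = ∫ σ in (0 : ℝ)..τ, IccExtend zero_le_one γ σ := rfl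

variable [CompleteSpace E]

theorem eq_primitive_of_hasDerivAt {γ u : C(unitInterval, E)} {c : ℝ → E}
    (hc : ∀ τ : unitInterval, c τ = γ τ) (hc0 : c 0 = 0)
    (hderiv : ∀ τ : unitInterval, HasDerivAt c (u τ) τ) : γ = primitive E u := by
  ext τ
  have hsub : ∀ σ ∈ uIcc (0 : ℝ) τ, HasDerivAt c (IccExtend zero_le_one u σ) σ := by
    intro σ hσ
    rw [uIcc_of_le τ.2.1] at hσ
    have hσ' : σ ∈ unitInterval := ⟨hσ.1, hσ.2.trans τ.2.2⟩
    rw [IccExtend_of_mem _ _ hσ']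
    exact hderiv ⟨σ, hσ'⟩
  rw [primitive_apply, intervalIntegral.integral_eq_sub_of_hasDerivAt hsub
    (u.continuous.Icc_extend'.intervalIntegrable _ _), hc, hc0, sub_zero]

theorem hasDerivAt_integral_IccExtend (u : C(unitInterval, E)) (τ : unitInterval) :
    HasDerivAt (fun τ : ℝ => ∫ σ in (0 : ℝ)..τ, IccExtend zero_le_one u σ) (u τ) τ := by
  have hderiv := ((u.continuous.Icc_extend' (h := zero_le_one)).integral_hasStrictDerivAt 0
    (τ : ℝ)).hasDerivAt
  rwa [IccExtend_val] at hderiv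

end Primitive

section JointFlow

open VectorField

universe u

variable {E : Type u} [NormedAddCommGroup E] [NormedSpace ℝ E] {ι : Type*} [Fintype ι]

/-- The defect of a curve `γ` on `[0, 1]` as a solution of `γ' = ∑ tⱼ Xⱼ(γ)`, `γ 0 = s`, in
integrated form, as a function of `((t, s), γ)`. -/
def flowDefect (X : ι → C(E, E)) (w : ((ι → ℝ) × E) × C(unitInterval, E)) : C(unitInterval, E) :=
  w.2 - ContinuousMap.const _ w.1.2 - primitive E (∑ j, w.1.1 j • (X j).comp w.2)

/-- The linear operator `h ↦ ∫ ∑ tⱼ Xⱼ'(γ) h` in the integrated variational equation along `γ`. -/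
def variationalOp (X' : ι → C(E, E →L[ℝ] E)) (t : ι → ℝ) (γ : C(unitInterval, E)) :
    C(unitInterval, E) →L[ℝ] C(unitInterval, E) :=
  primitive E ∘L ∑ j, t j • pointwiseApply unitInterval E E ((X' j).comp γ)

variable {X : ι → C(E, E)} {X' : ι → C(E, E →L[ℝ] E)}

theorem flowDefect_eq_zero_iff {v : (ι → ℝ) × E} {γ : C(unitInterval, E)} :
    flowDefect X (v, γ) = 0 ↔
      γ = ContinuousMap.const _ v.2 + primitive E (∑ j, v.1 j • (X j).comp γ) := by
  rw [flowDefect, sub_sub, sub_eq_zero]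

theorem contDiff_flowDefect (hX : ∀ j, ContDiff ℝ ∞ (X j)) : ContDiff ℝ ∞ (flowDefect X) := by
  have hconst : ContDiff ℝ ∞ fun w : ((ι → ℝ) × E) × C(unitInterval, E) =>
      ContinuousMap.const unitInterval w.1.2 :=
    (ContinuousLinearMap.const (M := E) ℝ unitInterval).contDiff.comp
      (contDiff_snd.comp contDiff_fst)
  refine (contDiff_snd.sub hconst).sub ((primitive E).contDiff.comp (ContDiff.sum fun j _ => ?_))
  have htime : ContDiff ℝ ∞ fun w : ((ι → ℝ) × E) × C(unitInterval, E) => w.1.1 j :=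
    (contDiff_apply ℝ ℝ j).comp (contDiff_fst.comp contDiff_fst)
  exact htime.smul ((contDiff_continuousMap_comp (hX j)).comp contDiff_snd)

theorem fderiv_flowDefect_comp_inr (hX : ∀ j, ContDiff ℝ ∞ (X j)) (x : E)
    (γ : C(unitInterval, E)) :
    fderiv ℝ (flowDefect X) ((0, x), γ) ∘L .inr ℝ ((ι → ℝ) × E) C(unitInterval, E) =
      ContinuousLinearMap.id ℝ _ := by
  have hcomp := (((contDiff_flowDefect hX).differentiable (by simp) _).hasFDerivAt).comp γ
    (hasFDerivAt_prodMk_right (𝕜 := ℝ) ((0 : ι → ℝ), x) γ)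
  have hsub := (hasFDerivAt_id (𝕜 := ℝ) γ).sub_const (ContinuousMap.const _ x)
  refine hcomp.unique (hsub.congr_of_eventuallyEq (.of_forall fun γ => ?_))
  simp [flowDefect]

theorem exists_flowDefect_eq_zero [CompleteSpace E] (hX : ∀ j, ContDiff ℝ ∞ (X j)) (x₀ : E) :
    ∃ Γ : (ι → ℝ) × E → C(unitInterval, E), Γ (0, x₀) = ContinuousMap.const _ x₀ ∧
      (∀ᶠ v in 𝓝 (0, x₀), ContDiffAt ℝ ∞ Γ v) ∧
      ∀ᶠ v in 𝓝 (0, x₀), flowDefect X (v, Γ v) = 0 := by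
  set u : ((ι → ℝ) × E) × C(unitInterval, E) := ((0, x₀), ContinuousMap.const _ x₀) with hu
  have hsmooth : ∀ᶠ w in 𝓝 u, ContDiffAt ℝ ∞ (flowDefect X) w :=
    .of_forall fun _ => (contDiff_flowDefect hX).contDiffAt
  have hinv : (fderiv ℝ (flowDefect X) u ∘L .inr ℝ _ _).IsInvertible := by
    rw [fderiv_flowDefect_comp_inr hX]
    exact ⟨.refl ℝ _, rfl⟩
  refine ⟨_, hsmooth.self_of_nhds.implicitFunction_apply_self (by simp) hinv,
    eventually_contDiffAt_implicitFunction hsmooth (by simp) hinv, ?_⟩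
  have hzero : flowDefect X u = 0 := by simp [flowDefect, hu]
  simpa only [hzero] using
    hsmooth.self_of_nhds.eventually_apply_implicitFunction (by simp) hinv

theorem smul_comp_eq_primitive_add_variationalOp [CompleteSpace E]
    (hX : ∀ i x, HasFDerivAt (X i) (X' i x) x) {v : (ι → ℝ) × E} {γ : C(unitInterval, E)}
    (hγ : flowDefect X (v, γ) = 0) {i : ι}
    (hcomm : ∀ τ j, X' j (γ τ) (X i (γ τ)) = X' i (γ τ) (X j (γ τ))) {h : C(unitInterval, E)}
    (hh : ∀ τ, h τ = (τ : ℝ) • X i (γ τ)) :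
    h = primitive E ((X i).comp γ) + variationalOp X' v.1 γ h := by
  set u : C(unitInterval, E) := ∑ j, v.1 j • (X j).comp γ with hu
  let c : ℝ → E := fun τ => v.2 + ∫ σ in (0 : ℝ)..τ, IccExtend zero_le_one u σ
  have hc : ∀ τ : unitInterval, c τ = γ τ := fun τ =>
    (DFunLike.congr_fun (flowDefect_eq_zero_iff.1 hγ) τ).symm
  rw [variationalOp, ContinuousLinearMap.comp_apply, ← map_add]
  refine eq_primitive_of_hasDerivAt (c := fun τ => τ • X i (c τ)) (fun τ => by rw [hc, hh])
    (zero_smul ℝ _) fun τ => ?_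
  have hderiv := (hasDerivAt_id (τ : ℝ)).smul
    ((hX i (c τ)).comp_hasDerivAt (τ : ℝ) ((hasDerivAt_integral_IccExtend u τ).const_add v.2))
  refine hderiv.congr_deriv ?_
  have hchain : (τ : ℝ) • X' i (γ τ) (u τ) = ∑ j, v.1 j • X' j (γ τ) (h τ) := by
    simp only [hu, hh, hcomm, map_sum, map_smul, ContinuousMap.coe_sum, ContinuousMap.coe_smul,
      Finset.sum_apply, Pi.smul_apply, ContinuousMap.comp_apply, Finset.smul_sum]
    exact Finset.sum_congr rfl fun j _ => smul_comm _ _ _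
  simp only [id, hc, hchain, Function.comp_apply, one_smul, add_comm, ContinuousMap.add_apply,
    ContinuousMap.comp_apply, sum_apply, smul_apply, ContinuousMap.coe_sum, Finset.sum_apply,
    ContinuousMap.coe_smul, Pi.smul_apply, pointwiseApply_apply]

theorem fderiv_eq_primitive_add_variationalOp [DecidableEq ι]
    (hX : ∀ i x, HasFDerivAt (X i) (X' i x) x) {Γ : (ι → ℝ) × E → C(unitInterval, E)}
    {v : (ι → ℝ) × E} (hΓ : DifferentiableAt ℝ Γ v)
    (hzero : ∀ᶠ w in 𝓝 v, flowDefect X (w, Γ w) = 0) (i : ι) :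
    fderiv ℝ Γ v (Pi.single i 1, 0) = primitive E ((X i).comp (Γ v)) +
      variationalOp X' v.1 (Γ v) (fderiv ℝ Γ v (Pi.single i 1, 0)) := by
  have htime : ∀ j, HasFDerivAt (fun w : (ι → ℝ) × E => w.1 j)
      (.proj j ∘L .fst ℝ (ι → ℝ) E) v := fun j =>
    (ContinuousLinearMap.proj (R := ℝ) (φ := fun _ : ι => ℝ) j ∘L .fst ℝ (ι → ℝ) E).hasFDerivAt
  have hsum := HasFDerivAt.fun_sum (u := Finset.univ) fun j _ =>
    (htime j).smul ((hasFDerivAt_continuousMap_comp (hX j) (Γ v)).comp v hΓ.hasFDerivAt)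
  have hcurve := ((ContinuousLinearMap.const ℝ unitInterval).hasFDerivAt.comp v
    (hasFDerivAt_snd (𝕜 := ℝ) (p := v))).add ((primitive E).hasFDerivAt.comp v hsum)
  have hΓ' := hΓ.hasFDerivAt.unique (hcurve.congr_of_eventuallyEq
    (hzero.mono fun w hw => flowDefect_eq_zero_iff.1 hw))
  conv_lhs => rw [hΓ']
  simp [variationalOp, Finset.sum_add_distrib, add_comm, Pi.single_apply]

theorem eventually_norm_variationalOp_lt_one {Γ : (ι → ℝ) × E → C(unitInterval, E)} {s : E}
    (hΓ : ContinuousAt Γ (0, s)) : ∀ᶠ v in 𝓝 (0, s), ‖variationalOp X' v.1 (Γ v)‖ < 1 := by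
  have hcont : ContinuousAt (fun v => variationalOp X' v.1 (Γ v)) (0, s) := by
    refine continuousAt_const.clm_comp (tendsto_finsetSum _ fun j _ => ?_)
    exact ((continuous_apply j).comp continuous_fst).continuousAt.smul
      ((pointwiseApply unitInterval E E).continuous.continuousAt.comp
        ((ContinuousMap.continuous_postcomp (X' j)).continuousAt.comp hΓ))
  have hnorm : ContinuousAt (fun v => ‖variationalOp X' v.1 (Γ v)‖) (0, s) :=
    continuous_norm.continuousAt.comp hcont
  have hzero : variationalOp X' 0 (Γ (0, s)) = 0 := by
    ext
    simp [variationalOp]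
  refine hnorm.eventually (Iio_mem_nhds ?_)
  simp only [hzero, norm_zero, one_pos]

theorem eq_of_eq_add_apply_of_norm_lt_one {L : E →L[ℝ] E} (hL : ‖L‖ < 1) {b x y : E}
    (hx : x = b + L x) (hy : y = b + L y) : x = y := by
  have hsub : x - y = L (x - y) := by
    conv_lhs => rw [hx, hy]
    rw [map_sub, add_sub_add_left_eq_sub]
  by_contra hne
  have hlt : ‖L (x - y)‖ < ‖x - y‖ :=
    (L.le_opNorm _).trans_lt (mul_lt_of_lt_one_left (norm_pos_iff.2 (sub_ne_zero.2 hne)) hL)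
  exact absurd hsub (fun h => hlt.ne (congrArg norm h).symm)

/-- `Φ (t, s)` is, near `(0, x₀)`, the point reached from `s` by flowing along each `Xᵢ` for the
time `tᵢ`; the flows of the `Xᵢ` then commute. -/
structure IsJointFlowAt [DecidableEq ι] (X : ι → E → E) (Φ : (ι → ℝ) × E → E) (x₀ : E) :
    Prop where
  eventually_contDiffAt : ∀ᶠ v in 𝓝 (0, x₀), ContDiffAt ℝ ∞ Φ v
  eventually_apply_zero : ∀ᶠ s in 𝓝 x₀, Φ (0, s) = s
  eventually_fderiv : ∀ᶠ v in 𝓝 (0, x₀), ∀ i, fderiv ℝ Φ v (Pi.single i 1, 0) = X i (Φ v)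

/- The curve `τ ↦ τ Xᵢ(γ τ)` and the derivative of `γ` with respect to `tᵢ` solve the same
variational equation, which has only one solution for small `t`; at `τ = 1` this says that the time
`tᵢ` flows along `Xᵢ`. -/
theorem exists_isJointFlowAt_of_contDiff [CompleteSpace E] [DecidableEq ι] {X : ι → C(E, E)}
    (hX : ∀ i, ContDiff ℝ ∞ (X i)) {x₀ : E}
    (hcomm : ∀ᶠ x in 𝓝 x₀, ∀ i j, lieBracket ℝ (X i) (X j) x = 0) :
    ∃ Φ, IsJointFlowAt (fun i => X i) Φ x₀ := by
  let X' : ι → C(E, E →L[ℝ] E) := fun i => ⟨fderiv ℝ (X i), (hX i).continuous_fderiv (by simp)⟩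
  have hX' : ∀ i x, HasFDerivAt (X i) (X' i x) x := fun i x =>
    ((hX i).differentiable (by simp) x).hasFDerivAt
  obtain ⟨Γ, hΓ₀, hΓ, hzero⟩ := exists_flowDefect_eq_zero hX x₀
  have hcommΓ : ∀ᶠ v in 𝓝 (0, x₀), ∀ τ i j, lieBracket ℝ (X i) (X j) (Γ v τ) = 0 := by
    obtain ⟨δ, hδ, hball⟩ := Metric.eventually_nhds_iff_ball.1 hcomm
    have hclose := hΓ.self_of_nhds.continuousAt (Metric.ball_mem_nhds _ hδ)
    rw [hΓ₀] at hclose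
    filter_upwards [hclose] with v hv τ
    exact hball _ ((ContinuousMap.dist_apply_le_dist τ).trans_lt hv)
  have hfderiv : ∀ᶠ v in 𝓝 (0, x₀), ∀ i τ,
      fderiv ℝ Γ v (Pi.single i 1, 0) τ = (τ : ℝ) • X i (Γ v τ) := by
    filter_upwards [hΓ, hzero.eventually_nhds, hcommΓ,
      eventually_norm_variationalOp_lt_one (X' := X') hΓ.self_of_nhds.continuousAt]
      with v hv hzero hcomm hlt i
    have hlin := smul_comp_eq_primitive_add_variationalOp hX' hzero.self_of_nhds
      (fun τ j => sub_eq_zero.1 (hcomm τ i j))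
      (h := ⟨fun τ => (τ : ℝ) • X i (Γ v τ), by fun_prop⟩) fun _ => rfl
    exact DFunLike.congr_fun (eq_of_eq_add_apply_of_norm_lt_one hlt
      (fderiv_eq_primitive_add_variationalOp hX' (hv.differentiableAt (by simp)) hzero i) hlin)
  let ev : C(unitInterval, E) →L[ℝ] E := ContinuousMap.evalCLM ℝ (1 : unitInterval)
  refine ⟨fun v => ev (Γ v), hΓ.mono fun v hv => ev.contDiff.contDiffAt.comp v hv, ?_, ?_⟩
  · have hslice : Tendsto (fun s : E => ((0 : ι → ℝ), s)) (𝓝 x₀) (𝓝 (0, x₀)) :=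
      Continuous.tendsto (by fun_prop) x₀
    filter_upwards [hslice.eventually hzero] with s hs
    have hconst : Γ (0, s) = ContinuousMap.const _ s := by
      simpa using flowDefect_eq_zero_iff.1 hs
    exact DFunLike.congr_fun hconst 1
  · filter_upwards [hΓ, hfderiv] with v hv hvi i
    have hev : HasFDerivAt (fun v => ev (Γ v)) (ev ∘L fderiv ℝ Γ v) v :=
      ev.hasFDerivAt.comp v (hv.differentiableAt (by simp)).hasFDerivAt
    rw [hev.fderiv, ContinuousLinearMap.comp_apply]
    exact (hvi i 1).trans (one_smul ℝ _)

end JointFlow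

section Straightening

open VectorField

variable {E : Type*} [NormedAddCommGroup E] [NormedSpace ℝ E] [FiniteDimensional ℝ E]

theorem exists_contDiff_eventuallyEq {F : Type*} [NormedAddCommGroup F] [NormedSpace ℝ F]
    {X : E → F} {x₀ : E} (hX : ∀ᶠ x in 𝓝 x₀, ContDiffAt ℝ ∞ X x) :
    ∃ Y : C(E, F), ContDiff ℝ ∞ Y ∧ Y =ᶠ[𝓝 x₀] X := by
  obtain ⟨r, hr, hball⟩ := Metric.eventually_nhds_iff_ball.1 hX
  let f : ContDiffBump x₀ := ⟨r / 3, r / 2, by positivity, by linarith⟩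
  have hsupp : tsupport f ⊆ Metric.ball x₀ r := by
    rw [f.tsupport_eq]
    exact Metric.closedBall_subset_ball (half_lt_self hr)
  have hsmooth : ContDiff ℝ ∞ fun x => f x • X x := by
    refine contDiff_iff_contDiffAt.2 fun x => ?_
    by_cases hx : x ∈ tsupport f
    · exact f.contDiff.contDiffAt.smul (hball x (hsupp hx))
    · refine (contDiffAt_const (c := (0 : F))).congr_of_eventuallyEq ?_
      filter_upwards [(isClosed_tsupport f).isOpen_compl.mem_nhds hx] with y hy
      rw [image_eq_zero_of_notMem_tsupport hy, zero_smul]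
  refine ⟨⟨_, hsmooth.continuous⟩, hsmooth, ?_⟩
  filter_upwards [Metric.closedBall_mem_nhds x₀ f.rIn_pos] with x hx
  simp [f.one_of_mem_closedBall hx]

variable {ι : Type*} [Fintype ι] [DecidableEq ι] {X : ι → E → E} {x₀ : E}

theorem exists_isJointFlowAt (hX : ∀ i, ∀ᶠ x in 𝓝 x₀, ContDiffAt ℝ ∞ (X i) x)
    (hcomm : ∀ᶠ x in 𝓝 x₀, ∀ i j, lieBracket ℝ (X i) (X j) x = 0) :
    ∃ Φ, IsJointFlowAt X Φ x₀ := by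
  choose Y hY hYX using fun i => exists_contDiff_eventuallyEq (hX i)
  have hYX' : ∀ᶠ x in 𝓝 x₀, ∀ i, Y i =ᶠ[𝓝 x] X i :=
    eventually_all.2 fun i => (hYX i).eventually_nhds
  obtain ⟨Φ, hΦ⟩ := exists_isJointFlowAt_of_contDiff hY (x₀ := x₀) (by
    filter_upwards [hYX', hcomm] with x hx hc i j
    rw [(hx i).lieBracket_vectorField_eq (hx j), hc])
  refine ⟨Φ, hΦ.eventually_contDiffAt, hΦ.eventually_apply_zero, ?_⟩
  have htendsto : Tendsto Φ (𝓝 (0, x₀)) (𝓝 x₀) := by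
    simpa only [ContinuousAt, hΦ.eventually_apply_zero.self_of_nhds] using
      hΦ.eventually_contDiffAt.self_of_nhds.continuousAt
  filter_upwards [hΦ.eventually_fderiv, htendsto.eventually hYX'] with v hv hYv i
  rw [hv, (hYv i).eq_of_nhds]

omit [FiniteDimensional ℝ E] in
theorem IsJointFlowAt.fderiv_apply {Φ : (ι → ℝ) × E → E} (hΦ : IsJointFlowAt X Φ x₀)
    (t : ι → ℝ) (z : E) : fderiv ℝ Φ (0, x₀) (t, z) = ∑ i, t i • X i x₀ + z := by
  have hdiff : HasFDerivAt Φ (fderiv ℝ Φ (0, x₀)) (0, x₀) :=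
    (hΦ.eventually_contDiffAt.self_of_nhds.differentiableAt (by simp)).hasFDerivAt
  have hspace : fderiv ℝ Φ (0, x₀) (0, z) = z :=
    DFunLike.congr_fun ((hdiff.comp x₀ (hasFDerivAt_prodMk_right 0 x₀)).unique
      ((hasFDerivAt_id x₀).congr_of_eventuallyEq hΦ.eventually_apply_zero)) z
  have htime : ∀ i, fderiv ℝ Φ (0, x₀) (Pi.single i 1, 0) = X i x₀ := fun i => by
    rw [hΦ.eventually_fderiv.self_of_nhds, hΦ.eventually_apply_zero.self_of_nhds]
  have hsplit : (t, z) = ∑ i, t i • ((Pi.single i 1 : ι → ℝ), (0 : E)) + (0, z) := by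
    refine Prod.ext ?_ ?_
    · simpa [Prod.fst_sum] using pi_eq_sum_univ' t
    · simp [Prod.snd_sum]
  rw [hsplit, map_add, map_sum, hspace]
  simp only [map_smul, htime]

omit [DecidableEq ι] in
theorem exists_equiv_apply_eq_sum_add {v : ι → E} (hv : LinearIndependent ℝ v)
    {F : Submodule ℝ E} (hF : IsCompl (Submodule.span ℝ (range v)) F) :
    ∃ L : ((ι → ℝ) × F) ≃L[ℝ] E, ∀ w, L w = ∑ i, w.1 i • v i + w.2 := by
  refine ⟨(((Module.Basis.span hv).equivFun.symm.prodCongr (.refl ℝ F)).trans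
    (Submodule.prodEquivOfIsCompl _ _ hF)).toContinuousLinearEquiv, fun w => ?_⟩
  simp [Module.Basis.equivFun_symm_apply, Module.Basis.span_apply]

variable {F : Submodule ℝ E}

omit [FiniteDimensional ℝ E] in
theorem hasFDerivAt_comp_add_subtype {G E' : Type*} [NormedAddCommGroup G] [NormedSpace ℝ G]
    [NormedAddCommGroup E'] [NormedSpace ℝ E'] {Φ : G × E → E'} {v : G × F}
    (hΦ : DifferentiableAt ℝ Φ (v.1, x₀ + v.2)) :
    HasFDerivAt (fun v : G × F => Φ (v.1, x₀ + v.2))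
      (fderiv ℝ Φ (v.1, x₀ + v.2) ∘L (ContinuousLinearMap.id ℝ G).prodMap F.subtypeL) v :=
  hΦ.hasFDerivAt.comp v
    (hasFDerivAt_fst.prodMk ((F.subtypeL.hasFDerivAt.comp v hasFDerivAt_snd).const_add x₀))

omit [FiniteDimensional ℝ E] in
theorem IsJointFlowAt.eventually_slice {Φ : (ι → ℝ) × E → E} (hΦ : IsJointFlowAt X Φ x₀) :
    ∀ᶠ v : (ι → ℝ) × F in 𝓝 0, ContDiffAt ℝ ∞ (fun v : (ι → ℝ) × F => Φ (v.1, x₀ + v.2)) v ∧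
      ∀ i, fderiv ℝ (fun v : (ι → ℝ) × F => Φ (v.1, x₀ + v.2)) v (Pi.single i 1, 0) =
        X i (Φ (v.1, x₀ + v.2)) := by
  have hinc : ContDiff ℝ ∞ fun v : (ι → ℝ) × F => (v.1, x₀ + (v.2 : E)) :=
    contDiff_fst.prodMk (contDiff_const.add (F.subtypeL.contDiff.comp contDiff_snd))
  have htendsto : Tendsto (fun v : (ι → ℝ) × F => (v.1, x₀ + (v.2 : E))) (𝓝 0) (𝓝 (0, x₀)) := by
    simpa using hinc.continuous.tendsto 0
  filter_upwards [htendsto.eventually hΦ.eventually_contDiffAt,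
    htendsto.eventually hΦ.eventually_fderiv] with v hv hvi
  refine ⟨hv.comp v hinc.contDiffAt, fun i => ?_⟩
  rw [(hasFDerivAt_comp_add_subtype (hv.differentiableAt (by simp))).fderiv, ← hvi i]
  simp

theorem exists_isSmoothDiffeo_fderiv_eq_single
    (hX : ∀ i, ∀ᶠ x in 𝓝 x₀, ContDiffAt ℝ ∞ (X i) x)
    (hcomm : ∀ᶠ x in 𝓝 x₀, ∀ i j, lieBracket ℝ (X i) (X j) x = 0)
    (hind : LinearIndependent ℝ fun i => X i x₀) :
    ∃ (F : Submodule ℝ E) (e : OpenPartialHomeomorph E ((ι → ℝ) × F)), IsSmoothDiffeo e ∧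
      x₀ ∈ e.source ∧ ∀ x ∈ e.source, ∀ i, fderiv ℝ e x (X i x) = (Pi.single i 1, 0) := by
  obtain ⟨Φ, hΦ⟩ := exists_isJointFlowAt hX hcomm
  obtain ⟨F, hF⟩ := (Submodule.span ℝ (range fun i => X i x₀)).exists_isCompl
  obtain ⟨L, hL⟩ := exists_equiv_apply_eq_sum_add hind hF
  let f : (ι → ℝ) × F → E := fun v => Φ (v.1, x₀ + v.2)
  have hf0 : f 0 = x₀ := by simpa [f] using hΦ.eventually_apply_zero.self_of_nhds
  have hf' : HasFDerivAt f (L : _ →L[ℝ] E) 0 := by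
    refine (hasFDerivAt_comp_add_subtype (v := (0 : (ι → ℝ) × F)) ?_).congr_fderiv
      (ContinuousLinearMap.ext fun v => ?_)
    · simpa using hΦ.eventually_contDiffAt.self_of_nhds.differentiableAt (by simp)
    · simpa [hL, Prod.map] using hΦ.fderiv_apply v.1 v.2
  obtain ⟨e, he, he0, hes, hef : ⇑e = f⟩ := exists_isSmoothDiffeo
    (hΦ.eventually_slice.mono fun _ h => h.1) hf' (hΦ.eventually_slice.mono fun _ h => h.2)
  refine ⟨F, e.symm, he.symm, ?_, fun x hx i => ?_⟩
  · have hmap := e.map_source he0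
    rwa [hef, hf0] at hmap
  · have hXe := hes (e.map_target hx) i
    have hinv := he.fderiv_symm_comp_fderiv (e.map_target hx)
    rw [e.right_inv hx] at hinv
    have hfe : f (e.symm x) = x := hef ▸ e.right_inv hx
    have hXx : fderiv ℝ e (e.symm x) (Pi.single i 1, 0) = X i x := by
      rw [hef]
      exact hXe.trans (congrArg (X i) hfe)
    rw [← hXx]
    exact DFunLike.congr_fun hinv _

end Straightening

section Poisson

open VectorField

variable {E : Type*} [NormedAddCommGroup E] [NormedSpace ℝ E] {P : E → (E →L[ℝ] ℝ) →L[ℝ] E}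
  {f g : E → ℝ} {x : E}

/-- The Jacobi identity at `x` for the bracket of the coordinate functions (the elements of `E*`)
defined by a bivector field `P` on a vector space. -/
def JacobiAt (P : E → (E →L[ℝ] ℝ) →L[ℝ] E) (x : E) : Prop :=
  ∀ α β γ : E →L[ℝ] ℝ, β (fderiv ℝ P x (P x γ) α) + γ (fderiv ℝ P x (P x α) β) +
    α (fderiv ℝ P x (P x β) γ) = 0

/-- The Hamiltonian vector field of `f`. -/
def hamiltonian (P : E → (E →L[ℝ] ℝ) →L[ℝ] E) (f : E → ℝ) (x : E) : E := P x (fderiv ℝ f x)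

theorem isSkew_fderiv (hP : DifferentiableAt ℝ P x) (hs : ∀ᶠ y in 𝓝 x, IsSkew (P y)) (v : E) :
    IsSkew (fderiv ℝ P x v) := by
  intro ξ η
  have hpair : ∀ ξ η : E →L[ℝ] ℝ,
      HasFDerivAt (fun y => η (P y ξ)) (η ∘L (fderiv ℝ P x).flip ξ) x := fun ξ η =>
    η.hasFDerivAt.comp x
      ((hP.hasFDerivAt.clm_apply (hasFDerivAt_const ξ x)).congr_fderiv (by simp))
  exact DFunLike.congr_fun ((hpair ξ η).unique
    ((hpair η ξ).neg.congr_of_eventuallyEq (hs.mono fun y hy => hy ξ η))) v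

theorem contDiffAt_hamiltonian (hP : ContDiffAt ℝ ∞ P x) (hf : ContDiffAt ℝ ∞ f x) :
    ContDiffAt ℝ ∞ (hamiltonian P f) x :=
  hP.clm_apply (hf.fderiv_right (by simp))

theorem hasFDerivAt_hamiltonian (hP : DifferentiableAt ℝ P x) (hf : ContDiffAt ℝ 2 f x) :
    HasFDerivAt (hamiltonian P f)
      (P x ∘L fderiv ℝ (fderiv ℝ f) x + (fderiv ℝ P x).flip (fderiv ℝ f x)) x :=
  hP.hasFDerivAt.clm_apply
    ((hf.fderiv_right (m := 1) (by norm_num)).differentiableAt (by simp)).hasFDerivAt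

theorem lieBracket_hamiltonian (hP : DifferentiableAt ℝ P x) (hs : ∀ᶠ y in 𝓝 x, IsSkew (P y))
    (hJ : JacobiAt P x) (hf : ContDiffAt ℝ 2 f x) (hg : ContDiffAt ℝ 2 g x) :
    lieBracket ℝ (hamiltonian P f) (hamiltonian P g) x =
      hamiltonian P (fun y => fderiv ℝ g y (hamiltonian P f y)) x := by
  have hsx : IsSkew (P x) := hs.self_of_nhds
  have hbracket : HasFDerivAt (fun y => fderiv ℝ g y (hamiltonian P f y)) _ x :=
    ((hg.fderiv_right (m := 1) (by norm_num)).differentiableAt (by simp)).hasFDerivAt.clm_apply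
      (hasFDerivAt_hamiltonian hP hf)
  refine (SeparatingDual.eq_iff_forall_dual_eq (R := ℝ)).2 fun γ => ?_
  rw [lieBracket, (hasFDerivAt_hamiltonian hP hf).fderiv, (hasFDerivAt_hamiltonian hP hg).fderiv]
  refine .trans ?_ (hsx (fderiv ℝ (fun y => fderiv ℝ g y (hamiltonian P f y)) x) γ).symm
  rw [hbracket.fderiv]
  have hJγ := hJ (fderiv ℝ f x) (fderiv ℝ g x) γ
  rw [isSkew_fderiv hP hs (P x (fderiv ℝ g x)) γ (fderiv ℝ f x)] at hJγ
  have hg₂ : fderiv ℝ (fderiv ℝ g) x (P x γ) (hamiltonian P f x) =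
      -γ (P x (fderiv ℝ (fderiv ℝ g) x (hamiltonian P f x))) := by
    rw [(hg.isSymmSndFDerivAt (by simp)).eq, hsx]
  have hf₂ : fderiv ℝ g x (P x (fderiv ℝ (fderiv ℝ f) x (P x γ))) =
      γ (P x (fderiv ℝ (fderiv ℝ f) x (hamiltonian P g x))) := by
    rw [hsx, hsx _ γ, (hf.isSymmSndFDerivAt (by simp)).eq, hamiltonian]
  simp only [hamiltonian, add_apply, ContinuousLinearMap.comp_apply, ContinuousLinearMap.flip_apply,
    map_add, map_sub] at hg₂ hf₂ ⊢
  linarith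

theorem hamiltonian_eq_zero_of_eventuallyEq_const {c : ℝ} (hf : f =ᶠ[𝓝 x] fun _ => c) :
    hamiltonian P f x = 0 := by
  rw [hamiltonian, hf.fderiv_eq, fderiv_const_apply, map_zero]

end Poisson

section LinearDarboux

variable {E F : Type*} [NormedAddCommGroup E] [NormedSpace ℝ E]
  [NormedAddCommGroup F] [NormedSpace ℝ F] {ι : Type*}

/-- The linear map with components `αᵢ` and the last component of `L`: the linearization of
coordinates in which the first components of a coordinate system have been replaced. -/
def replaceFst (α : ι → E →L[ℝ] ℝ) (L : E →L[ℝ] (ι → ℝ) × F) : E →L[ℝ] (ι → ℝ) × F :=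
  (ContinuousLinearMap.pi α).prod (ContinuousLinearMap.snd ℝ _ _ ∘L L)

variable [DecidableEq ι] {Θ : (E →L[ℝ] ℝ) →L[ℝ] E} {α : ι → E →L[ℝ] ℝ}
  {L : E →L[ℝ] (ι → ℝ) × F}

theorem snd_apply_eq_zero_of_mem_im
    (hspan : im Θ = Submodule.span ℝ (range fun i => Θ (α i)))
    (hL : ∀ i, L (Θ (α i)) = (Pi.single i 1, 0)) {w : E} (hw : w ∈ im Θ) : (L w).2 = 0 := by
  rw [hspan] at hw
  have hle : Submodule.span ℝ (range fun i => Θ (α i)) ≤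
      LinearMap.ker ((ContinuousLinearMap.snd ℝ _ _ ∘L L : E →L[ℝ] F) : E →ₗ[ℝ] F) := by
    rw [Submodule.span_le]
    rintro _ ⟨i, rfl⟩
    simp [hL]
  exact hle hw

theorem prod_eq_sum_single_add [Fintype ι] (p : (ι → ℝ) × F) :
    p = ∑ i, p.1 i • ((Pi.single i 1 : ι → ℝ), (0 : F)) + (0, p.2) := by
  refine Prod.ext ?_ ?_
  · simpa [Prod.fst_sum] using pi_eq_sum_univ' p.1
  · simp [Prod.snd_sum]

variable [FiniteDimensional ℝ E]

theorem replaceFst_map_comp_replaceFst [Fintype ι] (hΘ : IsSkew Θ)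
    (hspan : im Θ = Submodule.span ℝ (range fun i => Θ (α i)))
    (hL : ∀ i, L (Θ (α i)) = (Pi.single i 1, 0)) (l : (ι → ℝ) × F →L[ℝ] ℝ) :
    replaceFst α L (Θ (l ∘L replaceFst α L)) =
      ∑ i, l (Pi.single i 1, 0) • ((fun j => α j (Θ (α i))), (0 : F)) := by
  let m : E →L[ℝ] ℝ :=
    l ∘L ContinuousLinearMap.inr ℝ (ι → ℝ) F ∘L ContinuousLinearMap.snd ℝ _ _ ∘L L
  have hm : Θ m = 0 := by
    rw [map_eq_of_eqOn hΘ (ξ' := 0), map_zero]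
    intro w hw
    simp only [m, ContinuousLinearMap.comp_apply, ContinuousLinearMap.coe_snd',
      snd_apply_eq_zero_of_mem_im hspan hL hw, map_zero, zero_apply]
  have hl : l ∘L replaceFst α L = ∑ i, l (Pi.single i 1, 0) • α i + m := by
    ext v
    rw [ContinuousLinearMap.comp_apply, prod_eq_sum_single_add (replaceFst α L v), map_add,
      map_sum]
    simp only [map_smul, add_apply, sum_apply, smul_apply, smul_eq_mul]
    exact congrArg (· + _) (Finset.sum_congr rfl fun i _ => mul_comm _ _)
  have hα : ∀ i, replaceFst α L (Θ (α i)) = ((fun j => α j (Θ (α i))), 0) := fun i => by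
    simp [replaceFst, hL]
  simp only [hl, map_add, hm, add_zero, map_sum, map_smul, hα]

theorem replaceFst_injective [Finite ι] (hΘ : IsSkew Θ)
    (hspan : im Θ = Submodule.span ℝ (range fun i => Θ (α i)))
    (hL : ∀ i, L (Θ (α i)) = (Pi.single i 1, 0)) (hinj : Function.Injective L) :
    Function.Injective (replaceFst α L) := by
  have := Fintype.ofFinite ι
  refine (injective_iff_map_eq_zero _).2 fun v hv => ?_
  have hα : ∀ i, α i v = 0 := fun i => congrFun (congrArg Prod.fst hv) i
  have hv₂ : (L v).2 = 0 := congrArg Prod.snd hv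
  have hsum : v = ∑ i, (L v).1 i • Θ (α i) := by
    apply hinj
    refine (prod_eq_sum_single_add (L v)).trans ?_
    simp only [hv₂, map_sum, map_smul, hL]
    exact add_zero _
  have hmem : v ∈ im Θ := by
    rw [hsum, hspan]
    exact Submodule.sum_mem _ fun i _ =>
      Submodule.smul_mem _ _ (Submodule.subset_span (mem_range_self i))
  obtain ⟨ξ, rfl⟩ := hmem
  have hξ : im Θ ≤ LinearMap.ker (ξ : E →ₗ[ℝ] ℝ) := by
    rw [hspan, Submodule.span_le]
    rintro _ ⟨i, rfl⟩
    exact (hΘ (α i) ξ).trans (neg_eq_zero.2 (hα i))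
  exact (map_eq_of_eqOn hΘ (ξ' := 0) fun w hw => hξ hw).trans (map_zero Θ)

end LinearDarboux

section Darboux

variable {E : Type*} [NormedAddCommGroup E] [NormedSpace ℝ E] {P : E → (E →L[ℝ] ℝ) →L[ℝ] E}
  {x₀ : E} {k : ℕ} {f : Fin k → E → ℝ}

/-- A smooth field of bivectors on a neighbourhood of `x₀` whose bracket is a Poisson bracket. -/
structure IsPoissonAt (P : E → (E →L[ℝ] ℝ) →L[ℝ] E) (x₀ : E) : Prop where
  eventually_contDiffAt : ∀ᶠ x in 𝓝 x₀, ContDiffAt ℝ ∞ P x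
  eventually_isSkew : ∀ᶠ x in 𝓝 x₀, IsSkew (P x)
  eventually_jacobiAt : ∀ᶠ x in 𝓝 x₀, JacobiAt P x

/-- Smooth functions near `x₀` with constant brackets and linearly independent Hamiltonian vector
fields. -/
structure ConstantBrackets (P : E → (E →L[ℝ] ℝ) →L[ℝ] E) (x₀ : E) (f : Fin k → E → ℝ) :
    Prop where
  eventually_contDiffAt : ∀ i, ∀ᶠ x in 𝓝 x₀, ContDiffAt ℝ ∞ (f i) x
  exists_bracket_eq : ∀ i j, ∃ c : ℝ, ∀ᶠ x in 𝓝 x₀, fderiv ℝ (f j) x (hamiltonian P (f i) x) = c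
  linearIndependent : LinearIndependent ℝ fun i => hamiltonian P (f i) x₀

namespace ConstantBrackets

theorem snoc {h : E → ℝ} (hf : ConstantBrackets P x₀ f) (hs : ∀ᶠ x in 𝓝 x₀, IsSkew (P x))
    (hh : ∀ᶠ x in 𝓝 x₀, ContDiffAt ℝ ∞ h x)
    (hfh : ∀ i, ∃ c : ℝ, ∀ᶠ x in 𝓝 x₀, fderiv ℝ h x (hamiltonian P (f i) x) = c)
    (hind : hamiltonian P h x₀ ∉ Submodule.span ℝ (range fun i => hamiltonian P (f i) x₀)) :
    ConstantBrackets P x₀ (Fin.snoc (α := fun _ => E → ℝ) f h) := by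
  refine ⟨?_, ?_, ?_⟩
  · refine Fin.lastCases ?_ fun i => ?_
    · simpa only [Fin.snoc_last] using hh
    · simpa only [Fin.snoc_castSucc] using hf.eventually_contDiffAt i
  · refine Fin.lastCases ?_ fun i => ?_ <;> refine Fin.lastCases ?_ fun j => ?_ <;>
      simp only [Fin.snoc_last, Fin.snoc_castSucc]
    · exact ⟨0, hs.mono fun x hx => self_eq_neg.1 (hx _ _)⟩
    · obtain ⟨c, hc⟩ := hfh j
      refine ⟨-c, ?_⟩
      filter_upwards [hc, hs] with x hxc hx
      rw [← hxc]
      exact hx _ _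
    · exact hfh i
    · exact hf.exists_bracket_eq i j
  · have hsnoc : (fun i => hamiltonian P (Fin.snoc (α := fun _ => E → ℝ) f h i) x₀) =
        Fin.snoc (α := fun _ => E) (fun i => hamiltonian P (f i) x₀) (hamiltonian P h x₀) :=
      funext (Fin.lastCases (by simp) (by simp))
    rw [hsnoc]
    exact linearIndependent_finSnoc.2 ⟨hf.linearIndependent, hind⟩

variable [FiniteDimensional ℝ E]

theorem exists_isSmoothDiffeo (hf : ConstantBrackets P x₀ f) (hP : IsPoissonAt P x₀) :
    ∃ (F : Submodule ℝ E) (e : OpenPartialHomeomorph E ((Fin k → ℝ) × F)), IsSmoothDiffeo e ∧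
      x₀ ∈ e.source ∧
      ∀ x ∈ e.source, ∀ i, fderiv ℝ e x (hamiltonian P (f i) x) = (Pi.single i 1, 0) := by
  refine exists_isSmoothDiffeo_fderiv_eq_single (fun i => ?_) ?_ hf.linearIndependent
  · filter_upwards [hP.eventually_contDiffAt, hf.eventually_contDiffAt i] with x hPx hfx
    exact contDiffAt_hamiltonian hPx hfx
  · choose c hc using hf.exists_bracket_eq
    filter_upwards [hP.eventually_contDiffAt, hP.eventually_isSkew.eventually_nhds,
      hP.eventually_jacobiAt, eventually_all.2 hf.eventually_contDiffAt,
      eventually_all.2 fun i => eventually_all.2 fun j => (hc i j).eventually_nhds]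
      with x hPx hs hJ hfx hcx i j
    have hle : (2 : WithTop ℕ∞) ≤ ∞ := WithTop.coe_le_coe.2 (le_top (a := (2 : ℕ∞)))
    rw [lieBracket_hamiltonian (hPx.differentiableAt (by simp)) hs hJ ((hfx i).of_le hle)
      ((hfx j).of_le hle), hamiltonian_eq_zero_of_eventuallyEq_const (hcx i j)]

/- In coordinates straightening the Hamiltonian vector fields every linear function has constant
brackets with the `fᵢ`. -/
theorem exists_succ (hf : ConstantBrackets P x₀ f) (hP : IsPoissonAt P x₀)
    (hk : k < Module.finrank ℝ (im (P x₀))) :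
    ∃ f' : Fin (k + 1) → E → ℝ, ConstantBrackets P x₀ f' := by
  obtain ⟨F, e, he, hx₀, heX⟩ := hf.exists_isSmoothDiffeo hP
  obtain ⟨ξ, hξ⟩ : ∃ ξ, P x₀ ξ ∉ Submodule.span ℝ (range fun i => hamiltonian P (f i) x₀) := by
    by_contra! hall
    have hspan : im (P x₀) ≤ Submodule.span ℝ (range fun i => hamiltonian P (f i) x₀) := by
      rintro _ ⟨ξ, rfl⟩
      exact hall ξ
    have hle := Submodule.finrank_mono hspan
    rw [finrank_span_eq_card hf.linearIndependent, Fintype.card_fin] at hle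
    omega
  obtain ⟨g, hg⟩ := he.isInvertible_fderiv hx₀
  let l : (Fin k → ℝ) × F →L[ℝ] ℝ := ξ ∘L (g.symm : _ →L[ℝ] E)
  have hd : ∀ x ∈ e.source, fderiv ℝ (fun x => l (e x)) x = l ∘L fderiv ℝ e x := fun x hx =>
    (l.hasFDerivAt.comp x (he.hasFDerivAt hx)).fderiv
  have hsrc := e.open_source.mem_nhds hx₀
  refine ⟨_, hf.snoc (h := fun x => l (e x)) hP.eventually_isSkew ?_
    (fun i => ⟨l (Pi.single i 1, 0), ?_⟩) ?_⟩
  · filter_upwards [hsrc] with x hx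
    exact l.contDiff.contDiffAt.comp x (he.contDiffAt hx)
  · filter_upwards [hsrc] with x hx
    rw [hd x hx, ContinuousLinearMap.comp_apply, heX x hx]
  · have hl : l ∘L fderiv ℝ e x₀ = ξ := by
      rw [← hg]
      ext v
      simp [l]
    rwa [hamiltonian, hd x₀ hx₀, hl]

theorem eventually_im_eq_span (hf : ConstantBrackets P x₀ f)
    (hP : ∀ᶠ x in 𝓝 x₀, ContDiffAt ℝ ∞ P x)
    (hr : ∀ᶠ x in 𝓝 x₀, Module.finrank ℝ (im (P x)) = k) :
    ∀ᶠ x in 𝓝 x₀, im (P x) = Submodule.span ℝ (range fun i => hamiltonian P (f i) x) := by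
  have hcont : ContinuousAt (fun x i => hamiltonian P (f i) x) x₀ :=
    continuousAt_pi.2 fun i => (contDiffAt_hamiltonian hP.self_of_nhds
      (hf.eventually_contDiffAt i).self_of_nhds).continuousAt
  filter_upwards [hcont.eventually
    (isOpen_setOfPred_linearIndependent.mem_nhds hf.linearIndependent), hr] with x hind hrx
  refine (Submodule.eq_of_le_of_finrank_eq ?_ ?_).symm
  · rw [Submodule.span_le]
    rintro _ ⟨i, rfl⟩
    exact ⟨_, rfl⟩
  · rw [finrank_span_eq_card hind, Fintype.card_fin, hrx]

end ConstantBrackets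

variable [FiniteDimensional ℝ E]

theorem IsPoissonAt.exists_constantBrackets (hP : IsPoissonAt P x₀)
    (hk : k ≤ Module.finrank ℝ (im (P x₀))) : ∃ f : Fin k → E → ℝ, ConstantBrackets P x₀ f := by
  induction k with
  | zero => exact ⟨Fin.elim0, fun i => i.elim0, fun i => i.elim0, linearIndependent_empty_type⟩
  | succ k ih =>
    obtain ⟨f, hf⟩ := ih (by omega)
    exact hf.exists_succ hP hk

/- Straightening the Hamiltonian vector fields alone does not make the bracket constant: the first
coordinates have to be the functions themselves, the remaining ones are Casimir functions. -/
theorem ConstantBrackets.exists_injective_fderiv {r : ℕ} {f : Fin r → E → ℝ}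
    (hf : ConstantBrackets P x₀ f) (hP : IsPoissonAt P x₀)
    (hr : ∀ᶠ x in 𝓝 x₀, Module.finrank ℝ (im (P x)) = r) :
    ∃ (F : Submodule ℝ E) (y : E → (Fin r → ℝ) × F) (C : ((Fin r → ℝ) × F →L[ℝ] ℝ) →
      (Fin r → ℝ) × F), Nonempty (E ≃L[ℝ] (Fin r → ℝ) × F) ∧ (∀ᶠ x in 𝓝 x₀, ContDiffAt ℝ ∞ y x) ∧
      Function.Injective (fderiv ℝ y x₀) ∧
      ∀ᶠ x in 𝓝 x₀, ∀ l, fderiv ℝ y x (P x (l ∘L fderiv ℝ y x)) = C l := by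
  obtain ⟨F, e, he, hx₀, heX⟩ := hf.exists_isSmoothDiffeo hP
  choose c hc using hf.exists_bracket_eq
  obtain ⟨g, hg⟩ := he.isInvertible_fderiv hx₀
  have hsrc := e.open_source.mem_nhds hx₀
  have hspan := hf.eventually_im_eq_span hP.eventually_contDiffAt hr
  have hderiv : ∀ᶠ x in 𝓝 x₀, fderiv ℝ (fun x => ((fun i => f i x), (e x).2)) x =
      replaceFst (fun i => fderiv ℝ (f i) x) (fderiv ℝ e x) := by
    filter_upwards [hsrc, eventually_all.2 hf.eventually_contDiffAt] with x hx hfx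
    exact ((hasFDerivAt_pi.2 fun i => ((hfx i).differentiableAt (by simp)).hasFDerivAt).prodMk
      (hasFDerivAt_snd.comp x (he.hasFDerivAt hx))).fderiv
  refine ⟨F, fun x => ((fun i => f i x), (e x).2),
    fun l => ∑ i, l (Pi.single i 1, 0) • (c i, (0 : F)), ⟨g⟩, ?_, ?_, ?_⟩
  · filter_upwards [hsrc, eventually_all.2 hf.eventually_contDiffAt] with x hx hfx
    exact (contDiffAt_pi.2 hfx).prodMk (contDiffAt_snd.comp x (he.contDiffAt hx))
  · rw [hderiv.self_of_nhds]
    exact replaceFst_injective hP.eventually_isSkew.self_of_nhds hspan.self_of_nhds (heX x₀ hx₀)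
      (hg ▸ g.injective)
  · filter_upwards [hsrc, hP.eventually_isSkew, hspan, hderiv,
      eventually_all.2 fun i => eventually_all.2 (hc i)] with x hx hskew hspan hderiv hcx l
    rw [hderiv, replaceFst_map_comp_replaceFst hskew hspan (heX x hx) l]
    exact Finset.sum_congr rfl fun i _ => congrArg (fun b => l (Pi.single i 1, 0) • (b, (0 : F)))
      (funext (hcx i))

theorem IsPoissonAt.exists_fderiv_map_comp_eq {r : ℕ} {s : Set E} (hP : IsPoissonAt P x₀)
    (hr : ∀ᶠ x in 𝓝 x₀, Module.finrank ℝ (im (P x)) = r) (hs : s ∈ 𝓝 x₀) :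
    ∃ (ψ : OpenPartialHomeomorph E E) (C : (E →L[ℝ] ℝ) → E), IsSmoothDiffeo ψ ∧ x₀ ∈ ψ.source ∧
      ψ.source ⊆ s ∧ ∀ x ∈ ψ.source, ∀ α, fderiv ℝ ψ x (P x (α ∘L fderiv ℝ ψ x)) = C α := by
  obtain ⟨f, hf⟩ := hP.exists_constantBrackets hr.self_of_nhds.ge
  obtain ⟨F, y, C, ⟨g⟩, hy, hinj, hconst⟩ := hf.exists_injective_fderiv hP hr
  let G : (Fin r → ℝ) × F →L[ℝ] E := g.symm
  have hderiv : ∀ {x}, ContDiffAt ℝ ∞ y x → HasFDerivAt (G ∘ y) (G ∘L fderiv ℝ y x) x :=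
    fun {x} hx => G.hasFDerivAt.comp x (hx.differentiableAt (by simp)).hasFDerivAt
  let A : E ≃L[ℝ] E := (LinearEquiv.ofInjectiveEndo ((G ∘L fderiv ℝ y x₀ : E →L[ℝ] E) : E →ₗ[ℝ] E)
    (g.symm.injective.comp hinj)).toContinuousLinearEquiv
  have hA : HasFDerivAt (G ∘ y) (A : E →L[ℝ] E) x₀ :=
    (hderiv hy.self_of_nhds).congr_fderiv (ContinuousLinearMap.ext fun _ => rfl)
  obtain ⟨ψ, hψ, hψ₀, hψs, hψy⟩ := exists_isSmoothDiffeo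
    (hy.mono fun x hx => G.contDiff.contDiffAt.comp x hx) hA (inter_mem hs (hy.and hconst))
  refine ⟨ψ, fun α => G (C (α ∘L G)), hψ, hψ₀, fun x hx => (hψs hx).1, fun x hx α => ?_⟩
  obtain ⟨-, hyx, hconstx⟩ := hψs hx
  rw [hψy, (hderiv hyx).fderiv]
  exact congrArg G (hconstx (α ∘L G))

end Darboux

section ClosedForm

variable {N : Type*} [NormedAddCommGroup N] [NormedSpace ℝ N]

section SmoothInverse

variable {G H : Type*} [NormedAddCommGroup G] [NormedSpace ℝ G] [CompleteSpace G]
  [NormedAddCommGroup H] [NormedSpace ℝ H] {n : WithTop ℕ∞} {p : N}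

theorem contDiffAt_inverse_of_eq_id {T : N → G →L[ℝ] G} (hT : ContDiffAt ℝ n T p)
    (hTp : T p = .id ℝ G) :
    ContDiffAt ℝ n (fun q => (T q).inverse) p ∧ ∀ᶠ q in 𝓝 p, (T q).IsInvertible := by
  have hrefl : T p = (ContinuousLinearEquiv.refl ℝ G : G →L[ℝ] G) := hTp
  refine ⟨ContDiffAt.comp p (g := ContinuousLinearMap.inverse)
    (hrefl ▸ contDiffAt_map_inverse _) hT, hT.continuousAt.eventually ?_⟩
  rw [hrefl]
  exact ContinuousLinearEquiv.nhds _

theorem exists_contDiffAt_leftInverse {A : N → G →L[ℝ] H} (hA : ContDiffAt ℝ n A p)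
    {L : H →L[ℝ] G} (hL : L ∘L A p = .id ℝ G) :
    ∃ B : N → H →L[ℝ] G, ContDiffAt ℝ n B p ∧ ∀ᶠ q in 𝓝 p, ∀ u, B q (A q u) = u := by
  obtain ⟨hinv, hT⟩ := contDiffAt_inverse_of_eq_id (contDiffAt_const.clm_comp hA) hL
  exact ⟨_, hinv.clm_comp contDiffAt_const,
    hT.mono fun q hq u => DFunLike.congr_fun hq.inverse_comp_self u⟩

theorem exists_contDiffAt_rightInverse {A : N → H →L[ℝ] G} (hA : ContDiffAt ℝ n A p)
    {R : G →L[ℝ] H} (hR : A p ∘L R = .id ℝ G) :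
    ∃ B : N → G →L[ℝ] H, ContDiffAt ℝ n B p ∧ ∀ᶠ q in 𝓝 p, ∀ u, A q (B q u) = u := by
  obtain ⟨hinv, hT⟩ := contDiffAt_inverse_of_eq_id (hA.clm_comp contDiffAt_const) hR
  exact ⟨_, contDiffAt_const.clm_comp hinv,
    hT.mono fun q hq u => DFunLike.congr_fun hq.self_comp_inverse u⟩

end SmoothInverse

theorem twoForm_swap (θ : N [⋀^Fin 2]→L[ℝ] ℝ) (u v : N) : θ ![u, v] = -θ ![v, u] := by
  refine (congrArg θ ?_).trans (θ.map_swap ![v, u] (show (0 : Fin 2) ≠ 1 by decide))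
  ext i
  fin_cases i <;> rfl

variable (N) in
/-- The identification of linear forms with alternating 1-forms. -/
def oneFormOfDual : (N →L[ℝ] ℝ) →L[ℝ] N [⋀^Fin 1]→L[ℝ] ℝ :=
  (ContinuousAlternatingMap.ofSubsingletonLIE (𝕜 := ℝ) (E := N) (F := ℝ)
    (0 : Fin 1)).toContinuousLinearEquiv.toContinuousLinearMap

/-- The alternating 2-form `(u, v) ↦ B u v - B v u` of a bilinear form `B`. -/
def alternation (B : N →L[ℝ] N →L[ℝ] ℝ) : N [⋀^Fin 2]→L[ℝ] ℝ :=
  ContinuousAlternatingMap.alternatizeUncurryFinCLM ℝ N ℝ (oneFormOfDual N ∘L B)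

theorem alternation_apply (B : N →L[ℝ] N →L[ℝ] ℝ) (u : Fin 2 → N) :
    alternation B u = B (u 0) (u 1) - B (u 1) (u 0) := by
  refine (ContinuousAlternatingMap.alternatizeUncurryFin_apply _ _).trans ?_
  simp [oneFormOfDual, Fin.sum_univ_two, Fin.removeNth, sub_eq_add_neg]

theorem eq_half_smul_alternation {θ : N [⋀^Fin 2]→L[ℝ] ℝ} {B : N →L[ℝ] N →L[ℝ] ℝ}
    (h : ∀ u v, θ ![u, v] = B u v) : θ = (1 / 2 : ℝ) • alternation B := by
  ext u
  have hu : u = ![u 0, u 1] := by ext i; fin_cases i <;> rfl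
  have hB : θ u = B (u 0) (u 1) := by rw [← h, ← hu]
  have hB' : B (u 1) (u 0) = -B (u 0) (u 1) := by rw [← h, ← h, twoForm_swap]
  refine .trans ?_ (congrArg ((1 / 2 : ℝ) * ·) (alternation_apply B u).symm)
  simp only [hB, hB']
  ring

section Derivative

variable {θ : N → N [⋀^Fin 2]→L[ℝ] ℝ} {Ω : N → N →L[ℝ] N →L[ℝ] ℝ} {p : N}

theorem differentiableAt_twoForm (hΩ : DifferentiableAt ℝ Ω p)
    (h : ∀ᶠ q in 𝓝 p, ∀ u v, θ q ![u, v] = Ω q u v) : DifferentiableAt ℝ θ p := by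
  have hd : DifferentiableAt ℝ (fun q => alternation (Ω q)) p :=
    (ContinuousAlternatingMap.alternatizeUncurryFinCLM ℝ N ℝ).differentiableAt.comp p
      ((differentiableAt_const (oneFormOfDual N)).clm_comp hΩ)
  exact (DifferentiableAt.const_smul (R := ℝ) (f := fun q => alternation (Ω q)) hd
    (1 / 2 : ℝ)).congr_of_eventuallyEq (h.mono fun q hq => eq_half_smul_alternation hq)

theorem hasFDerivAt_apply_const {G H : Type*} [NormedAddCommGroup G] [NormedSpace ℝ G]
    [NormedAddCommGroup H] [NormedSpace ℝ H] {A : N → G →L[ℝ] H} {A' : N →L[ℝ] G →L[ℝ] H}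
    (hA : HasFDerivAt A A' p) (v : G) : HasFDerivAt (fun q => A q v) (A'.flip v) p :=
  (hA.clm_apply (hasFDerivAt_const v p)).congr_fderiv (by simp)

theorem extDeriv_twoForm_apply (hΩ : DifferentiableAt ℝ Ω p)
    (h : ∀ᶠ q in 𝓝 p, ∀ u v, θ q ![u, v] = Ω q u v) (a b c : N) :
    extDeriv θ p ![a, b, c] =
      fderiv ℝ Ω p a b c + fderiv ℝ Ω p b c a + fderiv ℝ Ω p c a b := by
  have hθ (w u v : N) : fderiv ℝ (fun q => θ q ![u, v]) p w = fderiv ℝ Ω p w u v := by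
    have heq : (fun q => θ q ![u, v]) =ᶠ[𝓝 p] fun q => Ω q u v := h.mono fun q hq => hq u v
    rw [heq.fderiv_eq,
      (hasFDerivAt_apply_const (hasFDerivAt_apply_const hΩ.hasFDerivAt u) v).fderiv]
    rfl
  have hswap : fderiv ℝ Ω p b a c = -fderiv ℝ Ω p b c a := by
    rw [← hθ, ← hθ, ← neg_apply, ← fderiv_fun_neg]
    congr 2
    exact funext fun q => twoForm_swap _ _ _
  have h₀ : Fin.removeNth 0 ![a, b, c] = ![b, c] := by ext i; fin_cases i <;> rfl
  have h₁ : Fin.removeNth 1 ![a, b, c] = ![a, c] := by ext i; fin_cases i <;> rfl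
  have h₂ : Fin.removeNth 2 ![a, b, c] = ![a, b] := by ext i; fin_cases i <;> rfl
  rw [extDeriv_apply (differentiableAt_twoForm hΩ h), Fin.sum_univ_three, h₀, h₁, h₂, hθ, hθ, hθ]
  simp [hswap]

end Derivative

section Inverse

variable {E : Type*} [NormedAddCommGroup E] [NormedSpace ℝ E] {A : N → N →L[ℝ] E}
  {Q : N → (E →L[ℝ] ℝ) →L[ℝ] E} {Y : N → (E →L[ℝ] ℝ) →L[ℝ] N} {Ω : N → N →L[ℝ] N →L[ℝ] ℝ}
  {θ : N → N [⋀^Fin 2]→L[ℝ] ℝ} {p : N}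

theorem fderiv_inverse_twoForm
    (hA : DifferentiableAt ℝ A p) (hY : DifferentiableAt ℝ Y p) (hQ : DifferentiableAt ℝ Q p)
    (hΩ : DifferentiableAt ℝ Ω p) (hAY : ∀ᶠ q in 𝓝 p, ∀ ξ, A q (Y q ξ) = Q q ξ)
    (hΩY : ∀ᶠ q in 𝓝 p, ∀ ξ v, Ω q (Y q ξ) v = ξ (A q v))
    (hswap : ∀ u v, Ω p u v = -Ω p v u) (w : N) (ξ η : E →L[ℝ] ℝ) :
    fderiv ℝ Ω p w (Y p ξ) (Y p η) =
      ξ (fderiv ℝ A p w (Y p η)) - η (fderiv ℝ A p w (Y p ξ)) + η (fderiv ℝ Q p w ξ) := by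
  have hYξ : HasFDerivAt (fun q => Y q ξ) ((fderiv ℝ Y p).flip ξ) p :=
    hasFDerivAt_apply_const hY.hasFDerivAt ξ
  have hdAY : fderiv ℝ Q p w ξ = A p (fderiv ℝ Y p w ξ) + fderiv ℝ A p w (Y p ξ) :=
    DFunLike.congr_fun ((hasFDerivAt_apply_const hQ.hasFDerivAt ξ).unique
      ((hA.hasFDerivAt.clm_apply hYξ).congr_of_eventuallyEq
        (hAY.mono fun q hq => (hq ξ).symm))) w
  have hdΩY : ξ (fderiv ℝ A p w (Y p η)) =
      Ω p (fderiv ℝ Y p w ξ) (Y p η) + fderiv ℝ Ω p w (Y p ξ) (Y p η) :=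
    DFunLike.congr_fun
      ((ξ.hasFDerivAt.comp p (hasFDerivAt_apply_const hA.hasFDerivAt (Y p η))).unique
        ((hasFDerivAt_apply_const (hΩ.hasFDerivAt.clm_apply hYξ) (Y p η)).congr_of_eventuallyEq
          (hΩY.mono fun q hq => (hq ξ (Y p η)).symm))) w
  rw [hdAY, hdΩY, hswap, hΩY.self_of_nhds, map_add]
  ring

variable [FiniteDimensional ℝ N] [FiniteDimensional ℝ E]

theorem exists_contDiffAt_inverse_twoForm
    (hA : ContDiffAt ℝ ∞ A p) (hQ : ContDiffAt ℝ ∞ Q p) (hinj : Function.Injective (A p))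
    (hQA : ∀ᶠ q in 𝓝 p, ∀ ξ, ∃ u, A q u = Q q ξ) (hAQ : ∀ u, ∃ ξ, Q p ξ = A p u)
    (hθ : ∀ᶠ q in 𝓝 p, ∀ u v ξ, Q q ξ = A q u → θ q ![u, v] = ξ (A q v)) :
    ∃ (Y : N → (E →L[ℝ] ℝ) →L[ℝ] N) (Ω : N → N →L[ℝ] N →L[ℝ] ℝ),
      ContDiffAt ℝ ∞ Y p ∧ ContDiffAt ℝ ∞ Ω p ∧ (∀ᶠ q in 𝓝 p, ∀ ξ, A q (Y q ξ) = Q q ξ) ∧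
      ∀ᶠ q in 𝓝 p, ∀ u v, θ q ![u, v] = Ω q u v := by
  have : CompleteSpace N := FiniteDimensional.complete ℝ N
  obtain ⟨L, hL⟩ := (A p : N →ₗ[ℝ] E).exists_leftInverse_of_injective (LinearMap.ker_eq_bot.2 hinj)
  obtain ⟨B, hB, hBA⟩ := exists_contDiffAt_leftInverse hA
    (L := LinearMap.toContinuousLinearMap L) (ContinuousLinearMap.ext (LinearMap.congr_fun hL))
  have hAY : ∀ᶠ q in 𝓝 p, ∀ ξ, A q (B q (Q q ξ)) = Q q ξ := by
    filter_upwards [hBA, hQA] with q hq hq' ξ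
    obtain ⟨u, hu⟩ := hq' ξ
    rw [← hu, hq]
  have hY : ContDiffAt ℝ ∞ (fun q => B q ∘L Q q) p := hB.clm_comp hQ
  have hsurj : Function.Surjective (B p ∘L Q p) := fun u => (hAQ u).imp fun ξ hξ => by
    rw [ContinuousLinearMap.comp_apply, hξ, hBA.self_of_nhds]
  obtain ⟨s, hs⟩ := ((B p ∘L Q p : (E →L[ℝ] ℝ) →L[ℝ] N) :
    (E →L[ℝ] ℝ) →ₗ[ℝ] N).exists_rightInverse_of_surjective (LinearMap.range_eq_top.2 hsurj)
  obtain ⟨R, hR, hYR⟩ := exists_contDiffAt_rightInverse hY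
    (R := LinearMap.toContinuousLinearMap s) (ContinuousLinearMap.ext (LinearMap.congr_fun hs))
  refine ⟨_, fun q => (ContinuousLinearMap.compL ℝ N E ℝ).flip (A q) ∘L R q, hY,
    ((ContinuousLinearMap.contDiff _).contDiffAt.comp p hA).clm_comp hR, hAY, ?_⟩
  filter_upwards [hAY, hYR, hθ] with q hAYq hYRq hθq u v
  exact hθq u v (R q u) ((hAYq _).symm.trans (congrArg (A q) (hYRq u)))

variable {f : N → E} {P : E → (E →L[ℝ] ℝ) →L[ℝ] E} {a b c : N} {α β γ : E →L[ℝ] ℝ}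

set_option synthInstance.maxHeartbeats 40000 in
-- The search for the norm on `(E →L[ℝ] ℝ) →L[ℝ] E` exceeds the default limit.
theorem extDeriv_inverse_twoForm_apply (hf : ContDiffAt ℝ ∞ f p) (hP : ContDiffAt ℝ ∞ P (f p))
    (hinj : Function.Injective (fderiv ℝ f p))
    (him : ∀ᶠ q in 𝓝 p, ∀ ξ, ∃ u, fderiv ℝ f q u = P (f q) ξ)
    (him' : ∀ u, ∃ ξ, P (f p) ξ = fderiv ℝ f p u)
    (hθ : ∀ᶠ q in 𝓝 p, ∀ u v ξ, P (f q) ξ = fderiv ℝ f q u → θ q ![u, v] = ξ (fderiv ℝ f q v))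
    (ha : fderiv ℝ f p a = P (f p) γ) (hb : fderiv ℝ f p b = P (f p) α)
    (hc : fderiv ℝ f p c = P (f p) β) :
    extDeriv θ p ![a, b, c] = β (fderiv ℝ P (f p) (P (f p) γ) α) +
      γ (fderiv ℝ P (f p) (P (f p) α) β) + α (fderiv ℝ P (f p) (P (f p) β) γ) := by
  have hdf : ContDiffAt ℝ ∞ (fderiv ℝ f) p := hf.fderiv_right (by simp)
  have hPf : ContDiffAt ℝ ∞ (fun q => P (f q)) p := hP.comp p hf
  obtain ⟨Y, Ω, hY, hΩ, hfY, hθΩ⟩ := exists_contDiffAt_inverse_twoForm hdf hPf hinj him him' hθ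
  replace hΩ : DifferentiableAt ℝ Ω p := hΩ.differentiableAt (by simp)
  have hΩY : ∀ᶠ q in 𝓝 p, ∀ ξ v, Ω q (Y q ξ) v = ξ (fderiv ℝ f q v) := by
    filter_upwards [hfY, hθ, hθΩ] with q hfYq hθq hθΩq ξ v
    rw [← hθΩq, hθq _ _ _ (hfYq ξ).symm]
  have hswap (u v : N) : Ω p u v = -Ω p v u := by
    rw [← hθΩ.self_of_nhds, ← hθΩ.self_of_nhds, twoForm_swap]
  have hsymm (u v : N) : fderiv ℝ (fderiv ℝ f) p u v = fderiv ℝ (fderiv ℝ f) p v u :=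
    hf.isSymmSndFDerivAt (by simpa using WithTop.coe_le_coe.2 (le_top (a := (2 : ℕ∞)))) u v
  have hdPf (w : N) : fderiv ℝ (fun q => P (f q)) p w = fderiv ℝ P (f p) (fderiv ℝ f p w) :=
    DFunLike.congr_fun
      (fderiv_comp p (hP.differentiableAt (by simp)) (hf.differentiableAt (by simp))) w
  have hdΩ := fderiv_inverse_twoForm (hdf.differentiableAt (by simp))
    (hY.differentiableAt (by simp)) (hPf.differentiableAt (by simp)) hΩ hfY hΩY hswap
  have hYp {ξ : E →L[ℝ] ℝ} {u : N} (hu : fderiv ℝ f p u = P (f p) ξ) : u = Y p ξ :=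
    hinj (hu.trans (hfY.self_of_nhds ξ).symm)
  obtain rfl := hYp ha
  obtain rfl := hYp hb
  obtain rfl := hYp hc
  -- The second derivatives of `f` cancel in the cyclic sum.
  rw [extDeriv_twoForm_apply hΩ hθΩ, hdΩ, hdΩ, hdΩ, hdPf, hdPf, hdPf, ha, hb, hc,
    hsymm (Y p β) (Y p γ), hsymm (Y p β) (Y p α), hsymm (Y p α) (Y p γ)]
  ring

end Inverse

end ClosedForm

section ChartDerivatives

variable {E : Type*} [NormedAddCommGroup E] [NormedSpace ℝ E]
  {F : Type*} [NormedAddCommGroup F] [NormedSpace ℝ F]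
  {M : Type*} [TopologicalSpace M] [ChartedSpace E M] {φ : OpenPartialHomeomorph M E} {x : M}

theorem mdifferentiable_of_mem_maximalAtlas (hφ : φ ∈ IsManifold.maximalAtlas 𝓘(ℝ, E) ∞ M) :
    φ.MDifferentiable 𝓘(ℝ, E) 𝓘(ℝ, E) :=
  ⟨fun _ hx => ((contMDiffAt_of_mem_maximalAtlas hφ hx).mdifferentiableAt
      (by simp)).mdifferentiableWithinAt,
    fun _ hx => ((contMDiffAt_symm_of_mem_maximalAtlas hφ hx).mdifferentiableAt
      (by simp)).mdifferentiableWithinAt⟩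

theorem isInvertible_mfderiv_of_mdifferentiable {N : Type*} [TopologicalSpace N]
    [ChartedSpace E N] {φ : OpenPartialHomeomorph M N}
    (hφ : φ.MDifferentiable 𝓘(ℝ, E) 𝓘(ℝ, E)) (hx : x ∈ φ.source) :
    (mfderiv 𝓘(ℝ, E) 𝓘(ℝ, E) φ x).IsInvertible :=
  ⟨hφ.mfderiv hx, rfl⟩

/-- The differential at `x` of the chart `φ`, as an isomorphism of the tangent space with the model
space. -/
def chartDeriv (hφ : φ ∈ IsManifold.maximalAtlas 𝓘(ℝ, E) ∞ M) (hx : x ∈ φ.source) :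
    TangentSpace 𝓘(ℝ, E) x ≃L[ℝ] E :=
  ((mdifferentiable_of_mem_maximalAtlas hφ).mfderiv hx).trans (fromTangentSpace (φ x))

theorem isInvertible_mvfderiv (hφ : φ ∈ IsManifold.maximalAtlas 𝓘(ℝ, E) ∞ M)
    (hx : x ∈ φ.source) : (mvfderiv 𝓘(ℝ, E) φ x).IsInvertible :=
  ⟨chartDeriv hφ hx, rfl⟩

theorem mvfderiv_injective (hφ : φ ∈ IsManifold.maximalAtlas 𝓘(ℝ, E) ∞ M) (hx : x ∈ φ.source) :
    Function.Injective (mvfderiv 𝓘(ℝ, E) φ x) :=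
  (chartDeriv hφ hx).injective

/-- The vector field whose representation in the chart `φ` is the constant field `e`. -/
def chartField (φ : OpenPartialHomeomorph M E) (e : E) (x : M) : TangentSpace 𝓘(ℝ, E) x :=
  (mvfderiv 𝓘(ℝ, E) φ x).inverse e

theorem mvfderiv_chartField (hφ : φ ∈ IsManifold.maximalAtlas 𝓘(ℝ, E) ∞ M) (hx : x ∈ φ.source)
    (e : E) : mvfderiv 𝓘(ℝ, E) φ x (chartField φ e x) = e :=
  (isInvertible_mvfderiv hφ hx).self_apply_inverse e

theorem chartField_mvfderiv (hφ : φ ∈ IsManifold.maximalAtlas 𝓘(ℝ, E) ∞ M) (hx : x ∈ φ.source)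
    (v : TangentSpace 𝓘(ℝ, E) x) : chartField φ (mvfderiv 𝓘(ℝ, E) φ x v) x = v :=
  (isInvertible_mvfderiv hφ hx).inverse_apply_self v

theorem mfderiv_chart_symm (hφ : φ ∈ IsManifold.maximalAtlas 𝓘(ℝ, E) ∞ M) (hx : x ∈ φ.source)
    (e : E) :
    mfderiv 𝓘(ℝ, E) 𝓘(ℝ, E) φ.symm (φ x) ((fromTangentSpace (𝕜 := ℝ) (φ x)).symm e) =
      chartField φ e x := by
  conv_lhs => rw [← mvfderiv_chartField hφ hx e]
  exact DFunLike.congr_fun ((mdifferentiable_of_mem_maximalAtlas hφ).symm_comp_deriv hx) _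

theorem mvfderiv_congr {f g : M → F} (h : f =ᶠ[𝓝 x] g) :
    mvfderiv 𝓘(ℝ, E) f x = mvfderiv 𝓘(ℝ, E) g x :=
  ContinuousLinearMap.ext fun v =>
    DFunLike.congr_fun (h.mfderiv_eq (I := 𝓘(ℝ, E)) (I' := 𝓘(ℝ, F))) v

theorem mvfderiv_vector_comp {G : Type*} [NormedAddCommGroup G] [NormedSpace ℝ G] {g : F → G}
    {f : M → F} (hg : DifferentiableAt ℝ g (f x)) (hf : MDifferentiableAt 𝓘(ℝ, E) 𝓘(ℝ, F) f x) :
    mvfderiv 𝓘(ℝ, E) (g ∘ f) x = fderiv ℝ g (f x) ∘L mvfderiv 𝓘(ℝ, E) f x := by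
  have h := mfderiv_comp x hg.mdifferentiableAt hf
  rw [mfderiv_eq_fderiv] at h
  exact h

theorem fderiv_comp_eq_mvfderiv_mfderiv {G : Type*} [NormedAddCommGroup G] [NormedSpace ℝ G]
    {g : M → F} {f : G → M} {p : G} (hg : MDifferentiableAt 𝓘(ℝ, E) 𝓘(ℝ, F) g (f p))
    (hf : MDifferentiableAt 𝓘(ℝ, G) 𝓘(ℝ, E) f p) (u : G) :
    fderiv ℝ (g ∘ f) p u = mvfderiv 𝓘(ℝ, E) g (f p)
      (mfderiv 𝓘(ℝ, G) 𝓘(ℝ, E) f p ((fromTangentSpace (𝕜 := ℝ) p).symm u)) := by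
  rw [← mfderiv_eq_fderiv]
  exact DFunLike.congr_fun (mfderiv_comp p hg hf) u

theorem fderiv_comp_chart_symm (hφ : φ ∈ IsManifold.maximalAtlas 𝓘(ℝ, E) ∞ M)
    (hx : x ∈ φ.source) {g : M → F} (hg : MDifferentiableAt 𝓘(ℝ, E) 𝓘(ℝ, F) g x)
    (v : TangentSpace 𝓘(ℝ, E) x) :
    fderiv ℝ (g ∘ φ.symm) (φ x) (mvfderiv 𝓘(ℝ, E) φ x v) = mvfderiv 𝓘(ℝ, E) g x v := by
  have hg' : MDifferentiableAt 𝓘(ℝ, E) 𝓘(ℝ, F) g (φ.symm (φ x)) := by rwa [φ.left_inv hx]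
  rw [fderiv_comp_eq_mvfderiv_mfderiv hg'
    ((mdifferentiable_of_mem_maximalAtlas hφ).mdifferentiableAt_symm (φ.map_source hx)),
    mfderiv_chart_symm hφ hx, chartField_mvfderiv hφ hx, φ.left_inv hx]

theorem contDiffAt_comp_chart_symm (hφ : φ ∈ IsManifold.maximalAtlas 𝓘(ℝ, E) ∞ M) {p : E}
    (hp : p ∈ φ.target) {g : M → F} (hg : ContMDiffAt 𝓘(ℝ, E) 𝓘(ℝ, F) ∞ g (φ.symm p)) :
    ContDiffAt ℝ ∞ (g ∘ φ.symm) p :=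
  (hg.comp p (contMDiffAt_symm_of_mem_maximalAtlas hφ hp)).contDiffAt

end ChartDerivatives

section ChartCalculus

variable {E : Type*} [NormedAddCommGroup E] [NormedSpace ℝ E]
  {F : Type*} [NormedAddCommGroup F] [NormedSpace ℝ F]
  {M : Type*} [TopologicalSpace M] [ChartedSpace E M] [IsManifold 𝓘(ℝ, E) ∞ M]
  {φ : OpenPartialHomeomorph M E} {x : M}

theorem contMDiffAt_mvfderiv {f : M → F} (hf : ContMDiffAt 𝓘(ℝ, E) 𝓘(ℝ, F) ∞ f x) :
    ContMDiffAt 𝓘(ℝ, E) (𝓘(ℝ, E).prod 𝓘(ℝ, E →L[ℝ] F)) ∞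
      (fun y => TotalSpace.mk' (E →L[ℝ] F)
        (E := fun y : M => TangentSpace 𝓘(ℝ, E) y →L[ℝ] Bundle.Trivial M F y) y
        (mvfderiv 𝓘(ℝ, E) f y)) x := by
  refine contMDiffAt_hom_bundle _ |>.2 ⟨contMDiffAt_id, ?_⟩
  refine (hf.mfderiv_const (m := ∞) (by simp)).congr_of_eventuallyEq (Eventually.of_forall ?_)
  intro y
  ext v
  simp only [inTangentCoordinates, ContinuousLinearMap.inCoordinates,
    Trivial.fiberBundle_trivializationAt', Trivial.continuousLinearMapAt_trivialization,
    ContinuousLinearMap.id_comp, ContinuousLinearMap.comp_apply,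
    TangentBundle.continuousLinearMapAt_model_space, id_eq]
  rfl

theorem contMDiffAt_mvfderiv_apply {f : M → F} (hf : ContMDiffAt 𝓘(ℝ, E) 𝓘(ℝ, F) ∞ f x)
    {Y : ∀ x : M, TangentSpace 𝓘(ℝ, E) x}
    (hY : ContMDiffAt 𝓘(ℝ, E) 𝓘(ℝ, E).tangent ∞ (fun y => TotalSpace.mk' E y (Y y)) x) :
    ContMDiffAt 𝓘(ℝ, E) 𝓘(ℝ, F) ∞ (fun y => mvfderiv 𝓘(ℝ, E) f y (Y y)) x := by
  have h := (contMDiffAt_mvfderiv hf).clm_bundle_apply (F₁ := E) (F₂ := F)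
    (E₁ := (TangentSpace 𝓘(ℝ, E) : M → Type _)) (E₂ := Bundle.Trivial M F) (b := id) (v := Y) hY
  exact ((contMDiffAt_totalSpace).1 h).2

theorem mdifferentiableAt_mvfderiv_apply {f : M → F} (hf : ContMDiffAt 𝓘(ℝ, E) 𝓘(ℝ, F) ∞ f x)
    {Y : ∀ x : M, TangentSpace 𝓘(ℝ, E) x}
    (hY : MDifferentiableAt 𝓘(ℝ, E) 𝓘(ℝ, E).tangent (fun y => TotalSpace.mk' E y (Y y)) x) :
    MDifferentiableAt 𝓘(ℝ, E) 𝓘(ℝ, F) (fun y => mvfderiv 𝓘(ℝ, E) f y (Y y)) x := by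
  have h := MDifferentiableAt.clm_bundle_apply (F₁ := E) (F₂ := F)
    (E₁ := (TangentSpace 𝓘(ℝ, E) : M → Type _)) (E₂ := Bundle.Trivial M F) (b := id) (v := Y)
    ((contMDiffAt_mvfderiv hf).mdifferentiableAt (by simp)) hY
  exact ((mdifferentiableAt_totalSpace _ _).1 h).2

theorem mvfderiv_mvfderiv_add {f : M → F} (hf : ContMDiffAt 𝓘(ℝ, E) 𝓘(ℝ, F) ∞ f x)
    {Y Y' : ∀ x : M, TangentSpace 𝓘(ℝ, E) x}
    (hY : MDifferentiableAt 𝓘(ℝ, E) 𝓘(ℝ, E).tangent (fun y => TotalSpace.mk' E y (Y y)) x)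
    (hY' : MDifferentiableAt 𝓘(ℝ, E) 𝓘(ℝ, E).tangent (fun y => TotalSpace.mk' E y (Y' y)) x) :
    mvfderiv 𝓘(ℝ, E) (fun y => mvfderiv 𝓘(ℝ, E) f y ((Y + Y') y)) x =
      mvfderiv 𝓘(ℝ, E) (fun y => mvfderiv 𝓘(ℝ, E) f y (Y y)) x +
        mvfderiv 𝓘(ℝ, E) (fun y => mvfderiv 𝓘(ℝ, E) f y (Y' y)) x := by
  simp only [Pi.add_apply, map_add]
  exact mvfderiv_add (mdifferentiableAt_mvfderiv_apply hf hY)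
    (mdifferentiableAt_mvfderiv_apply hf hY')

theorem mvfderiv_mvfderiv_smul {f : M → F} (hf : ContMDiffAt 𝓘(ℝ, E) 𝓘(ℝ, F) ∞ f x)
    {g : M → ℝ} (hg : MDifferentiableAt 𝓘(ℝ, E) 𝓘(ℝ, ℝ) g x)
    {Y : ∀ x : M, TangentSpace 𝓘(ℝ, E) x}
    (hY : MDifferentiableAt 𝓘(ℝ, E) 𝓘(ℝ, E).tangent (fun y => TotalSpace.mk' E y (Y y)) x)
    (v : TangentSpace 𝓘(ℝ, E) x) :
    mvfderiv 𝓘(ℝ, E) (fun y => mvfderiv 𝓘(ℝ, E) f y ((g • Y) y)) x v =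
      g x • mvfderiv 𝓘(ℝ, E) (fun y => mvfderiv 𝓘(ℝ, E) f y (Y y)) x v +
        mvfderiv 𝓘(ℝ, E) g x v • mvfderiv 𝓘(ℝ, E) f x (Y x) := by
  have h := mvfderiv_smul hg (mdifferentiableAt_mvfderiv_apply hf hY)
  simp only [Pi.smul_apply', map_smul]
  refine (DFunLike.congr_fun h v).trans ?_
  simp

theorem contMDiffAt_chartField_apply [CompleteSpace E]
    (hφ : φ ∈ IsManifold.maximalAtlas 𝓘(ℝ, E) ∞ M)
    (hx : x ∈ φ.source) {g : M → E} (hg : ContMDiffAt 𝓘(ℝ, E) 𝓘(ℝ, E) ∞ g x) :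
    ContMDiffAt 𝓘(ℝ, E) 𝓘(ℝ, E).tangent ∞
      (fun y => TotalSpace.mk' E y (chartField φ (g y) y)) x := by
  have hV : ContMDiffAt 𝓘(ℝ, E) 𝓘(ℝ, E).tangent ∞
      (fun y : E => TotalSpace.mk' E (E := (TangentSpace 𝓘(ℝ, E) : E → Type _)) y
        ((fromTangentSpace (𝕜 := ℝ) y).symm ((g ∘ φ.symm) y))) (φ x) := by
    rw [contMDiffAt_vectorSpace_iff_contDiffAt]
    refine contDiffAt_comp_chart_symm hφ (φ.map_source hx) ?_
    rwa [φ.left_inv hx]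
  refine (hV.mpullback_vectorField_preimage (contMDiffAt_of_mem_maximalAtlas hφ hx)
    (isInvertible_mfderiv_of_mdifferentiable (mdifferentiable_of_mem_maximalAtlas hφ) hx)
    (by simp)).congr_of_eventuallyEq ?_
  filter_upwards [φ.open_source.mem_nhds hx] with y hy
  change TotalSpace.mk' E y (chartField φ (g y) y) =
    TotalSpace.mk' E y (chartField φ (g (φ.symm (φ y))) y)
  rw [φ.left_inv hy]

theorem contMDiffAt_chartField [CompleteSpace E] (hφ : φ ∈ IsManifold.maximalAtlas 𝓘(ℝ, E) ∞ M)
    (hx : x ∈ φ.source) (e : E) :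
    ContMDiffAt 𝓘(ℝ, E) 𝓘(ℝ, E).tangent ∞ (fun y => TotalSpace.mk' E y (chartField φ e y)) x :=
  contMDiffAt_chartField_apply hφ hx contMDiffAt_const

end ChartCalculus

section LieBracket

variable {E : Type*} [NormedAddCommGroup E] [NormedSpace ℝ E]
  {M : Type*} [TopologicalSpace M] [ChartedSpace E M] {φ : OpenPartialHomeomorph M E} {x : M}

theorem mpullback_chart_symm (hφ : φ ∈ IsManifold.maximalAtlas 𝓘(ℝ, E) ∞ M) (hx : x ∈ φ.source)
    (Z : ∀ x : M, TangentSpace 𝓘(ℝ, E) x) :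
    VectorField.mpullback 𝓘(ℝ, E) 𝓘(ℝ, E) φ.symm Z (φ x) =
      (fromTangentSpace (𝕜 := ℝ) (φ x)).symm (mvfderiv 𝓘(ℝ, E) φ x (Z x)) := by
  have hinv : (mfderiv 𝓘(ℝ, E) 𝓘(ℝ, E) φ.symm (φ x)).IsInvertible :=
    isInvertible_mfderiv_of_mdifferentiable (mdifferentiable_of_mem_maximalAtlas hφ).symm
      (φ.map_source hx)
  rw [VectorField.mpullback_apply, hinv.inverse_apply_eq, mfderiv_chart_symm hφ hx,
    chartField_mvfderiv hφ hx, φ.left_inv hx]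

theorem mlieBracket_eq_lieBracket (V W : ∀ p : E, TangentSpace 𝓘(ℝ, E) p) :
    VectorField.mlieBracket 𝓘(ℝ, E) V W = VectorField.lieBracket ℝ V W := by
  rw [← VectorField.mlieBracketWithin_univ, VectorField.mlieBracketWithin_eq_lieBracketWithin]
  exact VectorField.lieBracketWithin_univ

variable [IsManifold 𝓘(ℝ, E) ∞ M]

theorem fderiv_mpullback_chart_symm (hφ : φ ∈ IsManifold.maximalAtlas 𝓘(ℝ, E) ∞ M)
    (hx : x ∈ φ.source) {Z : ∀ x : M, TangentSpace 𝓘(ℝ, E) x}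
    (hZ : MDifferentiableAt 𝓘(ℝ, E) 𝓘(ℝ, E).tangent (fun y => TotalSpace.mk' E y (Z y)) x)
    (v : TangentSpace 𝓘(ℝ, E) x) :
    fderiv ℝ (VectorField.mpullback 𝓘(ℝ, E) 𝓘(ℝ, E) φ.symm Z : E → E) (φ x)
        (mvfderiv 𝓘(ℝ, E) φ x v) =
      mvfderiv 𝓘(ℝ, E) (fun y => mvfderiv 𝓘(ℝ, E) φ y (Z y)) x v := by
  have heq : (VectorField.mpullback 𝓘(ℝ, E) 𝓘(ℝ, E) φ.symm Z : E → E) =ᶠ[𝓝 (φ x)]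
      (fun y => mvfderiv 𝓘(ℝ, E) φ y (Z y)) ∘ φ.symm := by
    filter_upwards [φ.open_target.mem_nhds (φ.map_source hx)] with p hp
    have h := mpullback_chart_symm hφ (φ.map_target hp) Z
    rw [φ.right_inv hp] at h
    exact h
  rw [heq.fderiv_eq, fderiv_comp_chart_symm hφ hx
    (mdifferentiableAt_mvfderiv_apply (contMDiffAt_of_mem_maximalAtlas hφ hx) hZ)]

theorem mvfderiv_mlieBracket [CompleteSpace E] (hφ : φ ∈ IsManifold.maximalAtlas 𝓘(ℝ, E) ∞ M)
    (hx : x ∈ φ.source) {X Y : ∀ x : M, TangentSpace 𝓘(ℝ, E) x}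
    (hX : MDifferentiableAt 𝓘(ℝ, E) 𝓘(ℝ, E).tangent (fun y => TotalSpace.mk' E y (X y)) x)
    (hY : MDifferentiableAt 𝓘(ℝ, E) 𝓘(ℝ, E).tangent (fun y => TotalSpace.mk' E y (Y y)) x) :
    mvfderiv 𝓘(ℝ, E) φ x (VectorField.mlieBracket 𝓘(ℝ, E) X Y x) =
      mvfderiv 𝓘(ℝ, E) (fun y => mvfderiv 𝓘(ℝ, E) φ y (Y y)) x (X x) -
      mvfderiv 𝓘(ℝ, E) (fun y => mvfderiv 𝓘(ℝ, E) φ y (X y)) x (Y x) := by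
  have : IsManifold 𝓘(ℝ, E) (minSmoothness ℝ 3) M := by
    rw [minSmoothness_of_isRCLikeNormedField]
    exact IsManifold.of_le (n := ∞) (WithTop.coe_le_coe.2 (le_top (a := (3 : ℕ∞))))
  have hφx := φ.map_source hx
  have hle : minSmoothness ℝ 2 ≤ (∞ : WithTop ℕ∞) := by
    rw [minSmoothness_of_isRCLikeNormedField]
    exact WithTop.coe_le_coe.2 (le_top (a := (2 : ℕ∞)))
  have hpull := VectorField.mpullback_mlieBracket (V := X) (W := Y) (n := ∞) (f := φ.symm)
    (x₀ := φ x) (by rwa [φ.left_inv hx]) (by rwa [φ.left_inv hx])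
    (contMDiffAt_symm_of_mem_maximalAtlas hφ hφx) hle
  rw [mpullback_chart_symm hφ hx, mlieBracket_eq_lieBracket] at hpull
  have hXY := fderiv_mpullback_chart_symm hφ hx hY (X x)
  have hYX := fderiv_mpullback_chart_symm hφ hx hX (Y x)
  have hpullX := mpullback_chart_symm hφ hx X
  have hpullY := mpullback_chart_symm hφ hx Y
  refine hpull.trans (congrArg₂ (· - ·) (Eq.trans ?_ hXY) (Eq.trans ?_ hYX))
  · exact congrArg (fderiv ℝ _ (φ x)) hpullX
  · exact congrArg (fderiv ℝ _ (φ x)) hpullY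

end LieBracket

section ChartRepresentation

variable {E : Type*} [NormedAddCommGroup E] [NormedSpace ℝ E]
  {M : Type*} [TopologicalSpace M] [ChartedSpace E M] {φ : OpenPartialHomeomorph M E} {x : M}

theorem exists_comp_mvfderiv_eq (hφ : φ ∈ IsManifold.maximalAtlas 𝓘(ℝ, E) ∞ M)
    (hx : x ∈ φ.source) (ξ : TangentSpace 𝓘(ℝ, E) x →L[ℝ] ℝ) :
    ∃ α : E →L[ℝ] ℝ, α ∘L mvfderiv 𝓘(ℝ, E) φ x = ξ :=
  ⟨ξ ∘L (mvfderiv 𝓘(ℝ, E) φ x).inverse,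
    ContinuousLinearMap.ext fun v => congrArg ξ (chartField_mvfderiv hφ hx v)⟩

variable [IsManifold 𝓘(ℝ, E) ∞ M]

theorem contMDiffAt_comp_mvfderiv {F : Type*} [NormedAddCommGroup F] [NormedSpace ℝ F]
    {f : M → F} (hf : ContMDiffAt 𝓘(ℝ, E) 𝓘(ℝ, F) ∞ f x) (α : F →L[ℝ] ℝ) :
    ContMDiffAt 𝓘(ℝ, E) (𝓘(ℝ, E).prod 𝓘(ℝ, E →L[ℝ] ℝ)) ∞
      (fun x => TotalSpace.mk' (E →L[ℝ] ℝ)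
        (E := fun x : M => TangentSpace 𝓘(ℝ, E) x →L[ℝ] ℝ) x (α ∘L mvfderiv 𝓘(ℝ, E) f x)) x := by
  refine (contMDiffAt_mvfderiv
    (α.contDiff.contDiffAt.contMDiffAt.comp x hf)).congr_of_eventuallyEq ?_
  filter_upwards [(contMDiffAt_iff_contMDiffAt_nhds (by simp)).1
    (hf.of_le (m := 1) (by simp))] with y hy
  have h := mvfderiv_vector_comp α.differentiableAt (hy.mdifferentiableAt (by simp))
  rw [α.fderiv] at h
  exact congrArg (TotalSpace.mk' (E →L[ℝ] ℝ) y) h.symm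

namespace Bivector

theorem contMDiffAt_apply (Θ : Bivector E M) {ξ : ∀ x : M, TangentSpace 𝓘(ℝ, E) x →L[ℝ] ℝ}
    (hξ : ContMDiffAt 𝓘(ℝ, E) (𝓘(ℝ, E).prod 𝓘(ℝ, E →L[ℝ] ℝ)) ∞
      (fun x => TotalSpace.mk' (E →L[ℝ] ℝ)
        (E := fun x : M => TangentSpace 𝓘(ℝ, E) x →L[ℝ] ℝ) x (ξ x)) x) :
    ContMDiffAt 𝓘(ℝ, E) 𝓘(ℝ, E).tangent ∞
      (fun y => TotalSpace.mk' E y (Θ.toFun y (ξ y))) x :=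
  ContMDiffAt.clm_bundle_apply (F₁ := E →L[ℝ] ℝ) (F₂ := E)
    (E₁ := fun x : M => TangentSpace 𝓘(ℝ, E) x →L[ℝ] ℝ)
    (E₂ := (TangentSpace 𝓘(ℝ, E) : M → Type _)) (b := id) (v := ξ) (Θ.smooth x) hξ

/-- The representation of a bivector field in a chart `φ`: a bivector-valued function on the model
space, with `Θ(β ∘ dφ, α ∘ dφ)` as its component in the directions `β`, `α`. -/
def chartRep (Θ : Bivector E M) (φ : OpenPartialHomeomorph M E) (p : E) : (E →L[ℝ] ℝ) →L[ℝ] E :=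
  mvfderiv 𝓘(ℝ, E) φ (φ.symm p) ∘L Θ.toFun (φ.symm p) ∘L
    ContinuousLinearMap.precomp ℝ (mvfderiv 𝓘(ℝ, E) φ (φ.symm p))

theorem chartRep_apply_of_mem (Θ : Bivector E M) (hx : x ∈ φ.source) (α : E →L[ℝ] ℝ) :
    Θ.chartRep φ (φ x) α =
      mvfderiv 𝓘(ℝ, E) φ x (Θ.toFun x (α ∘L mvfderiv 𝓘(ℝ, E) φ x)) := by
  conv_rhs => rw [← φ.left_inv hx]
  rfl

theorem isSkew_chartRep (Θ : Bivector E M) (φ : OpenPartialHomeomorph M E) (p : E) :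
    IsSkew (Θ.chartRep φ p) := fun α β =>
  Θ.skew (φ.symm p) (α ∘L mvfderiv 𝓘(ℝ, E) φ (φ.symm p)) (β ∘L mvfderiv 𝓘(ℝ, E) φ (φ.symm p))

theorem contDiffAt_chartRep [FiniteDimensional ℝ E] (Θ : Bivector E M)
    (hφ : φ ∈ IsManifold.maximalAtlas 𝓘(ℝ, E) ∞ M) {p : E} (hp : p ∈ φ.target) :
    ContDiffAt ℝ ∞ (Θ.chartRep φ) p := by
  suffices h : ContDiffOn ℝ ∞ (Θ.chartRep φ) φ.target from
    h.contDiffAt (φ.open_target.mem_nhds hp)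
  refine contDiffOn_clm_apply.2 fun α q hq => ContDiffAt.contDiffWithinAt ?_
  have hφq := contMDiffAt_of_mem_maximalAtlas hφ (φ.map_target hq)
  exact contDiffAt_comp_chart_symm hφ hq
    (contMDiffAt_mvfderiv_apply hφq (Θ.contMDiffAt_apply (contMDiffAt_comp_mvfderiv hφq α)))

theorem mem_image_iff (Θ : Bivector E M) (hφ : φ ∈ IsManifold.maximalAtlas 𝓘(ℝ, E) ∞ M)
    (hx : x ∈ φ.source) (v : TangentSpace 𝓘(ℝ, E) x) :
    v ∈ Θ.image x ↔ ∃ α, Θ.chartRep φ (φ x) α = mvfderiv 𝓘(ℝ, E) φ x v := by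
  constructor
  · rintro ⟨ξ, rfl⟩
    obtain ⟨α, rfl⟩ := exists_comp_mvfderiv_eq hφ hx ξ
    exact ⟨α, Θ.chartRep_apply_of_mem hx α⟩
  · rintro ⟨α, hα⟩
    rw [Θ.chartRep_apply_of_mem hx] at hα
    exact ⟨_, mvfderiv_injective hφ hx hα⟩

theorem finrank_im_chartRep (Θ : Bivector E M) (hφ : φ ∈ IsManifold.maximalAtlas 𝓘(ℝ, E) ∞ M)
    (hx : x ∈ φ.source) :
    Module.finrank ℝ (im (Θ.chartRep φ (φ x))) = Module.finrank ℝ (Θ.image x) := by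
  have h : im (Θ.chartRep φ (φ x)) = (Θ.image x).map
      ((chartDeriv hφ hx).toLinearEquiv : TangentSpace 𝓘(ℝ, E) x →ₗ[ℝ] E) := by
    ext e
    rw [Submodule.mem_map]
    constructor
    · rintro ⟨α, rfl⟩
      exact ⟨_, ⟨_, rfl⟩, (Θ.chartRep_apply_of_mem hx α).symm⟩
    · rintro ⟨v, hv, rfl⟩
      obtain ⟨α, hα⟩ := (Θ.mem_image_iff hφ hx v).1 hv
      exact ⟨α, hα⟩
  rw [h]
  exact LinearEquiv.finrank_map_eq _ _

end Bivector

end ChartRepresentation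

section ConstantCoordinates

variable {E : Type*} [NormedAddCommGroup E] [NormedSpace ℝ E]
  {M : Type*} [TopologicalSpace M] [ChartedSpace E M] [IsManifold 𝓘(ℝ, E) ∞ M]

theorem trans_mem_maximalAtlas {φ : OpenPartialHomeomorph M E} {ψ : OpenPartialHomeomorph E E}
    (hφ : φ ∈ IsManifold.maximalAtlas 𝓘(ℝ, E) ∞ M) (hψ : IsSmoothDiffeo ψ) :
    φ.trans ψ ∈ IsManifold.maximalAtlas 𝓘(ℝ, E) ∞ M := by
  rw [IsManifold.mem_maximalAtlas_iff_contMDiffOn]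
  refine ⟨fun y hy => ContMDiffAt.contMDiffWithinAt ?_,
    fun q hq => ContMDiffAt.contMDiffWithinAt ?_⟩
  · rw [OpenPartialHomeomorph.trans_source] at hy
    exact (hψ.contDiffAt hy.2).contMDiffAt.comp y (contMDiffAt_of_mem_maximalAtlas hφ hy.1)
  · rw [OpenPartialHomeomorph.trans_target] at hq
    exact (contMDiffAt_symm_of_mem_maximalAtlas hφ hq.2).comp q
      (hψ.symm.contDiffAt hq.1).contMDiffAt

variable [FiniteDimensional ℝ E]

namespace Bivector

theorem isPoissonAt_chartRep (Θ : Bivector E M) {φ : OpenPartialHomeomorph M E}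
    (hφ : φ ∈ IsManifold.maximalAtlas 𝓘(ℝ, E) ∞ M)
    (hJ : ∀ y ∈ φ.source, JacobiAt (Θ.chartRep φ) (φ y)) {x : M} (hx : x ∈ φ.source) :
    IsPoissonAt (Θ.chartRep φ) (φ x) := by
  have htarget : ∀ᶠ p in 𝓝 (φ x), p ∈ φ.target := φ.open_target.mem_nhds (φ.map_source hx)
  refine ⟨htarget.mono fun p hp => Θ.contDiffAt_chartRep hφ hp,
    Eventually.of_forall (Θ.isSkew_chartRep φ), htarget.mono fun p hp => ?_⟩
  simpa only [φ.right_inv hp] using hJ _ (φ.map_target hp)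

theorem isLocallyConstant_of_jacobiAt (Θ : Bivector E M) (hr : Θ.HasConstantRank)
    (hJ : ∀ φ ∈ IsManifold.maximalAtlas 𝓘(ℝ, E) ∞ M, ∀ x ∈ φ.source,
      JacobiAt (Θ.chartRep φ) (φ x)) : Θ.IsLocallyConstant := by
  intro x
  obtain ⟨r, hr⟩ := hr
  have hφ : chartAt E x ∈ IsManifold.maximalAtlas 𝓘(ℝ, E) ∞ M :=
    IsManifold.chart_mem_maximalAtlas x
  have hx : x ∈ (chartAt E x).source := mem_chart_source E x
  generalize chartAt E x = φ at hφ hx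
  have htarget : φ.target ∈ 𝓝 (φ x) := φ.open_target.mem_nhds (φ.map_source hx)
  have hrank : ∀ᶠ p in 𝓝 (φ x), Module.finrank ℝ (im (Θ.chartRep φ p)) = r := by
    filter_upwards [htarget] with p hp
    have h := Θ.finrank_im_chartRep hφ (φ.map_target hp)
    rw [φ.right_inv hp] at h
    exact h.trans (hr _)
  obtain ⟨ψ, C, hψ, hxψ, -, hC⟩ :=
    (Θ.isPoissonAt_chartRep hφ (hJ φ hφ) hx).exists_fderiv_map_comp_eq hrank htarget
  refine ⟨φ.trans ψ, trans_mem_maximalAtlas hφ hψ, ?_, fun α β => β (C α), ?_⟩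
  · exact φ.trans_source ψ ▸ ⟨hx, hxψ⟩
  · intro y hy α β
    rw [OpenPartialHomeomorph.trans_source] at hy
    have hderiv : mvfderiv 𝓘(ℝ, E) (φ.trans ψ) y =
        fderiv ℝ ψ (φ y) ∘L mvfderiv 𝓘(ℝ, E) φ y :=
      mvfderiv_vector_comp ((hψ.contDiffAt hy.2).differentiableAt (by simp))
        ((contMDiffAt_of_mem_maximalAtlas hφ hy.1).mdifferentiableAt (by simp))
    have hCy := hC _ hy.2 α
    rw [Θ.chartRep_apply_of_mem hy.1] at hCy
    rw [hderiv, ContinuousLinearMap.comp_apply, ← ContinuousLinearMap.comp_assoc]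
    exact congrArg β hCy

end Bivector

end ConstantCoordinates

section IntegralPatches

variable {E : Type*} [NormedAddCommGroup E] [NormedSpace ℝ E]
  {M : Type*} [TopologicalSpace M] [ChartedSpace E M] {φ : OpenPartialHomeomorph M E}
  {k : ℕ} {U : Set (EuclideanSpace ℝ (Fin k))} {f : EuclideanSpace ℝ (Fin k) → M}
  {p : EuclideanSpace ℝ (Fin k)}

namespace IsIntegralPatch

variable {D : ∀ x : M, Submodule ℝ (TangentSpace 𝓘(ℝ, E) x)}

theorem contMDiffAt (hf : IsIntegralPatch D U f) (hp : p ∈ U) :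
    ContMDiffAt 𝓘(ℝ, EuclideanSpace ℝ (Fin k)) 𝓘(ℝ, E) ∞ f p :=
  (hf.smooth p hp).contMDiffAt (hf.isOpen.mem_nhds hp)

theorem fderiv_chart_comp (hf : IsIntegralPatch D U f)
    (hφ : φ ∈ IsManifold.maximalAtlas 𝓘(ℝ, E) ∞ M) (hp : p ∈ U) (hpφ : f p ∈ φ.source)
    (u : EuclideanSpace ℝ (Fin k)) :
    fderiv ℝ (φ ∘ f) p u = mvfderiv 𝓘(ℝ, E) φ (f p)
      (mfderiv 𝓘(ℝ, EuclideanSpace ℝ (Fin k)) 𝓘(ℝ, E) f p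
        ((fromTangentSpace (𝕜 := ℝ) p).symm u)) :=
  fderiv_comp_eq_mvfderiv_mfderiv
    ((contMDiffAt_of_mem_maximalAtlas hφ hpφ).mdifferentiableAt (by simp))
    ((hf.contMDiffAt hp).mdifferentiableAt (by simp)) u

theorem fderiv_chart_comp_injective (hf : IsIntegralPatch D U f)
    (hφ : φ ∈ IsManifold.maximalAtlas 𝓘(ℝ, E) ∞ M) (hp : p ∈ U) (hpφ : f p ∈ φ.source) :
    Function.Injective (fderiv ℝ (φ ∘ f) p) := by
  intro u v huv
  rw [hf.fderiv_chart_comp hφ hp hpφ, hf.fderiv_chart_comp hφ hp hpφ] at huv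
  exact (fromTangentSpace (𝕜 := ℝ) p).symm.injective
    (hf.immersion p hp (mvfderiv_injective hφ hpφ huv))

end IsIntegralPatch

namespace Bivector

variable [IsManifold 𝓘(ℝ, E) ∞ M]

theorem mem_im_chartRep_iff (Θ : Bivector E M) (hf : IsIntegralPatch Θ.image U f)
    (hφ : φ ∈ IsManifold.maximalAtlas 𝓘(ℝ, E) ∞ M) (hp : p ∈ U) (hpφ : f p ∈ φ.source) (e : E) :
    e ∈ im (Θ.chartRep φ (φ (f p))) ↔ ∃ u, fderiv ℝ (φ ∘ f) p u = e := by
  constructor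
  · rintro ⟨ξ, rfl⟩
    obtain ⟨u, hu⟩ := (hf.tangent p hp _).1 ⟨ξ ∘L mvfderiv 𝓘(ℝ, E) φ (f p), rfl⟩
    refine ⟨fromTangentSpace (𝕜 := ℝ) p u, ?_⟩
    rw [hf.fderiv_chart_comp hφ hp hpφ]
    exact (congrArg _ hu).trans (Θ.chartRep_apply_of_mem hpφ ξ).symm
  · rintro ⟨u, rfl⟩
    rw [hf.fderiv_chart_comp hφ hp hpφ]
    exact (Θ.mem_image_iff hφ hpφ _).1 ((hf.tangent p hp _).2 ⟨_, rfl⟩)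

theorem extDeriv_inverseOnPatch [FiniteDimensional ℝ E] (Θ : Bivector E M)
    (hf : IsIntegralPatch Θ.image U f) (hφ : φ ∈ IsManifold.maximalAtlas 𝓘(ℝ, E) ∞ M)
    (hp : p ∈ U) (hpφ : f p ∈ φ.source)
    {a b c : EuclideanSpace ℝ (Fin k)} {α β γ : E →L[ℝ] ℝ}
    (ha : fderiv ℝ (φ ∘ f) p a = Θ.chartRep φ (φ (f p)) γ)
    (hb : fderiv ℝ (φ ∘ f) p b = Θ.chartRep φ (φ (f p)) α)
    (hc : fderiv ℝ (φ ∘ f) p c = Θ.chartRep φ (φ (f p)) β) :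
    extDeriv (Θ.inverseOnPatch hf) p ![a, b, c] =
      β (fderiv ℝ (Θ.chartRep φ) (φ (f p)) (Θ.chartRep φ (φ (f p)) γ) α) +
      γ (fderiv ℝ (Θ.chartRep φ) (φ (f p)) (Θ.chartRep φ (φ (f p)) α) β) +
      α (fderiv ℝ (Θ.chartRep φ) (φ (f p)) (Θ.chartRep φ (φ (f p)) β) γ) := by
  have hfp := hf.contMDiffAt hp
  have hnear : ∀ᶠ q in 𝓝 p, q ∈ U ∧ f q ∈ φ.source :=
    inter_mem (hf.isOpen.mem_nhds hp) (hfp.continuousAt (φ.open_source.mem_nhds hpφ))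
  refine extDeriv_inverse_twoForm_apply (f := φ ∘ f) (P := Θ.chartRep φ)
    ((contMDiffAt_of_mem_maximalAtlas hφ hpφ).comp p hfp).contDiffAt
    (Θ.contDiffAt_chartRep hφ (φ.map_source hpφ)) (hf.fderiv_chart_comp_injective hφ hp hpφ)
    ?_ (fun u => (Θ.mem_im_chartRep_iff hf hφ hp hpφ _).2 ⟨u, rfl⟩) ?_ ha hb hc
  · filter_upwards [hnear] with q hq ξ
    exact (Θ.mem_im_chartRep_iff hf hφ hq.1 hq.2 _).1 ⟨ξ, rfl⟩
  · filter_upwards [hnear] with q hq u v ξ hξ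
    rw [Function.comp_apply, Θ.chartRep_apply_of_mem hq.2,
      hf.fderiv_chart_comp hφ hq.1 hq.2] at hξ
    rw [inverseOnPatch, dif_pos hq.1, hf.fderiv_chart_comp hφ hq.1 hq.2]
    exact inverseForm_apply (Θ.skew (f q)) (ξ ∘L mvfderiv 𝓘(ℝ, E) φ (f q)) ⟨_, _⟩ ⟨_, _⟩
      (mvfderiv_injective hφ hq.2 hξ)

theorem jacobiAt_of_inverseClosedAlong [FiniteDimensional ℝ E] (Θ : Bivector E M)
    (hI : IsIntegrableDistribution Θ.image)
    (hclosed : ∀ x : M, Θ.InverseClosedAlong (leaf Θ.image x))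
    (hφ : φ ∈ IsManifold.maximalAtlas 𝓘(ℝ, E) ∞ M) {x : M} (hx : x ∈ φ.source) :
    JacobiAt (Θ.chartRep φ) (φ x) := by
  intro α β γ
  obtain ⟨k, U, f, hf, p, hp, rfl⟩ := hI x
  have hleaf : f '' U ⊆ leaf Θ.image (f p) := fun y hy =>
    Relation.ReflTransGen.single ⟨k, U, f, hf, ⟨p, hp, rfl⟩, hy⟩
  have htangent : ∀ ξ, ∃ u, fderiv ℝ (φ ∘ f) p u = Θ.chartRep φ (φ (f p)) ξ := fun ξ =>
    (Θ.mem_im_chartRep_iff hf hφ hp hx _).1 ⟨ξ, rfl⟩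
  obtain ⟨⟨a, ha⟩, ⟨b, hb⟩, c, hc⟩ := htangent γ, htangent α, htangent β
  rw [← Θ.extDeriv_inverseOnPatch hf hφ hp hx ha hb hc, hclosed (f p) k U f hf hleaf p hp]
  rfl

end Bivector

end IntegralPatches

section Slices

variable {E : Type*} [NormedAddCommGroup E] [NormedSpace ℝ E]
  {M : Type*} [TopologicalSpace M] [ChartedSpace E M] {φ : OpenPartialHomeomorph M E}

/-- The affine slice `u ↦ c + j u` of a chart `φ`, as a map into the manifold. -/
def slice {F : Type*} [NormedAddCommGroup F] [NormedSpace ℝ F] (φ : OpenPartialHomeomorph M E)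
    (c : E) (j : F →L[ℝ] E) (u : F) : M :=
  φ.symm (c + j u)

section Calculus

variable {F : Type*} [NormedAddCommGroup F] [NormedSpace ℝ F] {c : E} {j : F →L[ℝ] E} {u : F}

theorem contMDiffAt_slice (hφ : φ ∈ IsManifold.maximalAtlas 𝓘(ℝ, E) ∞ M)
    (hu : c + j u ∈ φ.target) : ContMDiffAt 𝓘(ℝ, F) 𝓘(ℝ, E) ∞ (slice φ c j) u :=
  (contMDiffAt_symm_of_mem_maximalAtlas hφ hu).comp u
    (ContDiff.contMDiff (by fun_prop)).contMDiffAt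

theorem mvfderiv_mfderiv_slice (hφ : φ ∈ IsManifold.maximalAtlas 𝓘(ℝ, E) ∞ M)
    (hu : c + j u ∈ φ.target) (v : F) :
    mvfderiv 𝓘(ℝ, E) φ (slice φ c j u) (mfderiv 𝓘(ℝ, F) 𝓘(ℝ, E) (slice φ c j) u
      ((fromTangentSpace (𝕜 := ℝ) u).symm v)) = j v := by
  have hopen : IsOpen ((fun u => c + j u) ⁻¹' φ.target) := φ.open_target.preimage (by fun_prop)
  have hcomp : φ ∘ slice φ c j =ᶠ[𝓝 u] fun u => c + j u := by
    filter_upwards [hopen.mem_nhds hu] with w hw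
    exact φ.right_inv hw
  rw [← fderiv_comp_eq_mvfderiv_mfderiv (f := slice φ c j)
    ((contMDiffAt_of_mem_maximalAtlas hφ (φ.map_target hu)).mdifferentiableAt (by simp))
    ((contMDiffAt_slice hφ hu).mdifferentiableAt (by simp)), hcomp.fderiv_eq, fderiv_const_add,
    j.fderiv]

end Calculus

variable {D : ∀ x : M, Submodule ℝ (TangentSpace 𝓘(ℝ, E) x)}

theorem isIntegralPatch_slice {k : ℕ} {U : Set (EuclideanSpace ℝ (Fin k))} {c : E}
    {j : EuclideanSpace ℝ (Fin k) →L[ℝ] E} (hφ : φ ∈ IsManifold.maximalAtlas 𝓘(ℝ, E) ∞ M)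
    (hj : Function.Injective j) (hU : IsOpen U) (hUc : IsConnected U)
    (hUφ : ∀ u ∈ U, c + j u ∈ φ.target)
    (hD : ∀ y ∈ φ.source, ∀ v, v ∈ D y ↔ ∃ u, j u = mvfderiv 𝓘(ℝ, E) φ y v) :
    IsIntegralPatch D U (slice φ c j) where
  isOpen := hU
  isConnected := hUc
  injOn u hu v hv huv :=
    hj (add_left_cancel (φ.symm.injOn (hUφ u hu) (hUφ v hv) huv))
  smooth u hu := (contMDiffAt_slice hφ (hUφ u hu)).contMDiffWithinAt
  immersion u hu v w hvw := by
    have h := congrArg (mvfderiv 𝓘(ℝ, E) φ (slice φ c j u)) hvw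
    exact hj ((mvfderiv_mfderiv_slice hφ (hUφ u hu) v).symm.trans
      (h.trans (mvfderiv_mfderiv_slice hφ (hUφ u hu) w)))
  tangent u hu v := by
    have hmem : slice φ c j u ∈ φ.source := φ.map_target (hUφ u hu)
    refine (hD _ hmem v).trans ⟨fun ⟨w, hw⟩ => ⟨w, ?_⟩, fun ⟨w, hw⟩ => ⟨w, ?_⟩⟩
    · exact mvfderiv_injective hφ hmem ((mvfderiv_mfderiv_slice hφ (hUφ u hu) w).trans hw)
    · exact hw ▸ (mvfderiv_mfderiv_slice hφ (hUφ u hu) w).symm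

theorem exists_isIntegralPatch_of_constant (hφ : φ ∈ IsManifold.maximalAtlas 𝓘(ℝ, E) ∞ M) {x : M}
    (hx : x ∈ φ.source) {W : Submodule ℝ E} [FiniteDimensional ℝ W]
    (hD : ∀ y ∈ φ.source, ∀ v, v ∈ D y ↔ mvfderiv 𝓘(ℝ, E) φ y v ∈ W) :
    ∃ (k : ℕ) (U : Set (EuclideanSpace ℝ (Fin k))) (f : EuclideanSpace ℝ (Fin k) → M),
      IsIntegralPatch D U f ∧ x ∈ f '' U := by
  let i : EuclideanSpace ℝ (Fin (Module.finrank ℝ W)) ≃L[ℝ] W :=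
    ContinuousLinearEquiv.ofFinrankEq finrank_euclideanSpace_fin
  let j := W.subtypeL ∘L (i : EuclideanSpace ℝ (Fin (Module.finrank ℝ W)) →L[ℝ] W)
  have hj : Function.Injective j := Subtype.val_injective.comp i.injective
  have hW : ∀ e, e ∈ W ↔ ∃ u, j u = e := fun e =>
    ⟨fun he => ⟨i.symm ⟨e, he⟩, by simp [j]⟩, fun ⟨u, hu⟩ => hu ▸ (i u).2⟩
  have hopen : IsOpen ((fun u => φ x + j u) ⁻¹' φ.target) := φ.open_target.preimage (by fun_prop)
  have hzero : (0 : EuclideanSpace ℝ _) ∈ (fun u => φ x + j u) ⁻¹' φ.target := by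
    simpa using φ.map_source hx
  obtain ⟨r, hr, hball⟩ := Metric.isOpen_iff.1 hopen 0 hzero
  refine ⟨_, Metric.ball 0 r, slice φ (φ x) j,
    isIntegralPatch_slice hφ hj Metric.isOpen_ball
      ((convex_ball _ _).isConnected ⟨0, Metric.mem_ball_self hr⟩) hball
      fun y hy v => (hD y hy v).trans (hW _), 0, Metric.mem_ball_self hr, ?_⟩
  simp [slice, φ.left_inv hx]

end Slices

section LocallyConstant

variable {E : Type*} [NormedAddCommGroup E] [NormedSpace ℝ E] [FiniteDimensional ℝ E]
  {M : Type*} [TopologicalSpace M] [ChartedSpace E M] [IsManifold 𝓘(ℝ, E) ∞ M]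

namespace Bivector

/-- The components of `Θ` in the chart `φ` are constant, equal to those of the bivector `C`. -/
def IsConstantIn (Θ : Bivector E M) (φ : OpenPartialHomeomorph M E)
    (C : (E →L[ℝ] ℝ) →L[ℝ] E) : Prop :=
  ∀ y ∈ φ.source, Θ.chartRep φ (φ y) = C

namespace IsLocallyConstant

variable {Θ : Bivector E M}

theorem exists_isConstantIn (h : Θ.IsLocallyConstant) (x : M) :
    ∃ φ ∈ IsManifold.maximalAtlas 𝓘(ℝ, E) ∞ M, x ∈ φ.source ∧ ∃ C, Θ.IsConstantIn φ C := by
  obtain ⟨φ, hφ, hx, B, hB⟩ := h x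
  refine ⟨φ, hφ, hx, Θ.chartRep φ (φ x), fun y hy => ?_⟩
  ext α
  rw [Θ.chartRep_apply_of_mem hy, Θ.chartRep_apply_of_mem hx, ← sub_eq_zero]
  refine (Module.forall_dual_apply_eq_zero_iff ℝ _).1 fun β => ?_
  rw [map_sub, sub_eq_zero]
  exact (hB y hy α (LinearMap.toContinuousLinearMap β)).trans
    (hB x hx α (LinearMap.toContinuousLinearMap β)).symm

theorem isIntegrableDistribution (h : Θ.IsLocallyConstant) :
    IsIntegrableDistribution Θ.image := by
  intro x
  obtain ⟨φ, hφ, hx, C, hC⟩ := h.exists_isConstantIn x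
  refine exists_isIntegralPatch_of_constant hφ hx (W := im C) fun y hy v => ?_
  rw [Θ.mem_image_iff hφ hy, hC y hy]
  rfl

theorem inverseClosedAlong (h : Θ.IsLocallyConstant) (L : Set M) : Θ.InverseClosedAlong L := by
  intro k U f hf _ p hp
  obtain ⟨φ, hφ, hx, C, hC⟩ := h.exists_isConstantIn (f p)
  have hderiv : fderiv ℝ (Θ.chartRep φ) (φ (f p)) = 0 := by
    have hconst : Θ.chartRep φ =ᶠ[𝓝 (φ (f p))] fun _ => C := by
      filter_upwards [φ.open_target.mem_nhds (φ.map_source hx)] with q hq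
      exact φ.right_inv hq ▸ hC _ (φ.map_target hq)
    exact ((hasFDerivAt_const C _).congr_of_eventuallyEq hconst).fderiv
  have htangent : ∀ u, ∃ ξ, Θ.chartRep φ (φ (f p)) ξ = fderiv ℝ (φ ∘ f) p u := fun u =>
    (Θ.mem_im_chartRep_iff hf hφ hp hx _).2 ⟨u, rfl⟩
  ext v
  have hv : v = ![v 0, v 1, v 2] := by
    ext i : 1
    fin_cases i <;> rfl
  obtain ⟨⟨γ, ha⟩, ⟨α, hb⟩, β, hc⟩ := htangent (v 0), htangent (v 1), htangent (v 2)
  rw [hv, Θ.extDeriv_inverseOnPatch hf hφ hp hx ha.symm hb.symm hc.symm, hderiv]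
  simp

end IsLocallyConstant

end Bivector

end LocallyConstant

section Connections

variable {E : Type*} [NormedAddCommGroup E] [NormedSpace ℝ E]
  {M : Type*} [TopologicalSpace M] [ChartedSpace E M] {φ : OpenPartialHomeomorph M E} {x : M}

theorem mvfderiv_mvfderiv_chartField (hφ : φ ∈ IsManifold.maximalAtlas 𝓘(ℝ, E) ∞ M)
    (hx : x ∈ φ.source) (e : E) :
    mvfderiv 𝓘(ℝ, E) (fun y => mvfderiv 𝓘(ℝ, E) φ y (chartField φ e y)) x = 0 := by
  have h : (fun y => mvfderiv 𝓘(ℝ, E) φ y (chartField φ e y)) =ᶠ[𝓝 x] fun _ => e := by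
    filter_upwards [φ.open_source.mem_nhds hx] with y hy
    exact mvfderiv_chartField hφ hy e
  rw [mvfderiv_congr h, mvfderiv_const]

variable [IsManifold 𝓘(ℝ, E) ∞ M]

/-- The Christoffel symbols of the connection `cov` in the chart `φ`, as a function of two vectors
of the model space. -/
def christoffel (cov : CovariantDerivative 𝓘(ℝ, E) E (TangentSpace 𝓘(ℝ, E) : M → Type _))
    (φ : OpenPartialHomeomorph M E) (x : M) (a b : E) : E :=
  mvfderiv 𝓘(ℝ, E) φ x (cov (chartField φ b) x (chartField φ a x))

variable {cov : CovariantDerivative 𝓘(ℝ, E) E (TangentSpace 𝓘(ℝ, E) : M → Type _)}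

theorem tensorialAt_mvfderiv_cov_sub
    (cov : CovariantDerivative 𝓘(ℝ, E) E (TangentSpace 𝓘(ℝ, E) : M → Type _))
    (hφ : φ ∈ IsManifold.maximalAtlas 𝓘(ℝ, E) ∞ M) (hx : x ∈ φ.source)
    (v : TangentSpace 𝓘(ℝ, E) x) :
    TensorialAt 𝓘(ℝ, E) E (fun Y : ∀ x : M, TangentSpace 𝓘(ℝ, E) x =>
      mvfderiv 𝓘(ℝ, E) φ x (cov Y x v) -
        mvfderiv 𝓘(ℝ, E) (fun y => mvfderiv 𝓘(ℝ, E) φ y (Y y)) x v) x := by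
  have hφx := contMDiffAt_of_mem_maximalAtlas hφ hx
  constructor
  · intro g Y hg hY
    rw [mvfderiv_mvfderiv_smul hφx hg hY, cov.isCovariantDerivativeOnUniv.leibniz hY hg]
    simp [smul_sub]
  · intro Y Y' hY hY'
    rw [mvfderiv_mvfderiv_add hφx hY hY', cov.isCovariantDerivativeOnUniv.add hY hY']
    simp only [add_apply, map_add]
    abel

theorem mdifferentiableAt_chartField [CompleteSpace E]
    (hφ : φ ∈ IsManifold.maximalAtlas 𝓘(ℝ, E) ∞ M) (hx : x ∈ φ.source) (e : E) :
    MDifferentiableAt 𝓘(ℝ, E) 𝓘(ℝ, E).tangent (fun y => TotalSpace.mk' E y (chartField φ e y)) x :=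
  (contMDiffAt_chartField hφ hx e).mdifferentiableAt (by simp)

theorem Bivector.mvfderiv_mvfderiv_apply [FiniteDimensional ℝ E] (Θ : Bivector E M)
    (hφ : φ ∈ IsManifold.maximalAtlas 𝓘(ℝ, E) ∞ M) (hx : x ∈ φ.source) {α : E →L[ℝ] ℝ}
    {ξ : ∀ x : M, TangentSpace 𝓘(ℝ, E) x →L[ℝ] ℝ}
    (hξα : ∀ᶠ y in 𝓝 x, ξ y = α ∘L mvfderiv 𝓘(ℝ, E) φ y) (v : TangentSpace 𝓘(ℝ, E) x) :
    mvfderiv 𝓘(ℝ, E) (fun y => mvfderiv 𝓘(ℝ, E) φ y (Θ.toFun y (ξ y))) x v =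
      fderiv ℝ (Θ.chartRep φ) (φ x) (mvfderiv 𝓘(ℝ, E) φ x v) α := by
  have hcongr : (fun y => mvfderiv 𝓘(ℝ, E) φ y (Θ.toFun y (ξ y))) =ᶠ[𝓝 x]
      (fun p => Θ.chartRep φ p α) ∘ φ := by
    filter_upwards [hξα, φ.open_source.mem_nhds hx] with y hξ hy
    rw [hξ, Function.comp_apply, Θ.chartRep_apply_of_mem hy]
  have hderiv := hasFDerivAt_apply_const ((Θ.contDiffAt_chartRep hφ
    (φ.map_source hx)).differentiableAt (by simp)).hasFDerivAt α
  rw [mvfderiv_congr hcongr, mvfderiv_vector_comp hderiv.differentiableAt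
    ((contMDiffAt_of_mem_maximalAtlas hφ hx).mdifferentiableAt (by simp)), hderiv.fderiv]
  rfl

variable [FiniteDimensional ℝ E]

theorem christoffel_symm (ht : cov.torsion = 0)
    (hφ : φ ∈ IsManifold.maximalAtlas 𝓘(ℝ, E) ∞ M) (hx : x ∈ φ.source) (a b : E) :
    christoffel cov φ x a b = christoffel cov φ x b a := by
  have : CompleteSpace E := FiniteDimensional.complete ℝ E
  have ha := mdifferentiableAt_chartField hφ hx a
  have hb := mdifferentiableAt_chartField hφ hx b
  have h := congrArg (mvfderiv 𝓘(ℝ, E) φ x)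
    (cov.torsion_eq_zero_iff.1 ht (X := chartField φ a) (Y := chartField φ b) ha hb)
  rw [mvfderiv_mlieBracket hφ hx ha hb, mvfderiv_mvfderiv_chartField hφ hx,
    mvfderiv_mvfderiv_chartField hφ hx, map_sub] at h
  exact sub_eq_zero.1 (h.trans (sub_self 0))

theorem mvfderiv_cov_apply
    (cov : CovariantDerivative 𝓘(ℝ, E) E (TangentSpace 𝓘(ℝ, E) : M → Type _))
    (hφ : φ ∈ IsManifold.maximalAtlas 𝓘(ℝ, E) ∞ M) (hx : x ∈ φ.source) (a : E)
    {Y : ∀ x : M, TangentSpace 𝓘(ℝ, E) x}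
    (hY : MDifferentiableAt 𝓘(ℝ, E) 𝓘(ℝ, E).tangent (fun y => TotalSpace.mk' E y (Y y)) x) :
    mvfderiv 𝓘(ℝ, E) φ x (cov Y x (chartField φ a x)) =
      mvfderiv 𝓘(ℝ, E) (fun y => mvfderiv 𝓘(ℝ, E) φ y (Y y)) x (chartField φ a x) +
      christoffel cov φ x a (mvfderiv 𝓘(ℝ, E) φ x (Y x)) := by
  have : CompleteSpace E := FiniteDimensional.complete ℝ E
  have h := (tensorialAt_mvfderiv_cov_sub cov hφ hx (chartField φ a x)).pointwise hY
    (mdifferentiableAt_chartField hφ hx (mvfderiv 𝓘(ℝ, E) φ x (Y x)))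
    (chartField_mvfderiv hφ hx (Y x)).symm
  rw [mvfderiv_mvfderiv_chartField hφ hx] at h
  exact sub_eq_iff_eq_add'.1 (h.trans (sub_zero _))

theorem exists_isSmoothOneForm_eventuallyEq [T2Space M]
    (hφ : φ ∈ IsManifold.maximalAtlas 𝓘(ℝ, E) ∞ M) (hx : x ∈ φ.source) (α : E →L[ℝ] ℝ) :
    ∃ ξ : ∀ x : M, TangentSpace 𝓘(ℝ, E) x →L[ℝ] ℝ, IsSmoothOneForm ξ ∧
      ∀ᶠ y in 𝓝 x, ξ y = α ∘L mvfderiv 𝓘(ℝ, E) φ y := by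
  obtain ⟨ρ, -, hρ⟩ := (SmoothBumpFunction.nhds_basis_tsupport (I := 𝓘(ℝ, E)) x).mem_iff.1
    (φ.open_source.mem_nhds hx)
  refine ⟨fun y => ρ y • (α ∘L mvfderiv 𝓘(ℝ, E) φ y), ?_, ?_⟩
  · exact ContMDiffOn.smul_section_of_tsupport (F := E →L[ℝ] ℝ)
      (V := fun x : M => TangentSpace 𝓘(ℝ, E) x →L[ℝ] ℝ)
      (ρ.contMDiff.of_le (by simp)).contMDiffOn φ.open_source hρ
      fun y hy => (contMDiffAt_comp_mvfderiv
        (contMDiffAt_of_mem_maximalAtlas hφ hy) α).contMDiffWithinAt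
  · filter_upwards [ρ.eventuallyEq_one] with y hy
    rw [hy]
    exact one_smul ℝ _

theorem dualDeriv_apply {ξ : ∀ x : M, TangentSpace 𝓘(ℝ, E) x →L[ℝ] ℝ} (hξ : IsSmoothOneForm ξ)
    (v : TangentSpace 𝓘(ℝ, E) x) {Y : ∀ x : M, TangentSpace 𝓘(ℝ, E) x}
    (hY : MDifferentiableAt 𝓘(ℝ, E) 𝓘(ℝ, E).tangent (fun y => TotalSpace.mk' E y (Y y)) x) :
    dualDeriv cov ξ hξ x v (Y x) =
      mvfderiv 𝓘(ℝ, E) (fun y => ξ y (Y y)) x v - ξ x (cov Y x v) :=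
  TensorialAt.mkHom_apply (tensorialAt_dualDeriv cov hξ x v) hY

theorem dualDeriv_chartField (hφ : φ ∈ IsManifold.maximalAtlas 𝓘(ℝ, E) ∞ M) (hx : x ∈ φ.source)
    {ξ : ∀ x : M, TangentSpace 𝓘(ℝ, E) x →L[ℝ] ℝ} (hξ : IsSmoothOneForm ξ) {α : E →L[ℝ] ℝ}
    (hξα : ∀ᶠ y in 𝓝 x, ξ y = α ∘L mvfderiv 𝓘(ℝ, E) φ y) (a b : E) :
    dualDeriv cov ξ hξ x (chartField φ a x) (chartField φ b x) =
      -α (christoffel cov φ x a b) := by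
  have : CompleteSpace E := FiniteDimensional.complete ℝ E
  have hconst : (fun y => ξ y (chartField φ b y)) =ᶠ[𝓝 x] fun _ => α b := by
    filter_upwards [hξα, φ.open_source.mem_nhds hx] with y hξy hy
    rw [hξy]
    exact congrArg α (mvfderiv_chartField hφ hy b)
  rw [dualDeriv_apply hξ _ (mdifferentiableAt_chartField hφ hx b), mvfderiv_congr hconst,
    mvfderiv_const, hξα.self_of_nhds]
  exact zero_sub (α (christoffel cov φ x a b))

namespace Bivector

theorem fderiv_chartRep_of_isParallel [T2Space M] {Θ : Bivector E M} (hp : Θ.IsParallel cov)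
    (hφ : φ ∈ IsManifold.maximalAtlas 𝓘(ℝ, E) ∞ M) (hx : x ∈ φ.source)
    (a : E) (α β : E →L[ℝ] ℝ) :
    β (fderiv ℝ (Θ.chartRep φ) (φ x) a α) =
      α (christoffel cov φ x a (Θ.chartRep φ (φ x) β)) -
      β (christoffel cov φ x a (Θ.chartRep φ (φ x) α)) := by
  obtain ⟨ξ, hξ, hξα⟩ := exists_isSmoothOneForm_eventuallyEq hφ hx α
  obtain ⟨η, hη⟩ := exists_comp_mvfderiv_eq hφ hx (dualDeriv cov ξ hξ x (chartField φ a x))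
  have hη_apply (b : E) : η b = -α (christoffel cov φ x a b) := by
    rw [← dualDeriv_chartField hφ hx hξ hξα, ← hη]
    exact congrArg η (mvfderiv_chartField hφ hx b).symm
  have hparallel : fderiv ℝ (Θ.chartRep φ) (φ x) a α +
      christoffel cov φ x a (Θ.chartRep φ (φ x) α) = Θ.chartRep φ (φ x) η := by
    rw [Θ.chartRep_apply_of_mem hx η, hη, ← hp ξ hξ x,
      mvfderiv_cov_apply cov hφ hx a ((Θ.contMDiffAt_apply (hξ x)).mdifferentiableAt (by simp)),
      Θ.mvfderiv_mvfderiv_apply hφ hx hξα, mvfderiv_chartField hφ hx, hξα.self_of_nhds,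
      Θ.chartRep_apply_of_mem hx α]
  have hskew := Θ.isSkew_chartRep φ (φ x) η β
  rw [← hparallel, map_add, hη_apply] at hskew
  linarith

theorem jacobiAt_of_isParallel [T2Space M] {Θ : Bivector E M} (ht : cov.torsion = 0)
    (hp : Θ.IsParallel cov) (hφ : φ ∈ IsManifold.maximalAtlas 𝓘(ℝ, E) ∞ M) (hx : x ∈ φ.source) :
    JacobiAt (Θ.chartRep φ) (φ x) := by
  have : CompleteSpace E := FiniteDimensional.complete ℝ E
  intro α β γ
  simp only [fderiv_chartRep_of_isParallel hp hφ hx]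
  rw [christoffel_symm ht hφ hx (Θ.chartRep φ (φ x) γ) (Θ.chartRep φ (φ x) β),
    christoffel_symm ht hφ hx (Θ.chartRep φ (φ x) γ) (Θ.chartRep φ (φ x) α),
    christoffel_symm ht hφ hx (Θ.chartRep φ (φ x) α) (Θ.chartRep φ (φ x) β)]
  ring

end Bivector

end Connections

section ContinuousLinearMapFields

variable {E : Type*} [NormedAddCommGroup E] [NormedSpace ℝ E]
  {F : Type*} [NormedAddCommGroup F] [NormedSpace ℝ F]
  {G : Type*} [NormedAddCommGroup G] [NormedSpace ℝ G]
  {M : Type*} [TopologicalSpace M] [ChartedSpace E M] {x : M}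

theorem contMDiffAt_clm_of_apply [FiniteDimensional ℝ F] {A : M → F →L[ℝ] G}
    (hA : ∀ e, ContMDiffAt 𝓘(ℝ, E) 𝓘(ℝ, G) ∞ (fun y => A y e) x) :
    ContMDiffAt 𝓘(ℝ, E) 𝓘(ℝ, F →L[ℝ] G) ∞ A x := by
  let b := Module.finBasis ℝ F
  let T : (Fin (Module.finrank ℝ F) → G) →L[ℝ] F →L[ℝ] G :=
    ∑ i, (ContinuousLinearMap.smulRightL ℝ F G (LinearMap.toContinuousLinearMap (b.coord i))) ∘L
      ContinuousLinearMap.proj i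
  have hT : A = T ∘ fun y i => A y (b i) := by
    ext y e
    conv_lhs => rw [← b.sum_repr e, map_sum]
    simp [T]
  rw [hT]
  exact T.contDiff.contMDiff.contMDiffAt.comp x (contMDiffAt_pi_space.2 fun i => hA (b i))

theorem mvfderiv_clm_apply {A : M → F →L[ℝ] G} {g : M → F}
    (hA : MDifferentiableAt 𝓘(ℝ, E) 𝓘(ℝ, F →L[ℝ] G) A x)
    (hg : MDifferentiableAt 𝓘(ℝ, E) 𝓘(ℝ, F) g x) (v : TangentSpace 𝓘(ℝ, E) x) :
    mvfderiv 𝓘(ℝ, E) (fun y => A y (g y)) x v =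
      mvfderiv 𝓘(ℝ, E) A x v (g x) + A x (mvfderiv 𝓘(ℝ, E) g x v) := by
  have hAg := hA.prodMk_space hg
  have hA_eq := mvfderiv_vector_comp (g := ContinuousLinearMap.fst ℝ (F →L[ℝ] G) F)
    (ContinuousLinearMap.differentiableAt _) hAg
  have hg_eq := mvfderiv_vector_comp (g := ContinuousLinearMap.snd ℝ (F →L[ℝ] G) F)
    (ContinuousLinearMap.differentiableAt _) hAg
  have heval := isBoundedBilinearMap_apply.hasFDerivAt (𝕜 := ℝ) (A x, g x)
  have hcomp := mvfderiv_vector_comp (f := fun y => (A y, g y)) heval.differentiableAt hAg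
  rw [ContinuousLinearMap.fderiv] at hA_eq hg_eq
  rw [heval.fderiv] at hcomp
  refine (DFunLike.congr_fun hcomp v).trans ((add_comm _ _).trans ?_)
  exact congrArg₂ (fun B w => B (g x) + A x w) (DFunLike.congr_fun hA_eq v).symm
    (DFunLike.congr_fun hg_eq v).symm

variable [IsManifold 𝓘(ℝ, E) ∞ M] [FiniteDimensional ℝ E]

theorem contMDiffAt_endomorphism_of_chartField
    {L : ∀ x : M, TangentSpace 𝓘(ℝ, E) x →L[ℝ] TangentSpace 𝓘(ℝ, E) x}
    (hL : ∀ e, ContMDiffAt 𝓘(ℝ, E) 𝓘(ℝ, E).tangent ∞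
      (fun y => TotalSpace.mk' E y (L y (chartField (chartAt E x) e y))) x) :
    ContMDiffAt 𝓘(ℝ, E) (𝓘(ℝ, E).prod 𝓘(ℝ, E →L[ℝ] E)) ∞
      (fun y => TotalSpace.mk' (E →L[ℝ] E)
        (E := fun y : M => TangentSpace 𝓘(ℝ, E) y →L[ℝ] TangentSpace 𝓘(ℝ, E) y) y (L y)) x := by
  have hφ : chartAt E x ∈ IsManifold.maximalAtlas 𝓘(ℝ, E) ∞ M := IsManifold.chart_mem_maximalAtlas x
  have hx : x ∈ (chartAt E x).source := mem_chart_source E x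
  rw [contMDiffAt_hom_bundle]
  refine ⟨contMDiffAt_id, contMDiffAt_clm_of_apply fun e => ?_⟩
  refine (contMDiffAt_mvfderiv_apply (contMDiffAt_of_mem_maximalAtlas hφ hx)
    (hL e)).congr_of_eventuallyEq ?_
  filter_upwards [(chartAt E x).open_source.mem_nhds hx] with y hy
  have hbase : y ∈ (trivializationAt E (TangentSpace 𝓘(ℝ, E) : M → Type _) x).baseSet := by
    simpa using hy
  have hcoord : (trivializationAt E (TangentSpace 𝓘(ℝ, E)) x).continuousLinearMapAt ℝ y =
      mvfderiv 𝓘(ℝ, E) (chartAt E x) y := by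
    rw [TangentBundle.continuousLinearMapAt_trivializationAt hy]
    rfl
  have hsymm : (trivializationAt E (TangentSpace 𝓘(ℝ, E)) x).symmL ℝ y e =
      chartField (chartAt E x) e y := by
    apply mvfderiv_injective hφ hy
    rw [mvfderiv_chartField hφ hy, ← hcoord, Trivialization.continuousLinearMapAt_symmL _ hbase]
  change (trivializationAt E (TangentSpace 𝓘(ℝ, E)) x).continuousLinearMapAt ℝ y
    (L y ((trivializationAt E (TangentSpace 𝓘(ℝ, E)) x).symmL ℝ y e)) = _
  rw [hcoord, hsymm]

end ContinuousLinearMapFields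

section FlatConnections

variable {E : Type*} [NormedAddCommGroup E] [NormedSpace ℝ E]
  {M : Type*} [TopologicalSpace M] [ChartedSpace E M] {φ : OpenPartialHomeomorph M E} {x : M}

/-- The flat connection on the domain of the chart `φ` for which the coordinate fields of `φ` are
parallel. -/
def flatDeriv (φ : OpenPartialHomeomorph M E) (Y : ∀ x : M, TangentSpace 𝓘(ℝ, E) x) (x : M) :
    TangentSpace 𝓘(ℝ, E) x →L[ℝ] TangentSpace 𝓘(ℝ, E) x :=
  (mvfderiv 𝓘(ℝ, E) φ x).inverse ∘L
    mvfderiv 𝓘(ℝ, E) (fun y => mvfderiv 𝓘(ℝ, E) φ y (Y y)) x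

/-- The coefficients, in the chart `φ`, of a field `ξ` of cotangent vectors. -/
def oneFormChartRep (φ : OpenPartialHomeomorph M E)
    (ξ : ∀ x : M, TangentSpace 𝓘(ℝ, E) x →L[ℝ] ℝ) (x : M) : E →L[ℝ] ℝ :=
  ξ x ∘L (mvfderiv 𝓘(ℝ, E) φ x).inverse

/-- The connection on 1-forms induced by the flat connection of the chart `φ`. -/
def flatDualDeriv (φ : OpenPartialHomeomorph M E) (ξ : ∀ x : M, TangentSpace 𝓘(ℝ, E) x →L[ℝ] ℝ)
    (x : M) (v : TangentSpace 𝓘(ℝ, E) x) : TangentSpace 𝓘(ℝ, E) x →L[ℝ] ℝ :=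
  mvfderiv 𝓘(ℝ, E) (oneFormChartRep φ ξ) x v ∘L mvfderiv 𝓘(ℝ, E) φ x

theorem mvfderiv_flatDeriv (hφ : φ ∈ IsManifold.maximalAtlas 𝓘(ℝ, E) ∞ M) (hx : x ∈ φ.source)
    (Y : ∀ x : M, TangentSpace 𝓘(ℝ, E) x) (v : TangentSpace 𝓘(ℝ, E) x) :
    mvfderiv 𝓘(ℝ, E) φ x (flatDeriv φ Y x v) =
      mvfderiv 𝓘(ℝ, E) (fun y => mvfderiv 𝓘(ℝ, E) φ y (Y y)) x v :=
  mvfderiv_chartField hφ hx _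

theorem oneFormChartRep_comp_mvfderiv (hφ : φ ∈ IsManifold.maximalAtlas 𝓘(ℝ, E) ∞ M)
    (hx : x ∈ φ.source) (ξ : ∀ x : M, TangentSpace 𝓘(ℝ, E) x →L[ℝ] ℝ) :
    oneFormChartRep φ ξ x ∘L mvfderiv 𝓘(ℝ, E) φ x = ξ x :=
  ContinuousLinearMap.ext fun w => congrArg (ξ x) (chartField_mvfderiv hφ hx w)

variable [IsManifold 𝓘(ℝ, E) ∞ M]

theorem isCovariantDerivativeOn_flatDeriv (hφ : φ ∈ IsManifold.maximalAtlas 𝓘(ℝ, E) ∞ M) :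
    IsCovariantDerivativeOn (I := 𝓘(ℝ, E)) E
      (V := (TangentSpace 𝓘(ℝ, E) : M → Type _)) (flatDeriv φ) φ.source where
  add hY hY' hx := by
    rw [flatDeriv, mvfderiv_mvfderiv_add (contMDiffAt_of_mem_maximalAtlas hφ hx) hY hY',
      ContinuousLinearMap.comp_add]
    rfl
  leibniz hY hg hx := by
    ext v
    apply mvfderiv_injective hφ hx
    rw [mvfderiv_flatDeriv hφ hx,
      mvfderiv_mvfderiv_smul (contMDiffAt_of_mem_maximalAtlas hφ hx) hg hY]
    simp [mvfderiv_flatDeriv hφ hx]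

theorem flatDeriv_sub_eq_mlieBracket [CompleteSpace E]
    (hφ : φ ∈ IsManifold.maximalAtlas 𝓘(ℝ, E) ∞ M) (hx : x ∈ φ.source)
    {X Y : ∀ x : M, TangentSpace 𝓘(ℝ, E) x}
    (hX : MDifferentiableAt 𝓘(ℝ, E) 𝓘(ℝ, E).tangent (fun y => TotalSpace.mk' E y (X y)) x)
    (hY : MDifferentiableAt 𝓘(ℝ, E) 𝓘(ℝ, E).tangent (fun y => TotalSpace.mk' E y (Y y)) x) :
    flatDeriv φ Y x (X x) - flatDeriv φ X x (Y x) = VectorField.mlieBracket 𝓘(ℝ, E) X Y x := by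
  apply mvfderiv_injective hφ hx
  rw [map_sub, mvfderiv_flatDeriv hφ hx, mvfderiv_flatDeriv hφ hx, mvfderiv_mlieBracket hφ hx hX hY]

variable [FiniteDimensional ℝ E]

theorem contMDiffAt_flatDeriv (hφ : φ ∈ IsManifold.maximalAtlas 𝓘(ℝ, E) ∞ M)
    (hx : x ∈ φ.source) {Y : ∀ x : M, TangentSpace 𝓘(ℝ, E) x}
    (hY : ContMDiffAt 𝓘(ℝ, E) 𝓘(ℝ, E).tangent ∞ (fun y => TotalSpace.mk' E y (Y y)) x) :
    ContMDiffAt 𝓘(ℝ, E) (𝓘(ℝ, E).prod 𝓘(ℝ, E →L[ℝ] E)) ∞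
      (fun y => TotalSpace.mk' (E →L[ℝ] E)
        (E := fun y : M => TangentSpace 𝓘(ℝ, E) y →L[ℝ] TangentSpace 𝓘(ℝ, E) y) y
          (flatDeriv φ Y y)) x := by
  have : CompleteSpace E := FiniteDimensional.complete ℝ E
  refine contMDiffAt_endomorphism_of_chartField fun e => ?_
  exact contMDiffAt_chartField_apply hφ hx (contMDiffAt_mvfderiv_apply
    (contMDiffAt_mvfderiv_apply (contMDiffAt_of_mem_maximalAtlas hφ hx) hY)
    (contMDiffAt_chartField (IsManifold.chart_mem_maximalAtlas x) (mem_chart_source E x) e))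

theorem contMDiffAt_oneFormChartRep (hφ : φ ∈ IsManifold.maximalAtlas 𝓘(ℝ, E) ∞ M)
    (hx : x ∈ φ.source) {ξ : ∀ x : M, TangentSpace 𝓘(ℝ, E) x →L[ℝ] ℝ} (hξ : IsSmoothOneForm ξ) :
    ContMDiffAt 𝓘(ℝ, E) 𝓘(ℝ, E →L[ℝ] ℝ) ∞ (oneFormChartRep φ ξ) x := by
  have : CompleteSpace E := FiniteDimensional.complete ℝ E
  refine contMDiffAt_clm_of_apply fun e => ?_
  have h := (hξ x).clm_bundle_apply (F₁ := E) (F₂ := ℝ)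
    (E₁ := (TangentSpace 𝓘(ℝ, E) : M → Type _)) (E₂ := Bundle.Trivial M ℝ) (b := id)
    (v := chartField φ e) (contMDiffAt_chartField hφ hx e)
  exact ((contMDiffAt_totalSpace).1 h).2

theorem flatDualDeriv_apply (hφ : φ ∈ IsManifold.maximalAtlas 𝓘(ℝ, E) ∞ M) (hx : x ∈ φ.source)
    {ξ : ∀ x : M, TangentSpace 𝓘(ℝ, E) x →L[ℝ] ℝ} (hξ : IsSmoothOneForm ξ)
    (v : TangentSpace 𝓘(ℝ, E) x) {Y : ∀ x : M, TangentSpace 𝓘(ℝ, E) x}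
    (hY : MDifferentiableAt 𝓘(ℝ, E) 𝓘(ℝ, E).tangent (fun y => TotalSpace.mk' E y (Y y)) x) :
    flatDualDeriv φ ξ x v (Y x) =
      mvfderiv 𝓘(ℝ, E) (fun y => ξ y (Y y)) x v - ξ x (flatDeriv φ Y x v) := by
  have hcongr : (fun y => ξ y (Y y)) =ᶠ[𝓝 x]
      fun y => oneFormChartRep φ ξ y (mvfderiv 𝓘(ℝ, E) φ y (Y y)) := by
    filter_upwards [φ.open_source.mem_nhds hx] with y hy
    exact (DFunLike.congr_fun (oneFormChartRep_comp_mvfderiv hφ hy ξ) (Y y)).symm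
  have hflat : ξ x (flatDeriv φ Y x v) = oneFormChartRep φ ξ x
      (mvfderiv 𝓘(ℝ, E) (fun y => mvfderiv 𝓘(ℝ, E) φ y (Y y)) x v) := rfl
  rw [mvfderiv_congr hcongr, hflat, mvfderiv_clm_apply
    ((contMDiffAt_oneFormChartRep hφ hx hξ).mdifferentiableAt (by simp))
    (mdifferentiableAt_mvfderiv_apply (contMDiffAt_of_mem_maximalAtlas hφ hx) hY)]
  exact (add_sub_cancel_right _ _).symm

theorem Bivector.IsConstantIn.flatDeriv_apply {Θ : Bivector E M} {C : (E →L[ℝ] ℝ) →L[ℝ] E}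
    (hC : Θ.IsConstantIn φ C) (hφ : φ ∈ IsManifold.maximalAtlas 𝓘(ℝ, E) ∞ M) (hx : x ∈ φ.source)
    {ξ : ∀ x : M, TangentSpace 𝓘(ℝ, E) x →L[ℝ] ℝ} (hξ : IsSmoothOneForm ξ)
    (v : TangentSpace 𝓘(ℝ, E) x) :
    flatDeriv φ (fun y => Θ.toFun y (ξ y)) x v = Θ.toFun x (flatDualDeriv φ ξ x v) := by
  have hcongr : (fun y => mvfderiv 𝓘(ℝ, E) φ y (Θ.toFun y (ξ y))) =ᶠ[𝓝 x]
      C ∘ oneFormChartRep φ ξ := by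
    filter_upwards [φ.open_source.mem_nhds hx] with y hy
    rw [Function.comp_apply, ← hC y hy, Θ.chartRep_apply_of_mem hy,
      oneFormChartRep_comp_mvfderiv hφ hy]
  apply mvfderiv_injective hφ hx
  rw [mvfderiv_flatDeriv hφ hx, mvfderiv_congr hcongr, mvfderiv_vector_comp C.differentiableAt
    ((contMDiffAt_oneFormChartRep hφ hx hξ).mdifferentiableAt (by simp)), C.fderiv, flatDualDeriv,
    ← Θ.chartRep_apply_of_mem hx, hC x hx]
  rfl

end FlatConnections

section Gluing

variable {E : Type*} [NormedAddCommGroup E] [NormedSpace ℝ E]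
  {M : Type*} [TopologicalSpace M] [ChartedSpace E M] {ι : Type*}

/-- The combination of the operators `D i`, thought of as connections given on parts of `M`, with
coefficients from a partition of unity. -/
def gluedDeriv (ρ : SmoothPartitionOfUnity ι 𝓘(ℝ, E) M)
    (D : ι → (∀ x : M, TangentSpace 𝓘(ℝ, E) x) →
      ∀ x : M, TangentSpace 𝓘(ℝ, E) x →L[ℝ] TangentSpace 𝓘(ℝ, E) x)
    (Y : ∀ x : M, TangentSpace 𝓘(ℝ, E) x) (x : M) :
    TangentSpace 𝓘(ℝ, E) x →L[ℝ] TangentSpace 𝓘(ℝ, E) x :=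
  ∑ i ∈ ρ.finsupport x, ρ i x • D i Y x

variable {ρ : SmoothPartitionOfUnity ι 𝓘(ℝ, E) M}
  {D : ι → (∀ x : M, TangentSpace 𝓘(ℝ, E) x) →
    ∀ x : M, TangentSpace 𝓘(ℝ, E) x →L[ℝ] TangentSpace 𝓘(ℝ, E) x}
  {U : ι → Set M}

theorem mem_of_mem_finsupport (hρ : ρ.IsSubordinate U) {x : M} {i : ι}
    (hi : i ∈ ρ.finsupport x) : x ∈ U i :=
  hρ i (subset_tsupport _ ((ρ.mem_finsupport x).1 hi))

theorem gluedDeriv_apply (Y : ∀ x : M, TangentSpace 𝓘(ℝ, E) x) (x : M)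
    (v : TangentSpace 𝓘(ℝ, E) x) :
    gluedDeriv ρ D Y x v = ∑ i ∈ ρ.finsupport x, ρ i x • D i Y x v := by
  simp only [gluedDeriv, sum_apply, smul_apply]

theorem isCovariantDerivativeOn_gluedDeriv [IsManifold 𝓘(ℝ, E) ∞ M] (hρ : ρ.IsSubordinate U)
    (hD : ∀ i, IsCovariantDerivativeOn (I := 𝓘(ℝ, E)) E
      (V := (TangentSpace 𝓘(ℝ, E) : M → Type _)) (D i) (U i)) :
    IsCovariantDerivativeOn (I := 𝓘(ℝ, E)) E
      (V := (TangentSpace 𝓘(ℝ, E) : M → Type _)) (gluedDeriv ρ D) univ where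
  add {Y Y' x} hY hY' _ := by
    rw [gluedDeriv, gluedDeriv, gluedDeriv, ← Finset.sum_add_distrib]
    refine Finset.sum_congr rfl fun i hi => ?_
    rw [(hD i).add hY hY' (mem_of_mem_finsupport hρ hi), smul_add]
  leibniz {Y g x} hY hg _ := by
    have hsum : ∑ i ∈ ρ.finsupport x, ρ i x = 1 := ρ.sum_finsupport x (mem_univ x)
    rw [gluedDeriv, gluedDeriv, Finset.sum_congr rfl fun i hi => by
        rw [(hD i).leibniz hY hg (mem_of_mem_finsupport hρ hi), smul_add],
      Finset.sum_add_distrib, ← Finset.sum_smul, hsum, one_smul, Finset.smul_sum]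
    simp only [smul_comm (g x)]

theorem gluedDeriv_sub_eq_mlieBracket (hρ : ρ.IsSubordinate U)
    {X Y : ∀ x : M, TangentSpace 𝓘(ℝ, E) x} {x : M}
    (hD : ∀ i, x ∈ U i →
      D i Y x (X x) - D i X x (Y x) = VectorField.mlieBracket 𝓘(ℝ, E) X Y x) :
    gluedDeriv ρ D Y x (X x) - gluedDeriv ρ D X x (Y x) =
      VectorField.mlieBracket 𝓘(ℝ, E) X Y x := by
  have hsum : ∑ i ∈ ρ.finsupport x, ρ i x = 1 := ρ.sum_finsupport x (mem_univ x)
  rw [gluedDeriv_apply, gluedDeriv_apply, ← Finset.sum_sub_distrib,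
    Finset.sum_congr rfl fun i hi => by rw [← smul_sub, hD i (mem_of_mem_finsupport hρ hi)],
    ← Finset.sum_smul, hsum, one_smul]

theorem contMDiff_gluedDeriv [IsManifold 𝓘(ℝ, E) ∞ M] (hρ : ρ.IsSubordinate U)
    (hU : ∀ i, IsOpen (U i)) {Y : ∀ x : M, TangentSpace 𝓘(ℝ, E) x}
    (hD : ∀ i, ∀ x ∈ U i, ContMDiffAt 𝓘(ℝ, E) (𝓘(ℝ, E).prod 𝓘(ℝ, E →L[ℝ] E)) ∞
      (fun y => TotalSpace.mk' (E →L[ℝ] E)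
        (E := fun y : M => TangentSpace 𝓘(ℝ, E) y →L[ℝ] TangentSpace 𝓘(ℝ, E) y) y (D i Y y)) x) :
    ContMDiff 𝓘(ℝ, E) (𝓘(ℝ, E).prod 𝓘(ℝ, E →L[ℝ] E)) ∞
      (fun y => TotalSpace.mk' (E →L[ℝ] E)
        (E := fun y : M => TangentSpace 𝓘(ℝ, E) y →L[ℝ] TangentSpace 𝓘(ℝ, E) y) y
          (gluedDeriv ρ D Y y)) := by
  have hzero : ∀ {i : ι} {x : M}, ρ i x = 0 → ρ i x • D i Y x = 0 := fun h => by
    rw [h]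
    exact zero_smul ℝ _
  have hfinsum := ContMDiff.finsum_section_of_locallyFinite (𝕜 := ℝ) (I := 𝓘(ℝ, E)) (n := ∞)
    (F := E →L[ℝ] E) (V := fun y : M => TangentSpace 𝓘(ℝ, E) y →L[ℝ] TangentSpace 𝓘(ℝ, E) y)
    (t := fun i x => ρ i x • D i Y x)
    (ρ.locallyFinite.subset fun i x hx hx' => hx (hzero hx'))
    fun i => ContMDiffOn.smul_section_of_tsupport (F := E →L[ℝ] E)
      (V := fun y : M => TangentSpace 𝓘(ℝ, E) y →L[ℝ] TangentSpace 𝓘(ℝ, E) y)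
      (ρ i).contMDiff.contMDiffOn (hU i) (hρ i) fun y hy => (hD i y hy).contMDiffWithinAt
  convert hfinsum using 3 with x
  refine (finsum_eq_sum_of_support_subset _ fun i hi => ?_).symm
  rw [SmoothPartitionOfUnity.coe_finsupport]
  exact fun h => hi (hzero h)

variable [FiniteDimensional ℝ E] [IsManifold 𝓘(ℝ, E) ∞ M]

theorem exists_mdifferentiableAt_apply_eq (x : M) (w : TangentSpace 𝓘(ℝ, E) x) :
    ∃ Y : ∀ x : M, TangentSpace 𝓘(ℝ, E) x,
      MDifferentiableAt 𝓘(ℝ, E) 𝓘(ℝ, E).tangent (fun y => TotalSpace.mk' E y (Y y)) x ∧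
        Y x = w := by
  have : CompleteSpace E := FiniteDimensional.complete ℝ E
  exact ⟨chartField (chartAt E x) (mvfderiv 𝓘(ℝ, E) (chartAt E x) x w),
    mdifferentiableAt_chartField (IsManifold.chart_mem_maximalAtlas x) (mem_chart_source E x) _,
    chartField_mvfderiv (IsManifold.chart_mem_maximalAtlas x) (mem_chart_source E x) w⟩

theorem dualDeriv_eq_sum_flatDualDeriv
    {cov : CovariantDerivative 𝓘(ℝ, E) E (TangentSpace 𝓘(ℝ, E) : M → Type _)}
    {φ : ι → OpenPartialHomeomorph M E} (hφ : ∀ i, φ i ∈ IsManifold.maximalAtlas 𝓘(ℝ, E) ∞ M)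
    (hρ : ρ.IsSubordinate fun i => (φ i).source)
    (hcov : ∀ Y x, cov Y x = gluedDeriv ρ (fun i => flatDeriv (φ i)) Y x)
    {ξ : ∀ x : M, TangentSpace 𝓘(ℝ, E) x →L[ℝ] ℝ} (hξ : IsSmoothOneForm ξ) (x : M)
    (v : TangentSpace 𝓘(ℝ, E) x) :
    dualDeriv cov ξ hξ x v = ∑ i ∈ ρ.finsupport x, ρ i x • flatDualDeriv (φ i) ξ x v := by
  ext w
  obtain ⟨Y, hY, rfl⟩ := exists_mdifferentiableAt_apply_eq x w
  have hsum : ∑ i ∈ ρ.finsupport x, ρ i x = 1 := ρ.sum_finsupport x (mem_univ x)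
  calc dualDeriv cov ξ hξ x v (Y x)
      = mvfderiv 𝓘(ℝ, E) (fun y => ξ y (Y y)) x v - ξ x (cov Y x v) := dualDeriv_apply hξ v hY
    _ = ∑ i ∈ ρ.finsupport x,
          ρ i x • (mvfderiv 𝓘(ℝ, E) (fun y => ξ y (Y y)) x v - ξ x (flatDeriv (φ i) Y x v)) := by
        simp only [hcov, gluedDeriv_apply, map_sum, map_smul, smul_sub, Finset.sum_sub_distrib,
          ← Finset.sum_smul, hsum, one_smul]
    _ = ∑ i ∈ ρ.finsupport x, ρ i x • flatDualDeriv (φ i) ξ x v (Y x) :=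
        Finset.sum_congr rfl fun i hi => by
          rw [flatDualDeriv_apply (hφ i) (mem_of_mem_finsupport hρ hi) hξ v hY]
    _ = (∑ i ∈ ρ.finsupport x, ρ i x • flatDualDeriv (φ i) ξ x v) (Y x) := by
        simp only [sum_apply, smul_apply]

theorem Bivector.isParallel_of_eq_gluedDeriv {Θ : Bivector E M}
    {cov : CovariantDerivative 𝓘(ℝ, E) E (TangentSpace 𝓘(ℝ, E) : M → Type _)}
    {φ : ι → OpenPartialHomeomorph M E} {C : ι → (E →L[ℝ] ℝ) →L[ℝ] E}
    (hφ : ∀ i, φ i ∈ IsManifold.maximalAtlas 𝓘(ℝ, E) ∞ M) (hC : ∀ i, Θ.IsConstantIn (φ i) (C i))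
    (hρ : ρ.IsSubordinate fun i => (φ i).source)
    (hcov : ∀ Y x, cov Y x = gluedDeriv ρ (fun i => flatDeriv (φ i)) Y x) :
    Θ.IsParallel cov := by
  intro ξ hξ x v
  rw [dualDeriv_eq_sum_flatDualDeriv hφ hρ hcov, hcov, gluedDeriv_apply, map_sum]
  refine Finset.sum_congr rfl fun i hi => ?_
  rw [(hC i).flatDeriv_apply (hφ i) (mem_of_mem_finsupport hρ hi) hξ, map_smul]

theorem Bivector.IsLocallyConstant.isIntegrable [T2Space M] [SecondCountableTopology M]
    {Θ : Bivector E M} (h : Θ.IsLocallyConstant) : Θ.IsIntegrable := by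
  have : CompleteSpace E := FiniteDimensional.complete ℝ E
  have : LocallyCompactSpace M := ChartedSpace.locallyCompactSpace E M
  choose φ hφ hxφ C hC using h.exists_isConstantIn
  have hsource : ∀ x, IsOpen (φ x).source := fun x => (φ x).open_source
  obtain ⟨ρ, hρ⟩ := SmoothPartitionOfUnity.exists_isSubordinate 𝓘(ℝ, E) (s := (univ : Set M))
    isClosed_univ (fun x => (φ x).source) hsource fun x _ => mem_iUnion.2 ⟨x, hxφ x⟩
  let cov : CovariantDerivative 𝓘(ℝ, E) E (TangentSpace 𝓘(ℝ, E) : M → Type _) :=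
    ⟨gluedDeriv ρ fun i => flatDeriv (φ i),
      isCovariantDerivativeOn_gluedDeriv hρ fun i => isCovariantDerivativeOn_flatDeriv (hφ i)⟩
  refine ⟨cov, ⟨⟨fun {Y} hY => ?_⟩⟩, ?_, isParallel_of_eq_gluedDeriv hφ hC hρ fun _ _ => rfl⟩
  · rw [contMDiffOn_univ] at hY ⊢
    exact contMDiff_gluedDeriv hρ hsource fun i x hx => contMDiffAt_flatDeriv (hφ i) hx (hY x)
  · rw [CovariantDerivative.torsion_eq_zero_iff]
    intro X Y x hX hY
    exact gluedDeriv_sub_eq_mlieBracket hρ fun i hx =>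
      flatDeriv_sub_eq_mlieBracket (hφ i) hx hX hY

end Gluing

end BivectorFields

end

theorem propositionF {E : Type*} [NormedAddCommGroup E] [NormedSpace ℝ E] [FiniteDimensional ℝ E]
    {M : Type*} [TopologicalSpace M] [ChartedSpace E M] [IsManifold 𝓘(ℝ, E) ∞ M]
    [T2Space M] [SecondCountableTopology M]
    (Θ : BivectorFields.Bivector E M) (hΘ : Θ.HasConstantRank) :
    (Θ.IsLocallyConstant ↔ Θ.IsIntegrable) ∧
    (Θ.IsIntegrable ↔
      BivectorFields.IsIntegrableDistribution Θ.image ∧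
        ∀ x : M, Θ.InverseClosedAlong (BivectorFields.leaf Θ.image x)) := by
  have hlc := Θ.isLocallyConstant_of_jacobiAt hΘ
  have hba : Θ.IsIntegrable → Θ.IsLocallyConstant := fun ⟨_, _, ht, hp⟩ =>
    hlc fun _ hφ _ hx => BivectorFields.Bivector.jacobiAt_of_isParallel ht hp hφ hx
  refine ⟨⟨fun h => h.isIntegrable, hba⟩, fun h => ?_, fun ⟨hI, hclosed⟩ => ?_⟩
  · exact ⟨(hba h).isIntegrableDistribution, fun x => (hba h).inverseClosedAlong _⟩
  · exact (hlc fun _ hφ _ hx => Θ.jacobiAt_of_inverseClosedAlong hI hclosed hφ hx).isIntegrable
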